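/- Let $W$ be a compact closed $3$-manifold and $L\subset W$ a non-empty link. A triangulation $T$ of $W$ is a finite family of abstract tetrahedra with their $2$-faces glued in pairs (singular triangulations are allowed), with quotient $W$; $E_\Delta(T)$ is the set of all edges of the abstract tetrahedra, $E(T)$ the set of edges of $T$, and $\epsilon_T:E_\Delta(T)\to E(T)$ the identification map. A distinguished triangulation of $(W,L)$ is a pair $(T,H)$, where $H$ is a subcomplex of the $1$-skeleton of $T$ which realizes $L$ and contains all vertices of $T$. A rough charge on $T$ is a map $c:E_\Delta(T)\to\mathbb Z$ such that on every abstract tetrahedron opposite edges have the same value and the values on three edges with a common vertex add up to $1$. A rough charge $c$ is an integral charge on $(T,H)$ if moreover: (1) $\sum_{e'\in\epsilon_T^{-1}(e)}c(e')=2$ for every $e\in E(T)\setminus E(H)$, and $\sum_{e'\in\epsilon_T^{-1}(e)}c(e')=0$ for every $e\in E(H)$; (2) for every closed curve $s$ in general position with respect to $T$ without back-tracking (in each tetrahedron it passes through, it departs through a face different from the one by which it entered), the sum $c(s)$ of the values of $c$ on the edges between the entering and the departing faces is even. A distinguished move $(T_1,H_1)\to(T_2,H_2)$ is one of the following moves or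 its inverse. - $2\to3$: two distinct tetrahedra with a common face, forming a bipyramid, are replaced by three tetrahedra around a new edge joining the poles of the bipyramid; $H_2=H_1$ (so the new edge is not in $H_2$). - $0\to2$: $T_1$ is cut open along two $2$-faces with a common edge $e_0$, and the hole is filled by two tetrahedra $\Delta',\Delta''$ glued to each other along two faces. Thus $e_0$ is split into two edges $e'$ of $\Delta'$ and $e''$ of $\Delta''$, both opposite to the new interior edge; $H_2=H_1$, where $e_0$ is regarded as $e'$; the edge $e''$ and the new interior edge are not in $H_2$. - bubble: a $2$-face $f$ with an edge $e$ in $H_1$ is replaced by two tetrahedra $\Delta',\Delta''$ glued to each other along three faces which contain a new vertex; $H_2$ is obtained from $H_1$ by replacing $e$ by the other two edges of the new face containing $e$. A rough charge $c_1$ on $T_1$ transits to a rough charge $c_2$ on $T_2$ along such a move if they agree on all tetrahedra not involved in the move and: - for $2\to3$: for each of the nine edges common to the two decompositions of the bipyramid, the sum of the values of $c_1$ over the two old tetrahedra containing it equals the sum of the values of $c_2$ over the three new ones containing it; - for $0\to2$: the sum of the charges around every edge of $T_1$ equals the sum around the corresponding edge of $T_2$; that is, $c_2|_{\Delta'}+c_2|_{\Delta''}=0$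 along each of the four edges which $\Delta',\Delta''$ share other than the new interior one, and the sum of $c_1$ around $e_0$ equals the sum of $c_2$ around $e'$; - for a bubble move: $c_2|_{\Delta'}+c_2|_{\Delta''}$ is $0$ along the two new edges of $H_2$ and the edges opposite to them, $2$ along the third new edge, and $2$ along the former edge $e$ of $H_1$; - for an inverse move: $c_2$ transits to $c_1$ along the positive move. **Lemma.** Let $(T_1,H_1)\to(T_2,H_2)$ be any distinguished move between distinguished triangulations of $(W,L)$. Let $c_1$ be an integral charge on $(T_1,H_1)$ which transits to a rough charge $c_2$ on $T_2$. Then $c_2$ is an integral charge on $(T_2,H_2)$. -/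

import Mathlib

open scoped BigOperators

namespace ChargedTri

section Triangulations

/-- An ordered `2`-face of a family of abstract tetrahedra indexed by `τ`: a tetrahedron `tet`,
with vertex set `Fin 4`, together with three distinct vertices of it, in a chosen order. -/
@[ext]
structure OrdTri (τ : Type*) where
  tet : τ
  vert : Fin 3 ↪ Fin 4

/-- The set `E_Δ` of all edges of the abstract tetrahedra indexed by `τ`: an edge is a
tetrahedron together with an unordered pair of distinct vertices. -/
abbrev AbsEdge (τ : Type*) := τ × {e : Sym2 (Fin 4) // ¬ e.IsDiag}

/-- The edge `{a, b}` of the abstract tetrahedron `t`. -/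
def absEdge {τ : Type*} (t : τ) (a b : Fin 4) (h : a ≠ b) : AbsEdge τ :=
  (t, ⟨s(a, b), h⟩)

/-- The same `2`-face with its vertices listed in another order. -/
def OrdTri.reorder {τ : Type*} (x : OrdTri τ) (π : Equiv.Perm (Fin 3)) : OrdTri τ :=
  ⟨x.tet, π.toEmbedding.trans x.vert⟩

/-- The edge joining the first two vertices of an ordered `2`-face. -/
def OrdTri.edge {τ : Type*} (x : OrdTri τ) : AbsEdge τ :=
  absEdge x.tet (x.vert 0) (x.vert 1) (x.vert.injective.ne (by decide))

/-- A (possibly singular) triangulation, as a family of abstract tetrahedra indexed by `τ`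
whose `2`-faces are glued in pairs by affine identifications. The face with ordered vertices `x`
is glued to the one with ordered vertices `glue x`, the `i`-th vertex going to the `i`-th vertex.
No face is glued to itself. -/
structure Triangulation (τ : Type*) where
  glue : OrdTri τ → OrdTri τ
  glue_glue : ∀ x, glue (glue x) = x
  glue_reorder : ∀ x π, glue (x.reorder π) = (glue x).reorder π
  glue_ne : ∀ x π, glue x ≠ x.reorder π

namespace Triangulation

variable {τ : Type*} (T : Triangulation τ)

/-- Edges of abstract tetrahedra which are directly identified by a gluing of two faces. -/
inductive EdgeRel : AbsEdge τ → AbsEdge τ → Prop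
  | glue (x : OrdTri τ) : EdgeRel x.edge (T.glue x).edge

/-- The set `E(T)` of edges of the triangulation. -/
def Edge : Type _ := Quot T.EdgeRel

/-- The natural identification map `E_Δ(T) → E(T)`. -/
def proj (e : AbsEdge τ) : T.Edge := Quot.mk _ e

/-- Points of the abstract tetrahedra which are directly identified by a gluing of two faces:
the point with barycentric coordinates `w` in a face and the point with the same
coordinates in the face glued to it. -/
inductive PointRel : (Σ _ : τ, stdSimplex ℝ (Fin 4)) → (Σ _ : τ, stdSimplex ℝ (Fin 4)) → Prop
  | glue (x : OrdTri τ) (w : stdSimplex ℝ (Fin 3)) :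
      PointRel ⟨x.tet, stdSimplex.map x.vert w⟩
        ⟨(T.glue x).tet, stdSimplex.map (T.glue x).vert w⟩

/-- The topological space obtained by gluing the tetrahedra (with the quotient topology). -/
abbrev Realization : Type _ := Quot T.PointRel

/-- The union in the realization of the (closed) edges belonging to `H`. -/
def realizationOf (H : Set T.Edge) : Set T.Realization :=
  {P | ∃ (e : AbsEdge τ) (w : stdSimplex ℝ (Fin 4)), T.proj e ∈ H ∧
    (∀ v, v ∉ e.2.1 → w v = 0) ∧ P = Quot.mk _ ⟨e.1, w⟩}

/-- `(T, H)` is a distinguished triangulation of `(W, L)`: the realization of `T` is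
homeomorphic to `W` by a homeomorphism taking the subcomplex of the `1`-skeleton with set of edges
`H` onto the link `L`, and `H` is Hamiltonian, i.e. it contains all the vertices of `T`. -/
structure IsDistinguished (H : Set T.Edge) {W : Type*} [TopologicalSpace W] (L : Set W) :
    Prop where
  realizes : ∃ h : T.Realization ≃ₜ W, h '' T.realizationOf H = L
  hamiltonian : ∀ (t : τ) (v : Fin 4),
    (Quot.mk _ ⟨t, stdSimplex.vertex v⟩ : T.Realization) ∈ T.realizationOf H

/-- The edge `{a, b}` of the tetrahedron `t` is mapped to an edge of `T` belonging to `H`. -/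
def EdgeIn (H : Set T.Edge) (t : τ) (a b : Fin 4) : Prop :=
  ∃ h : a ≠ b, T.proj (absEdge t a b h) ∈ H

end Triangulation

/-- A non-empty link in `W`: a disjoint union of finitely many (at least one) embedded circles. -/
def IsLink {W : Type*} [TopologicalSpace W] (L : Set W) : Prop :=
  ∃ (k : ℕ) (f : Fin (k + 1) × Circle → W), Topology.IsEmbedding f ∧ Set.range f = L

end Triangulations

section Charges

/-- The value of `c` on the edge `{a, b}` of `t` (and `0` if `a = b`). -/
def chargeAt {τ : Type*} (c : AbsEdge τ → ℤ) (t : τ) (a b : Fin 4) : ℤ :=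
  if h : a ≠ b then c (absEdge t a b h) else 0

/-- A rough charge: on each abstract tetrahedron `c` is an integral charge, i.e. opposite edges
have the same charge and the charges of three edges with a common vertex add up to `1`. -/
def IsRoughCharge {τ : Type*} (c : AbsEdge τ → ℤ) : Prop :=
  ∀ (t : τ) (p : Equiv.Perm (Fin 4)),
    chargeAt c t (p 0) (p 1) = chargeAt c t (p 2) (p 3) ∧
    chargeAt c t (p 0) (p 1) + chargeAt c t (p 0) (p 2) + chargeAt c t (p 0) (p 3) = 1

/-- The sum of the charges around an edge `e` of `T`, i.e. over the fibre of
`E_Δ(T) → E(T)` at `e`. -/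
noncomputable def edgeSum {τ : Type*} [Fintype τ] (T : Triangulation τ) (c : AbsEdge τ → ℤ)
    (e : T.Edge) : ℤ :=
  open Classical in ∑ e' : AbsEdge τ with T.proj e' = e, c e'

/-- A closed curve without back-tracking with respect to `T`, recorded by the cyclic sequence of
the tetrahedra it passes through. In the `i`-th tetrahedron it enters through the face `enter i`
and departs through the different face `depart i`; the two faces are ordered so that their first
two vertices are those of the edge between them, the edge selected by the curve. -/
structure Curve {τ : Type*} (T : Triangulation τ) where
  n : ℕ
  enter : Fin (n + 1) → OrdTri τ
  depart : Fin (n + 1) → OrdTri τ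
  same_tet : ∀ i, (enter i).tet = (depart i).tet
  vert_zero : ∀ i, (enter i).vert 0 = (depart i).vert 0
  vert_one : ∀ i, (enter i).vert 1 = (depart i).vert 1
  vert_two : ∀ i, (enter i).vert 2 ≠ (depart i).vert 2
  /-- The curve departs through the face by which it enters the next tetrahedron
  (cyclically: `i + 1 = 0` for the last index `i`). -/
  next : ∀ i, ∃ π : Equiv.Perm (Fin 3), T.glue (depart i) = (enter (i + 1)).reorder π

/-- The sum of the charges of the edges selected by a curve. -/
def Curve.charge {τ : Type*} {T : Triangulation τ} (s : Curve T) (c : AbsEdge τ → ℤ) : ℤ :=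
  ∑ i, c (s.enter i).edge

/-- An integral charge on `(T, H)`. -/
structure IsIntegralCharge {τ : Type*} [Fintype τ] (T : Triangulation τ) (H : Set T.Edge)
    (c : AbsEdge τ → ℤ) : Prop where
  rough : IsRoughCharge c
  sum_of_notMem : ∀ e, e ∉ H → edgeSum T c e = 2
  sum_of_mem : ∀ e, e ∈ H → edgeSum T c e = 0
  curve : ∀ s : Curve T, s.charge c ≡ 0 [ZMOD 2]

end Charges

section TwoThree

/-! The standard bipyramid has vertices `0, 1, 2, 3, 4`, with poles `1, 3` and equator `0, 2, 4`.
Denote by `Δ i` the tetrahedron whose vertices are those different from `i`. The bipyramid is the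
union of `Δ 1` and `Δ 3`, and also the union of `Δ 0`, `Δ 2` and `Δ 4`. -/

/-- The two poles. -/
abbrev Pole := {i : Fin 5 // i = 1 ∨ i = 3}

/-- The three vertices on the equator. -/
abbrev Equator := {i : Fin 5 // ¬ (i = 1 ∨ i = 3)}

/-- Tetrahedra `tet₁ k` in the role of `Δ 1, Δ 3` and tetrahedra `tet₂ j` in the role of
`Δ 0, Δ 2, Δ 4`, with their vertices labelled, and a bijection `common` between the remaining
tetrahedra. Here `lab₁ k l` is the vertex of `tet₁ k` with label `l ≠ k`. -/
structure BipyramidPair (τ₁ τ₂ : Type*) where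
  tet₁ : Pole → τ₁
  tet₂ : Equator → τ₂
  lab₁ : Pole → Fin 5 → Fin 4
  lab₂ : Equator → Fin 5 → Fin 4
  tet₁_injective : Function.Injective tet₁
  tet₂_injective : Function.Injective tet₂
  lab₁_injOn : ∀ k, Set.InjOn (lab₁ k) {k.1}ᶜ
  lab₂_injOn : ∀ j, Set.InjOn (lab₂ j) {j.1}ᶜ
  common : {t : τ₁ // t ∉ Set.range tet₁} ≃ {t : τ₂ // t ∉ Set.range tet₂}

/-- The correspondence between the ordered `2`-faces outside the interior of the two bipyramids:
faces of the remaining tetrahedra, and boundary faces of the bipyramids. The boundary face with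
vertices different from `k` (a pole) and `j` (on the equator) lies in `tet₁ k` and in `tet₂ j`. -/
inductive BipyramidPair.Corr {τ₁ τ₂ : Type*} (B : BipyramidPair τ₁ τ₂) :
    OrdTri τ₁ → OrdTri τ₂ → Prop
  | common (t : {t : τ₁ // t ∉ Set.range B.tet₁}) (u : Fin 3 ↪ Fin 4) :
      B.Corr ⟨t.1, u⟩ ⟨(B.common t).1, u⟩
  | boundary (k : Pole) (j : Equator) (l : Fin 3 → Fin 5) (u v : Fin 3 ↪ Fin 4)
      (hl : ∀ i, l i ≠ k.1 ∧ l i ≠ j.1)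
      (hu : ∀ i, u i = B.lab₁ k (l i)) (hv : ∀ i, v i = B.lab₂ j (l i)) :
      B.Corr ⟨B.tet₁ k, u⟩ ⟨B.tet₂ j, v⟩

variable {τ₁ τ₂ : Type*}

/-- A `2 → 3` move `T₁ → T₂`: two distinct tetrahedra of `T₁` with a common face
are replaced by three tetrahedra around a new edge, the one with labels `1, 3`. -/
structure TwoThreeMove (T₁ : Triangulation τ₁) (T₂ : Triangulation τ₂)
    extends BipyramidPair τ₁ τ₂ where
  inner₁ : ∀ (k k' : Pole) (l : Fin 3 → Fin 5) (u v : Fin 3 ↪ Fin 4), k ≠ k' →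
    (∀ i, l i ≠ k.1 ∧ l i ≠ k'.1) → (∀ i, u i = lab₁ k (l i)) → (∀ i, v i = lab₁ k' (l i)) →
    T₁.glue ⟨tet₁ k, u⟩ = ⟨tet₁ k', v⟩
  inner₂ : ∀ (j j' : Equator) (l : Fin 3 → Fin 5) (u v : Fin 3 ↪ Fin 4), j ≠ j' →
    (∀ i, l i ≠ j.1 ∧ l i ≠ j'.1) → (∀ i, u i = lab₂ j (l i)) → (∀ i, v i = lab₂ j' (l i)) →
    T₂.glue ⟨tet₂ j, u⟩ = ⟨tet₂ j', v⟩
  outer : ∀ x y, toBipyramidPair.Corr x y → toBipyramidPair.Corr (T₁.glue x) (T₂.glue y)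

/-- The `2 → 3` move is a distinguished move `(T₁, H₁) → (T₂, H₂)`: `H₂` is `H₁`, so that the
new edge is not in `H₂`. -/
structure TwoThreeMove.IsDistinguished {T₁ : Triangulation τ₁} {T₂ : Triangulation τ₂}
    (M : TwoThreeMove T₁ T₂) (H₁ : Set T₁.Edge) (H₂ : Set T₂.Edge) : Prop where
  common : ∀ t a b, T₁.EdgeIn H₁ t.1 a b ↔ T₂.EdgeIn H₂ (M.common t).1 a b
  boundary : ∀ (k : Pole) (j : Equator) (a b : Fin 5), a ≠ k.1 → a ≠ j.1 → b ≠ k.1 → b ≠ j.1 →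
    (T₁.EdgeIn H₁ (M.tet₁ k) (M.lab₁ k a) (M.lab₁ k b) ↔
      T₂.EdgeIn H₂ (M.tet₂ j) (M.lab₂ j a) (M.lab₂ j b))
  new : ∀ j, ¬ T₂.EdgeIn H₂ (M.tet₂ j) (M.lab₂ j 1) (M.lab₂ j 3)

/-- Charge transit along a `2 → 3` move (in either direction): the charges agree on the
tetrahedra not involved in the move, and for each edge `{a, b}` common to both decompositions
of the bipyramid the sums over the tetrahedra of the two decompositions agree. -/
structure TwoThreeMove.Transit {T₁ : Triangulation τ₁} {T₂ : Triangulation τ₂}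
    (M : TwoThreeMove T₁ T₂) (c₁ : AbsEdge τ₁ → ℤ) (c₂ : AbsEdge τ₂ → ℤ) : Prop where
  common : ∀ t e, c₁ (t.1, e) = c₂ ((M.common t).1, e)
  sum : ∀ a b : Fin 5, a ≠ b → ¬ ((a = 1 ∨ a = 3) ∧ (b = 1 ∨ b = 3)) →
    ∑ k : Pole with k.1 ≠ a ∧ k.1 ≠ b, chargeAt c₁ (M.tet₁ k) (M.lab₁ k a) (M.lab₁ k b) =
    ∑ j : Equator with j.1 ≠ a ∧ j.1 ≠ b, chargeAt c₂ (M.tet₂ j) (M.lab₂ j a) (M.lab₂ j b)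

end TwoThree

section Insertion

variable {τ₁ τ₂ : Type*}

/-- Two distinct new tetrahedra `tet 0, tet 1`, whose vertices are labelled by `0, 1, 2, 3` in such
a way that `lab d l` is the vertex of `tet d` with label `l`; the remaining tetrahedra
indexed by `τ₂` are those indexed by `τ₁`. -/
structure NewPair (τ₁ τ₂ : Type*) where
  tet : Fin 2 → τ₂
  lab : Fin 2 → Equiv.Perm (Fin 4)
  tet_injective : Function.Injective tet
  common : τ₁ ≃ {t : τ₂ // t ∉ Set.range tet}

namespace NewPair

variable (N : NewPair τ₁ τ₂)

/-- The face of the new tetrahedron `tet d` with ordered labels `m`. -/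
def face (d : Fin 2) (m : Fin 3 ↪ Fin 4) : OrdTri τ₂ :=
  ⟨N.tet d, m.trans (N.lab d).toEmbedding⟩

/-- The edge of the new tetrahedron `tet d` with labels `a, b`. -/
def edge (d : Fin 2) (a b : Fin 4) (h : a ≠ b) : AbsEdge τ₂ :=
  absEdge (N.tet d) (N.lab d a) (N.lab d b) ((N.lab d).injective.ne h)

/-- A face of one of the old tetrahedra, seen after the move. -/
def old (x : OrdTri τ₁) : OrdTri τ₂ := ⟨(N.common x.tet).1, x.vert⟩

/-- An edge of one of the old tetrahedra, seen after the move. -/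
def oldEdge (e : AbsEdge τ₁) : AbsEdge τ₂ := ((N.common e.1).1, e.2)

/-- The sum of the charges of the edges with labels `a, b` of the two new tetrahedra. -/
def sum (c : AbsEdge τ₂ → ℤ) (a b : Fin 4) (h : a ≠ b) : ℤ := ∑ d, c (N.edge d a b h)

/-- `N.Through T₂ u v`: collapse the pillow formed by `tet 0` and `tet 1` (glued along their faces
containing the labels `2, 3`) by identifying the face of `tet 0` and the face of `tet 1` with
the same labels, for the faces containing the labels `0, 1`. Arriving at the face `u`
of `T₂` (after crossing a gluing) one then arrives, having passed through the collapsed pillow as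
long as necessary, at the face `v` of a tetrahedron outside the pillow. -/
inductive Through (T₂ : Triangulation τ₂) : OrdTri τ₂ → OrdTri τ₂ → Prop
  | arrive (x : OrdTri τ₁) : Through T₂ (N.old x) (N.old x)
  | pass (d d' : Fin 2) (m : Fin 3 ↪ Fin 4) (v : OrdTri τ₂) (hd : d ≠ d')
      (h0 : 0 ∈ Set.range m) (h1 : 1 ∈ Set.range m)
      (h : Through T₂ (T₂.glue (N.face d' m)) v) : Through T₂ (N.face d m) v

end NewPair

/-- A `0 → 2` move `T₁ → T₂`: `T₁` is cut open along two `2`-faces with a common edge `e₀`, and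
the resulting hole is filled by two tetrahedra glued to each other along two faces. We use the
labels `0, 1` for the vertices of `e₀` and `2, 3` for the other vertices of the two faces, so that
the new tetrahedra have the common faces `0 2 3` and `1 2 3`, the new interior edge is `2 3`, and
`e₀` is split into the edges `0 1` of the two tetrahedra. Equivalently, as it is formulated
here, `T₁` is obtained from `T₂` by collapsing the pillow formed by the two tetrahedra, which merges
two different edges of `T₂` into `e₀`. -/
structure ZeroTwoMove (T₁ : Triangulation τ₁) (T₂ : Triangulation τ₂)
    extends NewPair τ₁ τ₂ where
  inner : ∀ m : Fin 3 ↪ Fin 4, 2 ∈ Set.range m → 3 ∈ Set.range m →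
    T₂.glue (toNewPair.face 0 m) = toNewPair.face 1 m
  outer : ∀ x : OrdTri τ₁,
    toNewPair.Through T₂ (T₂.glue (toNewPair.old x)) (toNewPair.old (T₁.glue x))
  /-- The two faces persist in `T₁`. -/
  persist : ∀ (d : Fin 2) (m : Fin 3 ↪ Fin 4), 0 ∈ Set.range m → 1 ∈ Set.range m →
    ∃ x : OrdTri τ₁, toNewPair.Through T₂ (T₂.glue (toNewPair.face d m)) (toNewPair.old x)
  e₀ : T₁.Edge
  split_ne : T₂.proj (toNewPair.edge 0 0 1 (by decide)) ≠
    T₂.proj (toNewPair.edge 1 0 1 (by decide))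
  split : ∀ q : AbsEdge τ₁, T₁.proj q = e₀ ↔
    T₂.proj (toNewPair.oldEdge q) = T₂.proj (toNewPair.edge 0 0 1 (by decide)) ∨
    T₂.proj (toNewPair.oldEdge q) = T₂.proj (toNewPair.edge 1 0 1 (by decide))

/-- The `0 → 2` move is a distinguished move `(T₁, H₁) → (T₂, H₂)`: `H₂` is `H₁`. Here `e₀` is
regarded as one of the two edges into which it is split; we call `tet 0` the new
tetrahedron containing that one. The other one, and the new interior edge, are not in `H₂`. -/
structure ZeroTwoMove.IsDistinguished {T₁ : Triangulation τ₁} {T₂ : Triangulation τ₂}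
    (M : ZeroTwoMove T₁ T₂) (H₁ : Set T₁.Edge) (H₂ : Set T₂.Edge) : Prop where
  common : ∀ q : AbsEdge τ₁, T₁.proj q ≠ M.e₀ → (T₁.proj q ∈ H₁ ↔ T₂.proj (M.oldEdge q) ∈ H₂)
  split : M.e₀ ∈ H₁ ↔ T₂.proj (M.edge 0 0 1 (by decide)) ∈ H₂
  new : T₂.proj (M.edge 1 0 1 (by decide)) ∉ H₂
  interior : T₂.proj (M.edge 0 2 3 (by decide)) ∉ H₂

/-- Charge transit along a `0 → 2` move (in either direction): the charges agree on the old
tetrahedra and, for each edge of `T₁` (which is also an edge of `T₂`), the sums of the charges around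
it agree. For the edges different from `e₀` this means that the new tetrahedra
contribute `0` along each of their edges shared with the old tetrahedra; the edge `e₀` is the edge
`0 1` of `tet 0` in `T₂`. -/
structure ZeroTwoMove.Transit [Fintype τ₁] [Fintype τ₂] {T₁ : Triangulation τ₁}
    {T₂ : Triangulation τ₂} (M : ZeroTwoMove T₁ T₂) (c₁ : AbsEdge τ₁ → ℤ) (c₂ : AbsEdge τ₂ → ℤ) :
    Prop where
  common : ∀ q : AbsEdge τ₁, c₁ q = c₂ (M.oldEdge q)
  sum02 : M.sum c₂ 0 2 (by decide) = 0
  sum03 : M.sum c₂ 0 3 (by decide) = 0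
  sum12 : M.sum c₂ 1 2 (by decide) = 0
  sum13 : M.sum c₂ 1 3 (by decide) = 0
  split : edgeSum T₁ c₁ M.e₀ = edgeSum T₂ c₂ (T₂.proj (M.edge 0 0 1 (by decide)))

/-- A (positive) bubble move `T₁ → T₂`: a `2`-face, with ordered vertices `f` in one of the two
tetrahedra containing it, is replaced by two tetrahedra glued to each other along three faces.
The vertices of the `2`-face have the labels `0, 1, 2`, and the new vertex has the label `3`. -/
structure BubbleMove (T₁ : Triangulation τ₁) (T₂ : Triangulation τ₂)
    extends NewPair τ₁ τ₂ where
  f : OrdTri τ₁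
  inner : ∀ m : Fin 3 ↪ Fin 4, 3 ∈ Set.range m →
    T₂.glue (toNewPair.face 0 m) = toNewPair.face 1 m
  cut₀ : T₂.glue (toNewPair.old f) = toNewPair.face 0 Fin.castSuccEmb
  cut₁ : T₂.glue (toNewPair.old (T₁.glue f)) = toNewPair.face 1 Fin.castSuccEmb
  outer : ∀ x : OrdTri τ₁, (∀ π, x ≠ f.reorder π) → (∀ π, x ≠ (T₁.glue f).reorder π) →
    T₂.glue (toNewPair.old x) = toNewPair.old (T₁.glue x)

/-- The bubble move is a distinguished move `(T₁, H₁) → (T₂, H₂)`: the edge with labels `0, 1` of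
the involved face is in `H₁`, and it is replaced in `H₂` by the other two edges
of the new face `0 1 3`. -/
structure BubbleMove.IsDistinguished {T₁ : Triangulation τ₁} {T₂ : Triangulation τ₂}
    (M : BubbleMove T₁ T₂) (H₁ : Set T₁.Edge) (H₂ : Set T₂.Edge) : Prop where
  common : ∀ q : AbsEdge τ₁, T₁.proj q ≠ T₁.proj M.f.edge →
    (T₁.proj q ∈ H₁ ↔ T₂.proj (M.oldEdge q) ∈ H₂)
  former : T₁.proj M.f.edge ∈ H₁
  removed : T₂.proj (M.edge 0 0 1 (by decide)) ∉ H₂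
  new03 : T₂.proj (M.edge 0 0 3 (by decide)) ∈ H₂
  new13 : T₂.proj (M.edge 0 1 3 (by decide)) ∈ H₂
  new23 : T₂.proj (M.edge 0 2 3 (by decide)) ∉ H₂

/-- Charge transit along a distinguished bubble move (in either direction): the charges agree on
the old tetrahedra, and the charges of the two new tetrahedra add up to `0` along the two new edges
of `H₂` and their opposite edges, to `2` along the other new edge, and to `2` along
the former edge of `H₁`. -/
structure BubbleMove.Transit {T₁ : Triangulation τ₁} {T₂ : Triangulation τ₂}
    (M : BubbleMove T₁ T₂) (c₁ : AbsEdge τ₁ → ℤ) (c₂ : AbsEdge τ₂ → ℤ) : Prop where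
  common : ∀ q : AbsEdge τ₁, c₁ q = c₂ (M.oldEdge q)
  sum03 : M.sum c₂ 0 3 (by decide) = 0
  sum13 : M.sum c₂ 1 3 (by decide) = 0
  sum12 : M.sum c₂ 1 2 (by decide) = 0
  sum02 : M.sum c₂ 0 2 (by decide) = 0
  sum23 : M.sum c₂ 2 3 (by decide) = 2
  sum01 : M.sum c₂ 0 1 (by decide) = 2

end Insertion

/-- The distinguished moves `(T₁, H₁) → (T₂, H₂)`: `2 → 3` moves, `0 → 2` moves, bubble moves
and their inverses. -/
inductive DistinguishedMove {τ₁ τ₂ : Type*} (T₁ : Triangulation τ₁) (H₁ : Set T₁.Edge)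
    (T₂ : Triangulation τ₂) (H₂ : Set T₂.Edge)
  | twoThree (M : TwoThreeMove T₁ T₂) (h : M.IsDistinguished H₁ H₂)
  | threeTwo (M : TwoThreeMove T₂ T₁) (h : M.IsDistinguished H₂ H₁)
  | zeroTwo (M : ZeroTwoMove T₁ T₂) (h : M.IsDistinguished H₁ H₂)
  | twoZero (M : ZeroTwoMove T₂ T₁) (h : M.IsDistinguished H₂ H₁)
  | bubble (M : BubbleMove T₁ T₂) (h : M.IsDistinguished H₁ H₂)
  | bubbleInv (M : BubbleMove T₂ T₁) (h : M.IsDistinguished H₂ H₁)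

/-- `c₁` transits to `c₂` along the distinguished move. -/
def DistinguishedMove.Transit {τ₁ τ₂ : Type*} [Fintype τ₁] [Fintype τ₂] {T₁ : Triangulation τ₁}
    {H₁ : Set T₁.Edge} {T₂ : Triangulation τ₂} {H₂ : Set T₂.Edge}
    (c₁ : AbsEdge τ₁ → ℤ) (c₂ : AbsEdge τ₂ → ℤ) : DistinguishedMove T₁ H₁ T₂ H₂ → Prop
  | .twoThree M _ => M.Transit c₁ c₂
  | .threeTwo M _ => M.Transit c₂ c₁
  | .zeroTwo M _ => M.Transit c₁ c₂
  | .twoZero M _ => M.Transit c₂ c₁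
  | .bubble M _ => M.Transit c₁ c₂
  | .bubbleInv M _ => M.Transit c₂ c₁

end ChargedTri

/-! The sums around edges and the parity along curves are treated separately.

Sums. A move changes only a few tetrahedra, so apart from a few exceptional classes the edges of the
two triangulations correspond (`TwoThreeMove.proj_eq_iff`, `BubbleMove.proj_eq_iff`,
`ZeroTwoMove.proj_oldEdge_eq_iff`), and the transit equations control the contribution of the
tetrahedra involved. The exceptional classes are computed by hand. Around the new edge of a 2-3
move, passing to opposite edges turns the sum into the sums over one face in each of the two old
tetrahedra, which is 1 + 1. For the two halves of a split edge, the total is the old sum plus 2;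
since transit gives the first half the old sum, the second half has sum 2.

Parity. Moving a curve through the region of a move would require case distinctions and could create
back-tracking. Instead, evenness on all curves is replaced by the existence of a potential: a mod 2
function on the faces of the abstract tetrahedra which changes by 1 across every gluing and by 1 + c
between two faces of a tetrahedron (`IsPotential`). Inside one tetrahedron such a function always
exists, because the charges on the three edges of a face add up to the odd number 1. Globally it
exists exactly when the charge is even on all curves: one direction is telescoping
(`IsPotential.curve`), the other integrates a cocycle on the dual graph (`exists_isPotential`). A
potential is then transported through a move: it is kept on the old tetrahedra and extended to the
new ones from their boundary faces, and the transit equations mod 2 give the compatibility.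

Only the positive 0-2 move needs more. The pillow can create dual curves which turn from one of the
two cut faces to the other inside a single new tetrahedron, and no local equation controls these.
The possible failure is one defect in `ZMod 2` for each new tetrahedron. The two defects agree, and
going around the split-off edge of `tet 0` detects that defect exactly once. For any function
changing by 1 across gluings, its total change around an edge is determined mod 2
(`sum_faces_around_edge`), so the even charge sum there forces the defect to vanish
(`ZeroTwoMove.defect_eq_zero`). -/

namespace ChargedTri

/-! ### Unordered faces, encoded by their opposite vertices -/

section Faces

variable {τ : Type*}

/-- The vertex of the tetrahedron opposite to a face. -/
def OrdTri.opp (x : OrdTri τ) : Fin 4 := 2 - ∑ i, x.vert i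

/-- The four elements of `Fin 4` add up to 6 = 2, which explains the constant in `OrdTri.opp`. -/
theorem OrdTri.opp_eq_iff (x : OrdTri τ) (v : Fin 4) :
    x.opp = v ↔ ∀ i, x.vert i ≠ v := by
  have key : ∀ a b c v : Fin 4, a ≠ b → a ≠ c → b ≠ c →
      (2 - (a + b + c) = v ↔ a ≠ v ∧ b ≠ v ∧ c ≠ v) := by decide
  have := key (x.vert 0) (x.vert 1) (x.vert 2) v (x.vert.injective.ne (by decide))
    (x.vert.injective.ne (by decide)) (x.vert.injective.ne (by decide))
  simpa [OrdTri.opp, Fin.sum_univ_three, Fin.forall_fin_succ] using this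

theorem OrdTri.vert_ne_opp (x : OrdTri τ) (i : Fin 3) : x.vert i ≠ x.opp :=
  (x.opp_eq_iff _).1 rfl i

@[simp]
theorem OrdTri.opp_reorder (x : OrdTri τ) (π : Equiv.Perm (Fin 3)) :
    (x.reorder π).opp = x.opp :=
  (OrdTri.opp_eq_iff _ _).2 fun i => x.vert_ne_opp (π i)

@[simp]
theorem OrdTri.tet_reorder (x : OrdTri τ) (π : Equiv.Perm (Fin 3)) :
    (x.reorder π).tet = x.tet := rfl

theorem OrdTri.exists_vert_eq (x : OrdTri τ) {v : Fin 4} (hv : v ≠ x.opp) :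
    ∃ i, x.vert i = v := by
  by_contra! h
  exact hv ((x.opp_eq_iff v).2 h).symm

theorem OrdTri.exists_reorder_eq {x y : OrdTri τ} (ht : x.tet = y.tet) (ho : x.opp = y.opp) :
    ∃ π, x = y.reorder π := by
  have h : ∀ i, ∃ j, y.vert j = x.vert i := fun i =>
    y.exists_vert_eq (ho ▸ x.vert_ne_opp i)
  choose g hg using h
  have hinj : Function.Injective g := fun i j hij =>
    x.vert.injective (by rw [← hg i, ← hg j, hij])
  refine ⟨Equiv.ofBijective g (Finite.injective_iff_bijective.1 hinj), ?_⟩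
  ext i
  · exact ht
  · simp [OrdTri.reorder, hg]

/-- The face of `t` opposite to `v`, with some order of its vertices. -/
def faceOpp (t : τ) (v : Fin 4) : OrdTri τ := ⟨t, v.succAboveEmb⟩

@[simp]
theorem faceOpp_tet (t : τ) (v : Fin 4) : (faceOpp t v).tet = t := rfl

@[simp]
theorem faceOpp_opp (t : τ) (v : Fin 4) : (faceOpp t v).opp = v :=
  (OrdTri.opp_eq_iff _ _).2 fun i => by simp [faceOpp, Fin.succAbove_ne]

/-- Supplies orderings of two faces in the form required by `Curve`: the vertices of their common
edge come first. -/
theorem exists_ordTri_pair (t : τ) {a b : Fin 4} (h : a ≠ b) :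
    ∃ x y : OrdTri τ, x.tet = t ∧ y.tet = t ∧ x.opp = a ∧ y.opp = b ∧
      x.vert 0 = y.vert 0 ∧ x.vert 1 = y.vert 1 ∧ x.vert 2 ≠ y.vert 2 := by
  have key : ∀ a b : Fin 4, a ≠ b → ∃ c d : Fin 4, c ≠ d ∧ c ≠ a ∧ c ≠ b ∧ d ≠ a ∧ d ≠ b := by
    decide
  obtain ⟨c, d, hcd, hca, hcb, hda, hdb⟩ := key a b h
  have inj : ∀ e : Fin 4, c ≠ e → d ≠ e → Function.Injective ![c, d, e] := by
    intro e h1 h2 i j hij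
    fin_cases i <;> fin_cases j <;> simp_all
  refine ⟨⟨t, ![c, d, b], inj b hcb hdb⟩, ⟨t, ![c, d, a], inj a hca hda⟩, rfl, rfl, ?_, ?_,
    rfl, rfl, h.symm⟩
  · rw [OrdTri.opp_eq_iff]
    intro i
    fin_cases i <;> simp [*, h.symm]
  · rw [OrdTri.opp_eq_iff]
    intro i
    fin_cases i <;> simp [*]

end Faces

/-! ### Relations for a rough charge on one tetrahedron -/

section Charge

variable {τ : Type*} {c : AbsEdge τ → ℤ}

theorem absEdge_comm (t : τ) {a b : Fin 4} (h : a ≠ b) :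
    absEdge t a b h = absEdge t b a h.symm := by
  simp only [absEdge, Sym2.eq_swap]

theorem chargeAt_of_ne (c : AbsEdge τ → ℤ) (t : τ) {a b : Fin 4} (h : a ≠ b) :
    chargeAt c t a b = c (absEdge t a b h) := dif_pos h

@[simp]
theorem chargeAt_self (c : AbsEdge τ → ℤ) (t : τ) (a : Fin 4) : chargeAt c t a a = 0 :=
  dif_neg (by simp)

theorem chargeAt_comm (c : AbsEdge τ → ℤ) (t : τ) (a b : Fin 4) :
    chargeAt c t a b = chargeAt c t b a := by
  by_cases h : a = b
  · rw [h]
  · rw [chargeAt_of_ne c t h, chargeAt_of_ne c t (Ne.symm h), absEdge_comm]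

theorem OrdTri.charge_edge (c : AbsEdge τ → ℤ) (x : OrdTri τ) :
    c x.edge = chargeAt c x.tet (x.vert 0) (x.vert 1) :=
  (chargeAt_of_ne c x.tet (x.vert.injective.ne (by decide))).symm

theorem exists_perm_of_ne {a b d e : Fin 4} (hab : a ≠ b) (had : a ≠ d) (hae : a ≠ e)
    (hbd : b ≠ d) (hbe : b ≠ e) (hde : d ≠ e) :
    ∃ p : Equiv.Perm (Fin 4), p 0 = a ∧ p 1 = b ∧ p 2 = d ∧ p 3 = e := by
  have hinj : Function.Injective ![a, b, d, e] := by
    intro i j hij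
    fin_cases i <;> fin_cases j <;> simp_all
  exact ⟨Equiv.ofBijective _ (Finite.injective_iff_bijective.1 hinj), rfl, rfl, rfl, rfl⟩

theorem IsRoughCharge.opposite (hc : IsRoughCharge c) (t : τ) {a b d e : Fin 4} (hab : a ≠ b)
    (had : a ≠ d) (hae : a ≠ e) (hbd : b ≠ d) (hbe : b ≠ e) (hde : d ≠ e) :
    chargeAt c t a b = chargeAt c t d e := by
  obtain ⟨p, rfl, rfl, rfl, rfl⟩ := exists_perm_of_ne hab had hae hbd hbe hde
  exact (hc t p).1

theorem IsRoughCharge.vertex (hc : IsRoughCharge c) (t : τ) {a b d e : Fin 4} (hab : a ≠ b)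
    (had : a ≠ d) (hae : a ≠ e) (hbd : b ≠ d) (hbe : b ≠ e) (hde : d ≠ e) :
    chargeAt c t a b + chargeAt c t a d + chargeAt c t a e = 1 := by
  obtain ⟨p, rfl, rfl, rfl, rfl⟩ := exists_perm_of_ne hab had hae hbd hbe hde
  exact (hc t p).2

/-- Replacing one edge of the face by its opposite turns the face into the star of a vertex. -/
theorem IsRoughCharge.face (hc : IsRoughCharge c) (t : τ) {a b d : Fin 4} (hab : a ≠ b)
    (had : a ≠ d) (hbd : b ≠ d) :
    chargeAt c t a b + chargeAt c t a d + chargeAt c t b d = 1 := by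
  have key : ∀ a b d : Fin 4, ∃ e, e ≠ a ∧ e ≠ b ∧ e ≠ d := by decide
  obtain ⟨e, hea, heb, hed⟩ := key a b d
  rw [hc.opposite t hbd hab.symm heb.symm had.symm hed.symm hea.symm]
  exact hc.vertex t hab had hea.symm hbd heb.symm hed.symm

end Charge

/-! ### Potentials modulo 2 and evenness along curves -/

section Potentials

variable {τ : Type*} {T : Triangulation τ} {c : AbsEdge τ → ℤ}

/-- A potential for the charge `c` modulo `2`: a function on the `2`-faces of the abstract
tetrahedra (the face opposite to `v` in `t` having the value `φ t v`) which changes under the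
gluings, and whose change inside tetrahedra is the charge plus `1`. -/
structure IsPotential (T : Triangulation τ) (c : AbsEdge τ → ℤ) (φ : τ → Fin 4 → ZMod 2) :
    Prop where
  glue : ∀ x, φ (T.glue x).tet (T.glue x).opp = φ x.tet x.opp + 1
  tet : ∀ t a b, a ≠ b → φ t a + φ t b = 1 + (chargeAt c t a b : ZMod 2)

/-- The function on the faces of `t` with value `z` on the face opposite to `a` which changes
inside `t` by the charge plus `1`. -/
def facePot (c : AbsEdge τ → ℤ) (t : τ) (a : Fin 4) (z : ZMod 2) (v : Fin 4) : ZMod 2 :=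
  if v = a then z else z + 1 + (chargeAt c t a v : ZMod 2)

@[simp]
theorem facePot_self (c : AbsEdge τ → ℤ) (t : τ) (a : Fin 4) (z : ZMod 2) :
    facePot c t a z a = z := if_pos rfl

theorem facePot_of_ne (c : AbsEdge τ → ℤ) (t : τ) {a v : Fin 4} (z : ZMod 2) (h : v ≠ a) :
    facePot c t a z v = z + 1 + (chargeAt c t a v : ZMod 2) := if_neg h

/-- On a triple of faces the increments 1 + c add up to 3 + 1 = 0 mod 2, so they form a cocycle. The
charge alone would not, which is why 1 is added in `IsPotential`, both inside tetrahedra and across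
gluings. -/
theorem facePot_add (hc : IsRoughCharge c) (t : τ) (a : Fin 4) (z : ZMod 2) {u v : Fin 4}
    (h : u ≠ v) :
    facePot c t a z u + facePot c t a z v = 1 + (chargeAt c t u v : ZMod 2) := by
  have h2 : (2 : ZMod 2) = 0 := rfl
  by_cases hu : u = a
  · subst hu
    rw [facePot_self, facePot_of_ne c t z h.symm]
    linear_combination z * h2
  by_cases hv : v = a
  · subst hv
    rw [facePot_self, facePot_of_ne c t z h, chargeAt_comm c t u]
    linear_combination z * h2
  · rw [facePot_of_ne c t z hu, facePot_of_ne c t z hv]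
    have := congrArg (Int.cast : ℤ → ZMod 2) (hc.face t (Ne.symm hu) (Ne.symm hv) h)
    push_cast at this
    linear_combination this + (z + 1 - (chargeAt c t u v : ZMod 2)) * h2

/-- The edge between two faces is opposite to the edge joining the vertices opposite to these faces,
so a rough charge takes the same value on both. -/
theorem Curve.charge_eq (hc : IsRoughCharge c) (s : Curve T) :
    s.charge c = ∑ i, chargeAt c (s.enter i).tet (s.enter i).opp (s.depart i).opp := by
  refine Finset.sum_congr rfl fun i _ => ?_
  have h1 : (s.enter i).opp = (s.depart i).vert 2 := by
    rw [OrdTri.opp_eq_iff, Fin.forall_fin_succ, Fin.forall_fin_two]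
    refine ⟨?_, ?_, ?_⟩
    · rw [s.vert_zero i]; exact (s.depart i).vert.injective.ne (by decide)
    · change (s.enter i).vert 1 ≠ _
      rw [s.vert_one i]; exact (s.depart i).vert.injective.ne (by decide)
    · exact s.vert_two i
  have h2 : (s.depart i).opp = (s.enter i).vert 2 := by
    rw [OrdTri.opp_eq_iff, Fin.forall_fin_succ, Fin.forall_fin_two]
    refine ⟨?_, ?_, ?_⟩
    · rw [← s.vert_zero i]; exact (s.enter i).vert.injective.ne (by decide)
    · change (s.depart i).vert 1 ≠ _
      rw [← s.vert_one i]; exact (s.enter i).vert.injective.ne (by decide)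
    · exact (s.vert_two i).symm
  rw [OrdTri.charge_edge c]
  refine hc.opposite _ ?_ ?_ ?_ ?_ ?_ ?_
  · exact (s.enter i).vert.injective.ne (by decide)
  · exact (s.enter i).vert_ne_opp 0
  · rw [s.vert_zero i]; exact (s.depart i).vert_ne_opp 0
  · exact (s.enter i).vert_ne_opp 1
  · rw [s.vert_one i]; exact (s.depart i).vert_ne_opp 1
  · rw [h1, h2]; exact (s.vert_two i).symm

theorem Curve.enter_ne_depart (s : Curve T) (i : Fin (s.n + 1)) :
    (s.enter i).opp ≠ (s.depart i).opp := by
  intro h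
  have h2 : (s.depart i).opp = (s.enter i).vert 2 := by
    rw [OrdTri.opp_eq_iff, Fin.forall_fin_succ, Fin.forall_fin_two]
    refine ⟨?_, ?_, ?_⟩
    · rw [← s.vert_zero i]; exact (s.enter i).vert.injective.ne (by decide)
    · change (s.depart i).vert 1 ≠ _
      rw [← s.vert_one i]; exact (s.enter i).vert.injective.ne (by decide)
    · exact (s.vert_two i).symm
  exact (s.enter i).vert_ne_opp 2 (h2.symm.trans h.symm)

/-- A charge with a potential modulo `2` is even on all closed curves. -/
theorem IsPotential.curve {φ : τ → Fin 4 → ZMod 2} (h : IsPotential T c φ)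
    (hc : IsRoughCharge c) (s : Curve T) : s.charge c ≡ 0 [ZMOD 2] := by
  have h2 : (2 : ZMod 2) = 0 := rfl
  rw [s.charge_eq hc]
  refine (ZMod.intCast_eq_intCast_iff _ _ 2).1 ?_
  push_cast
  -- The 1 from the tetrahedron cancels the 1 from the gluing that follows; what remains is a
  -- coboundary along the curve, which telescopes cyclically.
  have key : ∀ i, (chargeAt c (s.enter i).tet (s.enter i).opp (s.depart i).opp : ZMod 2) =
      φ (s.enter i).tet (s.enter i).opp + φ (s.enter (i + 1)).tet (s.enter (i + 1)).opp := by
    intro i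
    have h3 := h.tet (s.enter i).tet _ _ (s.enter_ne_depart i)
    have h4 := h.glue (s.depart i)
    obtain ⟨π, hπ⟩ := s.next i
    rw [hπ, OrdTri.opp_reorder, OrdTri.tet_reorder, ← s.same_tet i] at h4
    rw [h4]
    linear_combination -h3 - h2
  have key' := Equiv.sum_comp (Equiv.addRight (1 : Fin (s.n + 1)))
    (fun i => φ (s.enter i).tet (s.enter i).opp)
  simp only [Equiv.coe_addRight] at key'
  rw [Finset.sum_congr rfl fun i _ => key i, Finset.sum_add_distrib, key', ← two_mul, h2,
    zero_mul]

end Potentials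

/-! ### Integrating a mod 2 cocycle on the dual graph -/

section Walks

variable {τ : Type*} (T : Triangulation τ)

/-- The gluing of the faces of a triangulation, forgetting the order of the vertices of the faces
and recording a face by the opposite vertex. -/
def Triangulation.glueFace (d : τ × Fin 4) : τ × Fin 4 :=
  ((T.glue (faceOpp d.1 d.2)).tet, (T.glue (faceOpp d.1 d.2)).opp)

theorem Triangulation.glueFace_eq (x : OrdTri τ) :
    T.glueFace (x.tet, x.opp) = ((T.glue x).tet, (T.glue x).opp) := by
  obtain ⟨π, hπ⟩ := OrdTri.exists_reorder_eq (x := faceOpp x.tet x.opp) (y := x) (by simp)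
    (by simp)
  simp only [glueFace, hπ, T.glue_reorder, OrdTri.tet_reorder, OrdTri.opp_reorder]

@[simp]
theorem Triangulation.glueFace_glueFace (d : τ × Fin 4) : T.glueFace (T.glueFace d) = d := by
  conv_lhs => rw [glueFace.eq_def T d, T.glueFace_eq, T.glue_glue]
  simp

theorem Triangulation.glueFace_ne (d : τ × Fin 4) : T.glueFace d ≠ d := by
  intro h
  obtain ⟨π, hπ⟩ := OrdTri.exists_reorder_eq (x := T.glue (faceOpp d.1 d.2))
    (y := faceOpp d.1 d.2) (congrArg Prod.fst h)
    ((congrArg Prod.snd h).trans (faceOpp_opp _ _).symm)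
  exact T.glue_ne _ π hπ

/-- `T.IsWalk t l t'`: starting in the tetrahedron `t` and departing successively through the faces
in the list `l` one arrives in `t'`. -/
def Triangulation.IsWalk : τ → List (τ × Fin 4) → τ → Prop
  | t, [], t' => t = t'
  | t, d :: l, t' => d.1 = t ∧ IsWalk (T.glueFace d).1 l t'

variable {T}

theorem Triangulation.isWalk_append {t t' : τ} {l l' : List (τ × Fin 4)} :
    T.IsWalk t (l ++ l') t' ↔ ∃ s, T.IsWalk t l s ∧ T.IsWalk s l' t' := by
  induction l generalizing t with
  | nil => simp [IsWalk]
  | cons d l ih => simp [IsWalk, ih, and_assoc]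

theorem Triangulation.IsWalk.reverse {t t' : τ} {l : List (τ × Fin 4)} (h : T.IsWalk t l t') :
    T.IsWalk t' (l.map T.glueFace).reverse t := by
  induction l generalizing t with
  | nil => exact Eq.symm h
  | cons d l ih =>
    rw [List.map_cons, List.reverse_cons, isWalk_append]
    exact ⟨_, ih h.2, rfl, by simpa [IsWalk] using h.1⟩

theorem Triangulation.IsWalk.get_succ {t t' : τ} {l : List (τ × Fin 4)} (h : T.IsWalk t l t')
    (i : ℕ) (hi : i + 1 < l.length) : (T.glueFace l[i]).1 = l[i + 1].1 := by
  induction l generalizing t i with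
  | nil => simp at hi
  | cons d l ih =>
    cases i with
    | zero =>
      cases l with
      | nil => simp at hi
      | cons e l => exact h.2.1.symm
    | succ i => exact ih h.2 i (by simpa using hi)

theorem Triangulation.IsWalk.get_zero {t t' : τ} {l : List (τ × Fin 4)} (h : T.IsWalk t l t')
    (hl : 0 < l.length) : l[0].1 = t := by
  cases l with
  | nil => simp at hl
  | cons d l => exact h.1

theorem Triangulation.IsWalk.get_last {t t' : τ} {l : List (τ × Fin 4)} (h : T.IsWalk t l t')
    (i : ℕ) (hi : i + 1 = l.length) : (T.glueFace l[i]).1 = t' := by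
  induction l generalizing t i with
  | nil => simp at hi
  | cons d l ih =>
    cases i with
    | zero =>
      cases l with
      | nil => exact h.2
      | cons e l => simp at hi
    | succ i => exact ih h.2 i (by simpa using hi)

variable {g : τ × Fin 4 → ZMod 2}

/-- If a `ℤ/2`-valued cochain on the dual graph of a triangulation vanishes on all closed walks
without back-tracking, then it vanishes on all closed walks. -/
theorem Triangulation.sum_closedWalk_eq_zero (hg : ∀ d, g (T.glueFace d) = g d)
    (hcyc : ∀ (n : ℕ) (f : Fin (n + 1) → τ × Fin 4), (∀ i, (T.glueFace (f i)).1 = (f (i + 1)).1) →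
      (∀ i, f (i + 1) ≠ T.glueFace (f i)) → ∑ i, g (f i) = 0) :
    ∀ (n : ℕ) (l : List (τ × Fin 4)) (t : τ), l.length = n → T.IsWalk t l t →
      (l.map g).sum = 0 := by
  have h2 : (2 : ZMod 2) = 0 := rfl
  intro n
  induction n using Nat.strong_induction_on with
  | _ n ih =>
    intro l t hn h
    -- A step immediately undone contributes g d twice, hence 0, and can be deleted.
    by_cases h1 : ∃ a d b, l = a ++ d :: T.glueFace d :: b
    · obtain ⟨a, d, b, rfl⟩ := h1
      obtain ⟨s, ha, hs, -, hb⟩ := isWalk_append.1 h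
      rw [T.glueFace_glueFace, hs] at hb
      have := ih (a ++ b).length (by simp at hn ⊢; omega) (a ++ b) t rfl
        (isWalk_append.2 ⟨s, ha, hb⟩)
      simp only [List.map_append, List.sum_append, List.map_cons, List.sum_cons, hg] at this ⊢
      linear_combination this + g d * h2
    -- Back-tracking may also occur at the base point. Deleting the first and last steps moves the
    -- base point, which is why the induction allows every `t`.
    by_cases h3 : ∃ d m, l = T.glueFace d :: (m ++ [d])
    · obtain ⟨d, m, rfl⟩ := h3
      obtain ⟨s, hm, hs, -⟩ := isWalk_append.1 h.2
      rw [T.glueFace_glueFace] at hm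
      have := ih m.length (by simp at hn; omega) m _ rfl (hs ▸ hm)
      simp only [List.map_append, List.sum_append, List.map_cons, List.sum_cons, hg,
        List.map_nil, List.sum_nil] at this ⊢
      linear_combination this + g d * h2
    cases n with
    | zero => simp [List.length_eq_zero_iff.1 hn]
    | succ n =>
      have key := hcyc n (fun i => l[i.1]) ?_ ?_
      · rw [← key, ← List.sum_ofFn]
        congr 1
        refine List.ext_getElem (by simp [hn]) fun k _ _ => ?_
        simp only [List.getElem_map, List.getElem_ofFn]
      · intro i
        rcases Fin.eq_castSucc_or_eq_last i with ⟨j, rfl⟩ | rfl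
        · simp only [Fin.coeSucc_eq_succ, Fin.val_succ, Fin.val_castSucc]
          exact h.get_succ _ _
        · simp only [Fin.last_add_one, Fin.val_last, Fin.val_zero]
          rw [h.get_last n hn.symm, h.get_zero]
      · intro i hi
        rcases Fin.eq_castSucc_or_eq_last i with ⟨j, rfl⟩ | rfl
        · simp only [Fin.coeSucc_eq_succ, Fin.val_succ, Fin.val_castSucc] at hi
          refine h1 ⟨l.take j, l[j.1], l.drop (j + 2), ?_⟩
          rw [← hi, ← List.drop_eq_getElem_cons, ← List.drop_eq_getElem_cons,
            List.take_append_drop]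
        · simp only [Fin.last_add_one, Fin.val_last, Fin.val_zero] at hi
          -- A closed walk of one step back-tracks only if a face is glued to itself, which is
          -- excluded.
          cases n with
          | zero => exact T.glueFace_ne _ hi.symm
          | succ n =>
            refine h3 ⟨l[n + 1], (l.drop 1).take n, ?_⟩
            rw [← hi]
            apply List.ext_getElem
            · simp [hn]
            · intro k hk hk'
              rcases k with _ | k
              · simp
              · simp only [List.getElem_cons_succ]
                rw [List.getElem_append]
                split_ifs with hkn
                · simp
                · have : k = n := by simp at hkn; omega
                  subst this
                  simp

/-- A `ℤ/2`-valued cochain on the dual graph of a triangulation which vanishes on all closed walks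
without back-tracking is a coboundary. -/
theorem Triangulation.exists_coboundary (hg : ∀ d, g (T.glueFace d) = g d)
    (hcyc : ∀ (n : ℕ) (f : Fin (n + 1) → τ × Fin 4), (∀ i, (T.glueFace (f i)).1 = (f (i + 1)).1) →
      (∀ i, f (i + 1) ≠ T.glueFace (f i)) → ∑ i, g (f i) = 0) :
    ∃ u : τ → ZMod 2, ∀ d, u (T.glueFace d).1 = u d.1 + g d := by
  have hgl : ∀ l : List (τ × Fin 4), ((l.map T.glueFace).reverse.map g).sum = (l.map g).sum := by
    intro l
    rw [List.map_reverse, List.sum_reverse, List.map_map]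
    congr 2
    exact funext hg
  let S : Setoid τ := ⟨fun t t' => ∃ l, T.IsWalk t l t', fun t => ⟨[], rfl⟩,
    fun ⟨l, hl⟩ => ⟨_, hl.reverse⟩, fun ⟨l, hl⟩ ⟨l', hl'⟩ => ⟨_, isWalk_append.2 ⟨_, hl, hl'⟩⟩⟩
  -- One base tetrahedron is chosen in each component of the dual graph, and `u` is the sum along a
  -- walk from it.
  have hw : ∀ t, ∃ l, T.IsWalk (Quotient.mk S t).out l t := fun t => Quotient.mk_out (s := S) t
  choose w hw using hw
  refine ⟨fun t => ((w t).map g).sum, fun d => ?_⟩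
  have hd : T.IsWalk d.1 [d] (T.glueFace d).1 := ⟨rfl, rfl⟩
  have hq : Quotient.mk S d.1 = Quotient.mk S (T.glueFace d).1 := Quotient.sound ⟨_, hd⟩
  have h1 := hw (T.glueFace d).1
  rw [← hq] at h1
  -- The loop is: out to the source of `d`, across `d`, and back along the chosen walk.
  have := sum_closedWalk_eq_zero hg hcyc _ _ _ rfl
    (isWalk_append.2 ⟨_, isWalk_append.2 ⟨_, hw d.1, hd⟩, h1.reverse⟩)
  simp only [List.map_append, List.sum_append, hgl, List.map_cons, List.sum_cons,
    List.map_nil, List.sum_nil] at this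
  have h2 : (2 : ZMod 2) = 0 := rfl
  linear_combination -this + ((w (T.glueFace d).1).map g).sum * h2

/-- A charge which is even on all closed curves has a potential modulo `2`. -/
theorem exists_isPotential {c : AbsEdge τ → ℤ} (hc : IsRoughCharge c)
    (h : ∀ s : Curve T, s.charge c ≡ 0 [ZMOD 2]) : ∃ φ, IsPotential T c φ := by
  have h2 : (2 : ZMod 2) = 0 := rfl
  -- A potential inside each tetrahedron separately, normalized at the face opposite to 0. The error
  -- of `p` across a gluing is the cochain to be integrated; correcting by a constant `u t` on each
  -- tetrahedron does not disturb the increments inside it.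
  let p : τ × Fin 4 → ZMod 2 := fun d => facePot c d.1 0 0 d.2
  have hp : ∀ t a b, a ≠ b → p (t, a) + p (t, b) = 1 + (chargeAt c t a b : ZMod 2) :=
    fun t a b hab => facePot_add hc t 0 0 hab
  obtain ⟨u, hu⟩ := T.exists_coboundary (g := fun d => 1 + p d + p (T.glueFace d))
    (fun d => by simp only [T.glueFace_glueFace]; ring) (fun n f hf hne => by
      have hne' : ∀ i, (T.glueFace (f i)).2 ≠ (f (i + 1)).2 := fun i hi =>
        hne i (Prod.ext (hf i).symm hi.symm)
      choose x y hxt hyt hxo hyo h0 h1 h3 using fun i => exists_ordTri_pair (f (i + 1)).1 (hne' i)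
      have hy : ∀ i, faceOpp (f (i + 1)).1 (f (i + 1)).2 = faceOpp (y i).tet (y i).opp :=
        fun i => by rw [hyt, hyo]
      -- The index is shifted: the `i`-th tetrahedron of the curve is the one reached by leaving
      -- through `f i`, so it is left through `f (i + 1)`.
      let s : Curve T :=
        { n := n
          enter := x
          depart := y
          same_tet := fun i => by rw [hxt, hyt]
          vert_zero := h0
          vert_one := h1
          vert_two := h3
          next := fun i => by
            have := T.glueFace_eq (y i)
            rw [hyt, hyo, Prod.mk.eta] at this
            refine OrdTri.exists_reorder_eq ?_ ?_
            · rw [hxt, ← hf, this]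
            · rw [hxo, this] }
      have hs := (ZMod.intCast_eq_intCast_iff _ _ 2).2 (h s)
      rw [s.charge_eq hc] at hs
      push_cast at hs
      have key : ∀ i, (chargeAt c (s.enter i).tet (s.enter i).opp (s.depart i).opp : ZMod 2) =
          1 + p (T.glueFace (f i)) + p (f (i + 1)) := by
        intro i
        have := hp (f (i + 1)).1 _ _ (hne' i)
        rw [Prod.mk.eta, ← hf i, Prod.mk.eta] at this
        change (chargeAt c (x i).tet (x i).opp (y i).opp : ZMod 2) = _
        rw [hxt, hxo, hyo, ← hf i]
        linear_combination -this - h2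
      have hshift := Equiv.sum_comp (Equiv.addRight (1 : Fin (n + 1))) (fun i => p (f i))
      simp only [Equiv.coe_addRight] at hshift
      rw [Finset.sum_congr rfl fun i _ => key i] at hs
      simp only [Finset.sum_add_distrib] at hs ⊢
      rw [← hs]
      change _ = ∑ _ : Fin (n + 1), (1 : ZMod 2) + ∑ i : Fin (n + 1), p (T.glueFace (f i)) +
        ∑ i : Fin (n + 1), p (f (i + 1))
      rw [hshift]
      ring)
  refine ⟨fun t v => u t + p (t, v), fun x => ?_, fun t a b hab => ?_⟩
  · have h3 := hu (x.tet, x.opp)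
    simp only [T.glueFace_eq] at h3
    rw [h3]
    linear_combination p ((T.glue x).tet, (T.glue x).opp) * h2
  · linear_combination hp t a b hab + u t * h2

end Walks

/-! ### Comparing edge classes of two triangulations -/

section EdgeClasses

variable {τ : Type*} (T : Triangulation τ)

theorem Triangulation.proj_glue (x : OrdTri τ) : T.proj (T.glue x).edge = T.proj x.edge :=
  (Quot.sound (.glue x)).symm

theorem OrdTri.edge_reorder_swap (x : OrdTri τ) :
    (x.reorder (Equiv.swap 0 1)).edge = x.edge :=
  absEdge_comm _ _

/-- A property of abstract edges which is preserved by the gluings depends only on the class. -/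
theorem Triangulation.of_proj_eq {Q : AbsEdge τ → Prop}
    (hQ : ∀ x : OrdTri τ, Q x.edge → Q (T.glue x).edge) {p p' : AbsEdge τ}
    (h : T.proj p = T.proj p') (hp : Q p) : Q p' := by
  have key : ∀ x : OrdTri τ, Q x.edge = Q (T.glue x).edge := fun x =>
    propext ⟨hQ x, fun hx => by simpa only [T.glue_glue] using hQ _ hx⟩
  have := congrArg (Quot.lift Q (by rintro _ _ ⟨x⟩; exact key x)) h
  exact this.mp hp

/-- A correspondence `R` between abstract edges of two triangulations which is compatible with the
gluings of the first one and single-valued up to gluings of the second one, maps identified edges to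
identified edges. -/
theorem Triangulation.proj_eq_of_corr {τ' : Type*} {T : Triangulation τ} {T' : Triangulation τ'}
    {R : AbsEdge τ → AbsEdge τ' → Prop}
    (func : ∀ p q q', R p q → R p q' → T'.proj q = T'.proj q')
    (rel : ∀ (x : OrdTri τ) (q), R x.edge q → ∃ q', R (T.glue x).edge q' ∧ T'.proj q' = T'.proj q)
    {p p' : AbsEdge τ} {q q' : AbsEdge τ'} (hq : R p q) (hq' : R p' q')
    (h : T.proj p = T.proj p') : T'.proj q = T'.proj q' := by
  obtain ⟨r, hr, hrq⟩ := T.of_proj_eq (Q := fun s => ∃ r, R s r ∧ T'.proj r = T'.proj q)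
    (fun x ⟨r, hr, hrq⟩ => by
      obtain ⟨r', hr', h'⟩ := rel x r hr
      exact ⟨r', hr', h'.trans hrq⟩) h ⟨q, hq, rfl⟩
  exact hrq.symm.trans (func _ _ _ hr hq')

theorem Triangulation.edgeIn_singleton {e : T.Edge} {t : τ} {a b : Fin 4} (h : a ≠ b) :
    T.EdgeIn {e} t a b ↔ T.proj (absEdge t a b h) = e :=
  ⟨fun ⟨_, h'⟩ => h', fun h' => ⟨h, h'⟩⟩

theorem Triangulation.exists_absEdge_eq (p : AbsEdge τ) :
    ∃ (a b : Fin 4) (h : a ≠ b), p = absEdge p.1 a b h := by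
  obtain ⟨t, ⟨s, hs⟩⟩ := p
  induction s using Sym2.ind with
  | _ a b => exact ⟨a, b, hs, rfl⟩

end EdgeClasses

/-! ### Sums around an edge, and the change of a face function around it -/

section Sums

theorem sum_edges {M : Type*} [AddCommMonoid M] (π : Equiv.Perm (Fin 4))
    (F : {e : Sym2 (Fin 4) // ¬ e.IsDiag} → M) :
    ∑ s, F s = F ⟨s(π 0, π 1), π.injective.ne (by decide)⟩
      + F ⟨s(π 0, π 2), π.injective.ne (by decide)⟩
      + F ⟨s(π 0, π 3), π.injective.ne (by decide)⟩
      + F ⟨s(π 1, π 2), π.injective.ne (by decide)⟩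
      + F ⟨s(π 1, π 3), π.injective.ne (by decide)⟩
      + F ⟨s(π 2, π 3), π.injective.ne (by decide)⟩ := by
  have hπ : ∀ s : Sym2 (Fin 4), ¬ s.IsDiag ↔ ¬ (Sym2.map π s).IsDiag := by
    intro s
    induction s using Sym2.ind with
    | _ a b => simp
  let E : Sym2 (Fin 4) ≃ Sym2 (Fin 4) := ⟨Sym2.map π, Sym2.map π.symm,
    fun s => by simp [Sym2.map_map], fun s => by simp [Sym2.map_map]⟩
  rw [← Equiv.sum_comp (E.subtypeEquiv hπ)]
  have huniv : (Finset.univ : Finset {e : Sym2 (Fin 4) // ¬ e.IsDiag}) =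
      {⟨s(0, 1), by decide⟩, ⟨s(0, 2), by decide⟩, ⟨s(0, 3), by decide⟩, ⟨s(1, 2), by decide⟩,
        ⟨s(1, 3), by decide⟩, ⟨s(2, 3), by decide⟩} := by decide
  rw [huniv]
  repeat rw [Finset.sum_insert (by decide)]
  rw [Finset.sum_singleton]
  simp only [add_assoc]
  rfl

theorem two_mul_sum_edges (F : {e : Sym2 (Fin 4) // ¬ e.IsDiag} → ℤ) :
    2 * ∑ s, F s = ∑ a : Fin 4, ∑ b : Fin 4, if h : a ≠ b then F ⟨s(a, b), h⟩ else 0 := by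
  rw [sum_edges 1]
  simp [Fin.sum_univ_four, Sym2.eq_swap (a := (1 : Fin 4)) (b := 0),
    Sym2.eq_swap (a := (2 : Fin 4)) (b := 0), Sym2.eq_swap (a := (3 : Fin 4)) (b := 0),
    Sym2.eq_swap (a := (2 : Fin 4)) (b := 1), Sym2.eq_swap (a := (3 : Fin 4)) (b := 1),
    Sym2.eq_swap (a := (3 : Fin 4)) (b := 2)]
  ring

theorem sum_eq_sum_compl_range_add {ι τ M : Type*} [Fintype ι] [Fintype τ] [AddCommMonoid M]
    {f : ι → τ} (hf : Function.Injective f) [Fintype {t // t ∉ Set.range f}] (F : τ → M) :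
    ∑ t, F t = ∑ t : {t // t ∉ Set.range f}, F t + ∑ i, F (f i) := by
  classical
  rw [← Fintype.sum_subtype_add_sum_subtype (fun t => t ∉ Set.range f) F]
  congr 1
  · exact Finset.sum_congr (by ext; simp) fun _ _ => rfl
  · rw [← Equiv.sum_comp ((Equiv.ofInjective f hf).trans
      (Equiv.subtypeEquivRight fun t => by simp))]
    rfl

theorem OrdTri.exists_of_ne {τ : Type*} (t : τ) {a b v : Fin 4} (hab : a ≠ b) (hva : v ≠ a)
    (hvb : v ≠ b) :
    ∃ x : OrdTri τ, x.tet = t ∧ x.vert 0 = a ∧ x.vert 1 = b ∧ x.opp = v := by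
  have key : ∀ a b v : Fin 4, ∃ d, d ≠ a ∧ d ≠ b ∧ d ≠ v := by decide
  obtain ⟨d, hda, hdb, hdv⟩ := key a b v
  have inj : Function.Injective ![a, b, d] := by
    intro i j hij
    fin_cases i <;> fin_cases j <;> simp_all
  refine ⟨⟨t, ![a, b, d], inj⟩, rfl, rfl, rfl, ?_⟩
  rw [OrdTri.opp_eq_iff]
  intro i
  fin_cases i <;> simp [*, hva.symm, hvb.symm]

variable {τ : Type*} [Fintype τ] (T : Triangulation τ)

open Classical in
theorem edgeSum_eq (c : AbsEdge τ → ℤ) (e : T.Edge) :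
    edgeSum T c e = ∑ t, ∑ s, if T.proj (t, s) = e then c (t, s) else 0 := by
  rw [edgeSum, Finset.sum_filter, ← Finset.univ_product_univ, Finset.sum_product]

open Classical in
-- Counting ordered pairs of endpoints replaces unordered edges by a double sum over vertices, which
-- can be reindexed by the labels of a bipyramid.
theorem two_mul_edgeSum (c : AbsEdge τ → ℤ) (e : T.Edge) :
    2 * edgeSum T c e =
      ∑ t, ∑ a, ∑ b, if T.EdgeIn {e} t a b then chargeAt c t a b else 0 := by
  rw [edgeSum_eq, Finset.mul_sum]
  refine Finset.sum_congr rfl fun t _ => ?_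
  rw [two_mul_sum_edges]
  refine Finset.sum_congr rfl fun a _ => Finset.sum_congr rfl fun b _ => ?_
  by_cases h : a = b
  · simp [h]
  · rw [dif_pos h, chargeAt_of_ne c t h, T.edgeIn_singleton h]
    rfl

/-- Ordered `2`-faces correspond to pairs of a tetrahedron and an embedding. -/
def OrdTri.equivProd (τ : Type*) : OrdTri τ ≃ τ × (Fin 3 ↪ Fin 4) where
  toFun x := (x.tet, x.vert)
  invFun y := ⟨y.1, y.2⟩

noncomputable instance : Fintype (OrdTri τ) := Fintype.ofEquiv _ (OrdTri.equivProd τ).symm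

open Classical in
-- The factor 2 counts the two orders of the endpoints. Summing over ordered faces makes `T.glue` an
-- involution of the index set, even when an edge is identified with itself in reverse.
theorem sum_ordTri_eq (G : τ → Fin 4 → ℤ) (e : T.Edge) :
    ∑ x : OrdTri τ with T.proj x.edge = e, G x.tet x.opp =
      2 * ∑ p : AbsEdge τ with T.proj p = e, ∑ v with v ∉ p.2.1, G p.1 v := by
  have h1 : ∑ p : AbsEdge τ with T.proj p = e, ∑ v with v ∉ p.2.1, G p.1 v =
      ∑ t, ∑ s, if T.proj (t, s) = e then ∑ v with v ∉ s.1, G t v else 0 := by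
    rw [Finset.sum_filter, ← Finset.univ_product_univ, Finset.sum_product]
  have h2 : 2 * ∑ p : AbsEdge τ with T.proj p = e, ∑ v with v ∉ p.2.1, G p.1 v =
      ∑ y : τ × Fin 4 × Fin 4 × Fin 4 with (T.EdgeIn {e} y.1 y.2.1 y.2.2.1 ∧ y.2.2.2 ≠ y.2.1 ∧
        y.2.2.2 ≠ y.2.2.1), G y.1 y.2.2.2 := by
    rw [h1, Finset.mul_sum, Finset.sum_filter, ← Finset.univ_product_univ, Finset.sum_product]
    refine Finset.sum_congr rfl fun t _ => ?_
    rw [two_mul_sum_edges, ← Finset.univ_product_univ, Finset.sum_product]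
    refine Finset.sum_congr rfl fun a _ => ?_
    rw [← Finset.univ_product_univ, Finset.sum_product]
    refine Finset.sum_congr rfl fun b _ => ?_
    by_cases h : a = b
    · simp [h, Triangulation.EdgeIn]
    · simp only [dif_pos (show a ≠ b from h), T.edgeIn_singleton h]
      change (if T.proj (absEdge t a b h) = e then _ else _) = _
      split_ifs with he
      · rw [Finset.sum_filter]
        refine Finset.sum_congr rfl fun v _ => ?_
        simp [he]
      · simp [he]
  rw [h2]
  refine Finset.sum_nbij (fun x => (x.tet, x.vert 0, x.vert 1, x.opp)) ?_ ?_ ?_ fun _ _ => rfl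
  · intro x hx
    simp only [Finset.mem_filter, Finset.mem_univ, true_and] at hx ⊢
    exact ⟨⟨_, hx⟩, (x.vert_ne_opp 0).symm, (x.vert_ne_opp 1).symm⟩
  · rintro x - y - hxy
    simp only [Prod.mk.injEq] at hxy
    obtain ⟨h1, h2, h3, h4⟩ := hxy
    obtain ⟨j, hj⟩ := x.exists_vert_eq (h4 ▸ y.vert_ne_opp 2)
    have hj2 : j = 2 := by
      fin_cases j
      · exact absurd (y.vert.injective (h2.symm.trans hj)) (by decide)
      · exact absurd (y.vert.injective (h3.symm.trans hj)) (by decide)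
      · rfl
    subst hj2
    refine OrdTri.ext h1 (DFunLike.ext _ _ fun i => ?_)
    fin_cases i
    exacts [h2, h3, hj]
  · rintro ⟨t, a, b, v⟩ hy
    simp only [Finset.coe_filter, Finset.mem_univ, true_and, Set.mem_ofPred_eq] at hy
    obtain ⟨⟨hab, he⟩, hva, hvb⟩ := hy
    obtain ⟨x, rfl, rfl, rfl, rfl⟩ := OrdTri.exists_of_ne t hab hva hvb
    exact ⟨x, Finset.mem_coe.2 (Finset.mem_filter.2 ⟨Finset.mem_univ _, he⟩), rfl⟩

open Classical in
/-- If a function on the faces changes along the gluings, then the sum of its changes plus `1`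
in the tetrahedra around an edge vanishes. -/
theorem sum_faces_around_edge {φ : τ → Fin 4 → ZMod 2}
    (hφ : ∀ x, φ (T.glue x).tet (T.glue x).opp = φ x.tet x.opp + 1) (e : T.Edge) :
    ∑ p : AbsEdge τ with T.proj p = e, (1 + ∑ v with v ∉ p.2.1, φ p.1 v) = 0 := by
  -- The values are lifted to 0 and 1 in ℤ: the double count below gives the desired identity
  -- multiplied by 4, which would say nothing mod 2.
  have hval : ∀ z : ZMod 2, ((z + 1).val : ℤ) = 1 - z.val := by decide
  let G : τ → Fin 4 → ℤ := fun t v => (φ t v).val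
  -- Of two glued faces exactly one has value 1, so half of the faces around the edge do. Each
  -- abstract edge lies in two faces, so the number of ones, counted per abstract edge, equals the
  -- number of abstract edges in the fibre.
  have h1 : ∑ x : OrdTri τ with T.proj x.edge = e, G x.tet x.opp =
      ∑ x : OrdTri τ with T.proj x.edge = e, (1 - G x.tet x.opp) := by
    refine Finset.sum_nbij' T.glue T.glue ?_ ?_ (fun x _ => T.glue_glue x)
      (fun x _ => T.glue_glue x) ?_
    · intro x hx
      simpa [T.proj_glue] using hx
    · intro x hx
      simpa [T.proj_glue] using hx
    · intro x _
      simp only [G, hφ, hval]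
      ring
  have h3 := sum_ordTri_eq T (fun _ _ => 1) e
  rw [Finset.sum_sub_distrib, h3, sum_ordTri_eq T G e] at h1
  have hcard : ∀ s : {e : Sym2 (Fin 4) // ¬ e.IsDiag},
      (∑ v : Fin 4 with v ∉ s.1, (1 : ℤ)) = 2 := by decide
  simp only [hcard] at h1
  have h4 : ∑ p : AbsEdge τ with T.proj p = e, ∑ v with v ∉ p.2.1, G p.1 v =
      ∑ p : AbsEdge τ with T.proj p = e, 1 := by
    have h5 : ∑ p : AbsEdge τ with T.proj p = e, (2 : ℤ) =
        2 * ∑ p : AbsEdge τ with T.proj p = e, 1 := by rw [Finset.mul_sum, mul_one]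
    linarith
  have h5 := congrArg (Int.cast : ℤ → ZMod 2) h4
  have hcast : ∀ z : ZMod 2, (((z.val : ℕ) : ℤ) : ZMod 2) = z := by decide
  simp only [Int.cast_sum, G, hcast, Int.cast_one] at h5
  rw [Finset.sum_add_distrib, h5, ← two_mul]
  exact zero_mul _

end Sums

/-! ### Tetrahedra labelled by the vertices of the bipyramid -/

section Labels

variable {τ : Type*} {lab : Fin 5 → Fin 4} {k : Fin 5}

theorem exists_label (h : Set.InjOn lab {k}ᶜ) (v : Fin 4) : ∃ m, m ≠ k ∧ lab m = v := by
  have hinj : Function.Injective (fun i : Fin 4 => lab (k.succAbove i)) := fun i j hij =>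
    Fin.succAbove_right_injective (h (Fin.succAbove_ne k i) (Fin.succAbove_ne k j) hij)
  obtain ⟨i, hi⟩ := Finite.injective_iff_surjective.1 hinj v
  exact ⟨_, Fin.succAbove_ne k i, hi⟩

theorem label_ne (h : Set.InjOn lab {k}ᶜ) {a b : Fin 5} (ha : a ≠ k) (hb : b ≠ k) (hab : a ≠ b) :
    lab a ≠ lab b := h.ne ha hb hab

theorem opp_eq_label (h : Set.InjOn lab {k}ᶜ) {m : Fin 5} (hm : m ≠ k) {l : Fin 3 → Fin 5}
    (hl : ∀ i, l i ≠ k ∧ l i ≠ m) {u : Fin 3 ↪ Fin 4} (hu : ∀ i, u i = lab (l i)) (t : τ) :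
    (OrdTri.mk t u).opp = lab m := by
  rw [OrdTri.opp_eq_iff]
  intro i
  simpa only [hu] using label_ne h (hl i).1 hm (hl i).2

theorem exists_labels_face (h : Set.InjOn lab {k}ᶜ) (u : Fin 3 ↪ Fin 4) :
    ∃ (m : Fin 5) (l : Fin 3 → Fin 5), m ≠ k ∧ (∀ i, l i ≠ k ∧ l i ≠ m) ∧
      ∀ i, u i = lab (l i) := by
  obtain ⟨m, hm, hmo⟩ := exists_label h (OrdTri.mk () u).opp
  choose l hlk hl using fun i => exists_label h (u i)
  refine ⟨m, l, hm, fun i => ⟨hlk i, ?_⟩, fun i => (hl i).symm⟩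
  rintro rfl
  exact (OrdTri.mk () u).vert_ne_opp i ((hl i).symm.trans hmo)

theorem exists_face_of_labels {k' : Fin 5} {lab' : Fin 5 → Fin 4}
    (h' : Set.InjOn lab' {k'}ᶜ) {l : Fin 3 → Fin 5} (hl : ∀ i, l i ≠ k ∧ l i ≠ k')
    {u : Fin 3 ↪ Fin 4} (hu : ∀ i, u i = lab (l i)) :
    ∃ v : Fin 3 ↪ Fin 4, ∀ i, v i = lab' (l i) := by
  refine ⟨⟨fun i => lab' (l i), fun i j hij => ?_⟩, fun _ => rfl⟩
  have := h' (hl i).2 (hl j).2 hij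
  exact u.injective (by rw [hu, hu, this])

theorem IsRoughCharge.opposite_label {c : AbsEdge τ → ℤ} (hc : IsRoughCharge c) (t : τ)
    (h : Set.InjOn lab {k}ᶜ) {a b d e : Fin 5} (ha : a ≠ k) (hb : b ≠ k) (hd : d ≠ k)
    (he : e ≠ k) (hab : a ≠ b) (had : a ≠ d) (hae : a ≠ e) (hbd : b ≠ d) (hbe : b ≠ e)
    (hde : d ≠ e) :
    chargeAt c t (lab a) (lab b) = chargeAt c t (lab d) (lab e) :=
  hc.opposite t (label_ne h ha hb hab) (label_ne h ha hd had) (label_ne h ha he hae)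
    (label_ne h hb hd hbd) (label_ne h hb he hbe) (label_ne h hd he hde)

theorem IsRoughCharge.face_label {c : AbsEdge τ → ℤ} (hc : IsRoughCharge c) (t : τ)
    (h : Set.InjOn lab {k}ᶜ) {a b d : Fin 5} (ha : a ≠ k) (hb : b ≠ k) (hd : d ≠ k)
    (hab : a ≠ b) (had : a ≠ d) (hbd : b ≠ d) :
    chargeAt c t (lab a) (lab b) + chargeAt c t (lab a) (lab d) + chargeAt c t (lab b) (lab d)
      = 1 :=
  hc.face t (label_ne h ha hb hab) (label_ne h ha hd had) (label_ne h hb hd hbd)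

theorem sum_eq_sum_labels (h : Set.InjOn lab {k}ᶜ) (g : Fin 4 → ℤ) :
    ∑ v, g v = ∑ a, if a ≠ k then g (lab a) else 0 := by
  rw [← Finset.sum_filter]
  symm
  refine Finset.sum_nbij lab (by simp) ?_ ?_ (fun _ _ => rfl)
  · intro a ha b hb hab
    exact h (by simpa using ha) (by simpa using hb) hab
  · intro v _
    obtain ⟨m, hm, hv⟩ := exists_label h v
    exact ⟨m, by simpa using hm, hv⟩

theorem absEdge_eq_absEdge_iff {t t' : τ} {a b a' b' : Fin 4} {h : a ≠ b} {h' : a' ≠ b'} :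
    absEdge t a b h = absEdge t' a' b' h' ↔
      t = t' ∧ (a = a' ∧ b = b' ∨ a = b' ∧ b = a') := by
  simp [absEdge, Subtype.ext_iff]

theorem Triangulation.EdgeIn.symm {T : Triangulation τ} {H : Set T.Edge} {t : τ} {a b : Fin 4}
    (h : T.EdgeIn H t a b) : T.EdgeIn H t b a :=
  ⟨h.1.symm, by rw [absEdge_comm]; exact h.2⟩

theorem Triangulation.edgeIn_iff {T : Triangulation τ} {H : Set T.Edge} {t : τ} {a b : Fin 4}
    (h : a ≠ b) : T.EdgeIn H t a b ↔ T.proj (absEdge t a b h) ∈ H :=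
  ⟨fun ⟨_, h'⟩ => h', fun h' => ⟨h, h'⟩⟩

end Labels

/-! ### The 2-3 move: correspondence of faces and edges -/

namespace BipyramidPair

variable {τ₁ τ₂ : Type*} (B : BipyramidPair τ₁ τ₂)

theorem pole_ne_equator (k : Pole) (j : Equator) : k.1 ≠ j.1 := fun h => j.2 (h ▸ k.2)

/-- The correspondence between the abstract edges of the two triangulations. -/
inductive EdgeCorr : AbsEdge τ₁ → AbsEdge τ₂ → Prop
  | common (t : {t : τ₁ // t ∉ Set.range B.tet₁}) (e) : EdgeCorr (t.1, e) ((B.common t).1, e)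
  | boundary (k : Pole) (j : Equator) (a b : Fin 5) (ha : a ≠ k.1 ∧ a ≠ j.1)
      (hb : b ≠ k.1 ∧ b ≠ j.1) (hab : a ≠ b) :
      EdgeCorr (absEdge (B.tet₁ k) (B.lab₁ k a) (B.lab₁ k b)
          (label_ne (B.lab₁_injOn k) ha.1 hb.1 hab))
        (absEdge (B.tet₂ j) (B.lab₂ j a) (B.lab₂ j b)
          (label_ne (B.lab₂_injOn j) ha.2 hb.2 hab))

variable {B}

theorem Corr.edgeCorr {x : OrdTri τ₁} {y : OrdTri τ₂} (h : B.Corr x y) :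
    B.EdgeCorr x.edge y.edge := by
  cases h with
  | common t u => exact .common t _
  | boundary k j l u v hl hu hv =>
    have h01 : l 0 ≠ l 1 := fun h => absurd (u.injective ((hu 0).trans (by rw [h, hu 1])))
      (by decide)
    have := EdgeCorr.boundary (B := B) k j (l 0) (l 1) (hl 0) (hl 1) h01
    simpa only [OrdTri.edge, hu, hv] using this

variable (B)

/-- The label missing from a face of `tet₁ k` decides: an equatorial label means a boundary face,
the other pole means the common face. In `exists_corr_or_inner₂` the roles of poles and equator are
exchanged. -/
theorem exists_corr_or_inner₁ (x : OrdTri τ₁) :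
    (∃ y, B.Corr x y) ∨ ∃ (k k' : Pole) (l : Fin 3 → Fin 5) (u v : Fin 3 ↪ Fin 4), k ≠ k' ∧
      (∀ i, l i ≠ k.1 ∧ l i ≠ k'.1) ∧ (∀ i, u i = B.lab₁ k (l i)) ∧
      (∀ i, v i = B.lab₁ k' (l i)) ∧ x = ⟨B.tet₁ k, u⟩ := by
  obtain ⟨t, u⟩ := x
  by_cases ht : t ∈ Set.range B.tet₁
  · obtain ⟨k, rfl⟩ := ht
    obtain ⟨m, l, hm, hl, hu⟩ := exists_labels_face (B.lab₁_injOn k) u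
    by_cases hmp : m = 1 ∨ m = 3
    · obtain ⟨v, hv⟩ := exists_face_of_labels (B.lab₁_injOn ⟨m, hmp⟩) hl hu
      exact .inr ⟨k, ⟨m, hmp⟩, l, u, v, fun h => hm (by rw [h]), hl, hu, hv, rfl⟩
    · obtain ⟨v, hv⟩ := exists_face_of_labels (B.lab₂_injOn ⟨m, hmp⟩) hl hu
      exact .inl ⟨_, .boundary k ⟨m, hmp⟩ l u v hl hu hv⟩
  · exact .inl ⟨_, .common ⟨t, ht⟩ u⟩

theorem exists_corr_or_inner₂ (y : OrdTri τ₂) :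
    (∃ x, B.Corr x y) ∨ ∃ (j j' : Equator) (l : Fin 3 → Fin 5) (u v : Fin 3 ↪ Fin 4), j ≠ j' ∧
      (∀ i, l i ≠ j.1 ∧ l i ≠ j'.1) ∧ (∀ i, u i = B.lab₂ j (l i)) ∧
      (∀ i, v i = B.lab₂ j' (l i)) ∧ y = ⟨B.tet₂ j, u⟩ := by
  obtain ⟨t, u⟩ := y
  by_cases ht : t ∈ Set.range B.tet₂
  · obtain ⟨j, rfl⟩ := ht
    obtain ⟨m, l, hm, hl, hu⟩ := exists_labels_face (B.lab₂_injOn j) u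
    by_cases hmp : m = 1 ∨ m = 3
    · obtain ⟨v, hv⟩ := exists_face_of_labels (B.lab₁_injOn ⟨m, hmp⟩) hl hu
      exact .inl ⟨_, .boundary ⟨m, hmp⟩ j l v u (fun i => (hl i).symm) hv hu⟩
    · obtain ⟨v, hv⟩ := exists_face_of_labels (B.lab₂_injOn ⟨m, hmp⟩) hl hu
      exact .inr ⟨j, ⟨m, hmp⟩, l, u, v, fun h => hm (by rw [h]), hl, hu, hv, rfl⟩
  · obtain ⟨s, hs⟩ := B.common.surjective ⟨t, ht⟩
    refine .inl ⟨⟨s.1, u⟩, ?_⟩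
    have := Corr.common (B := B) s u
    rwa [hs] at this

/-- The edge of a new tetrahedron joining the poles. -/
def newEdge (j : Equator) : AbsEdge τ₂ :=
  absEdge (B.tet₂ j) (B.lab₂ j 1) (B.lab₂ j 3)
    (label_ne (B.lab₂_injOn j) (fun h => j.2 (.inl h.symm)) (fun h => j.2 (.inr h.symm))
      (by decide))

theorem exists_edgeCorr₁ (q : AbsEdge τ₁) : ∃ p, B.EdgeCorr q p := by
  by_cases ht : q.1 ∈ Set.range B.tet₁
  · obtain ⟨k, hk⟩ := ht
    obtain ⟨v, w, hvw, hq⟩ := Triangulation.exists_absEdge_eq q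
    obtain ⟨a, ha, rfl⟩ := exists_label (B.lab₁_injOn k) v
    obtain ⟨b, hb, rfl⟩ := exists_label (B.lab₁_injOn k) w
    have key : ∀ a b : Fin 5, ∃ j : Equator, a ≠ j.1 ∧ b ≠ j.1 := by decide
    obtain ⟨j, haj, hbj⟩ := key a b
    rw [hq, ← hk]
    exact ⟨_, .boundary k j a b ⟨ha, haj⟩ ⟨hb, hbj⟩ (fun h => hvw (by rw [h]))⟩
  · exact ⟨_, .common ⟨q.1, ht⟩ q.2⟩

/-- Any edge of the bipyramid that avoids some pole is already present in `T₁`; only the one joining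
both poles is not. -/
theorem exists_edgeCorr_or_newEdge (p : AbsEdge τ₂) :
    (∃ q, B.EdgeCorr q p) ∨ ∃ j, p = B.newEdge j := by
  by_cases ht : p.1 ∈ Set.range B.tet₂
  · obtain ⟨j, hj⟩ := ht
    obtain ⟨v, w, hvw, hp⟩ := Triangulation.exists_absEdge_eq p
    obtain ⟨a, ha, rfl⟩ := exists_label (B.lab₂_injOn j) v
    obtain ⟨b, hb, rfl⟩ := exists_label (B.lab₂_injOn j) w
    have hab : a ≠ b := fun h => hvw (by rw [h])
    have key : ∀ a b : Fin 5, a ≠ b → (∃ k : Pole, a ≠ k.1 ∧ b ≠ k.1) ∨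
      (a = 1 ∧ b = 3 ∨ a = 3 ∧ b = 1) := by decide
    rw [hp, ← hj]
    rcases key a b hab with ⟨k, hak, hbk⟩ | ⟨rfl, rfl⟩ | ⟨rfl, rfl⟩
    · exact .inl ⟨_, .boundary k j a b ⟨hak, ha⟩ ⟨hbk, hb⟩ hab⟩
    · exact .inr ⟨j, rfl⟩
    · exact .inr ⟨j, absEdge_comm _ _⟩
  · obtain ⟨s, hs⟩ := B.common.surjective ⟨p.1, ht⟩
    have := EdgeCorr.common (B := B) s p.2
    rw [hs] at this
    exact .inl ⟨_, this⟩

theorem not_edgeCorr_newEdge (j : Equator) (q : AbsEdge τ₁) : ¬ B.EdgeCorr q (B.newEdge j) := by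
  intro h
  generalize hp : B.newEdge j = p at h
  cases h with
  | common t e => exact (B.common t).2 ⟨j, congrArg Prod.fst hp⟩
  | boundary k j' a b ha hb hab =>
    obtain ⟨h1, h2⟩ := absEdge_eq_absEdge_iff.1 hp
    obtain rfl := B.tet₂_injective h1
    have n1 : (1 : Fin 5) ≠ j.1 := fun h => j.2 (.inl h.symm)
    have n3 : (3 : Fin 5) ≠ j.1 := fun h => j.2 (.inr h.symm)
    have inj := B.lab₂_injOn j
    rcases k with ⟨k, rfl | rfl⟩ <;> rcases h2 with ⟨h2, h3⟩ | ⟨h2, h3⟩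
    · exact ha.1 (inj n1 ha.2 h2).symm
    · exact hb.1 (inj n1 hb.2 h2).symm
    · exact hb.1 (inj n3 hb.2 h3).symm
    · exact ha.1 (inj n3 ha.2 h3).symm

end BipyramidPair

namespace TwoThreeMove

variable {τ₁ τ₂ : Type*} {T₁ : Triangulation τ₁} {T₂ : Triangulation τ₂} (M : TwoThreeMove T₁ T₂)

theorem exists_third_label (a b d e : Fin 5) : ∃ m : Fin 5, m ≠ a ∧ m ≠ b ∧ m ≠ d ∧ m ≠ e := by
  revert a b d e
  decide

/-- The remaining label `m` completes the edge to the face shared by the two tetrahedra, whose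
gluing identifies the two copies. -/
theorem proj_edge₁ {k k' : Pole} {a b : Fin 5} (ha : a ≠ k.1 ∧ a ≠ k'.1)
    (hb : b ≠ k.1 ∧ b ≠ k'.1) (hab : a ≠ b) :
    T₁.proj (absEdge (M.tet₁ k) (M.lab₁ k a) (M.lab₁ k b)
      (label_ne (M.lab₁_injOn k) ha.1 hb.1 hab)) =
    T₁.proj (absEdge (M.tet₁ k') (M.lab₁ k' a) (M.lab₁ k' b)
      (label_ne (M.lab₁_injOn k') ha.2 hb.2 hab)) := by
  by_cases hk : k = k'
  · subst hk; rfl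
  obtain ⟨m, hma, hmb, hmk, hmk'⟩ := exists_third_label a b k.1 k'.1
  have hl : ∀ i, ![a, b, m] i ≠ k.1 ∧ ![a, b, m] i ≠ k'.1 := by
    intro i; fin_cases i; exacts [ha, hb, ⟨hmk, hmk'⟩]
  have hinj : Function.Injective ![a, b, m] := by
    intro i j hij
    fin_cases i <;> fin_cases j <;> simp_all
  let u : Fin 3 ↪ Fin 4 := ⟨fun i => M.lab₁ k (![a, b, m] i),
    fun i j hij => hinj (M.lab₁_injOn k (hl i).1 (hl j).1 hij)⟩
  let v : Fin 3 ↪ Fin 4 := ⟨fun i => M.lab₁ k' (![a, b, m] i),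
    fun i j hij => hinj (M.lab₁_injOn k' (hl i).2 (hl j).2 hij)⟩
  have := T₁.proj_glue ⟨M.tet₁ k, u⟩
  rw [M.inner₁ k k' _ u v hk hl (fun _ => rfl) (fun _ => rfl)] at this
  exact this.symm

theorem proj_edge₂ {j j' : Equator} {a b : Fin 5} (ha : a ≠ j.1 ∧ a ≠ j'.1)
    (hb : b ≠ j.1 ∧ b ≠ j'.1) (hab : a ≠ b) :
    T₂.proj (absEdge (M.tet₂ j) (M.lab₂ j a) (M.lab₂ j b)
      (label_ne (M.lab₂_injOn j) ha.1 hb.1 hab)) =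
    T₂.proj (absEdge (M.tet₂ j') (M.lab₂ j' a) (M.lab₂ j' b)
      (label_ne (M.lab₂_injOn j') ha.2 hb.2 hab)) := by
  by_cases hk : j = j'
  · subst hk; rfl
  obtain ⟨m, hma, hmb, hmk, hmk'⟩ := exists_third_label a b j.1 j'.1
  have hl : ∀ i, ![a, b, m] i ≠ j.1 ∧ ![a, b, m] i ≠ j'.1 := by
    intro i; fin_cases i; exacts [ha, hb, ⟨hmk, hmk'⟩]
  have hinj : Function.Injective ![a, b, m] := by
    intro i j hij
    fin_cases i <;> fin_cases j <;> simp_all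
  let u : Fin 3 ↪ Fin 4 := ⟨fun i => M.lab₂ j (![a, b, m] i),
    fun i i' hij => hinj (M.lab₂_injOn j (hl i).1 (hl i').1 hij)⟩
  let v : Fin 3 ↪ Fin 4 := ⟨fun i => M.lab₂ j' (![a, b, m] i),
    fun i i' hij => hinj (M.lab₂_injOn j' (hl i).2 (hl i').2 hij)⟩
  have := T₂.proj_glue ⟨M.tet₂ j, u⟩
  rw [M.inner₂ j j' _ u v hk hl (fun _ => rfl) (fun _ => rfl)] at this
  exact this.symm

/-- An edge from a pole to the equator lies in two of the three new tetrahedra, so `EdgeCorr` is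
single-valued only up to the inner gluings. -/
theorem proj_eq_of_edgeCorr₁ {q : AbsEdge τ₁} {p p' : AbsEdge τ₂} (h : M.EdgeCorr q p)
    (h' : M.EdgeCorr q p') : T₂.proj p = T₂.proj p' := by
  cases h with
  | common t e =>
    generalize hq : (t.1, e) = q at h'
    cases h' with
    | common t' e' =>
      obtain ⟨h1, rfl⟩ := Prod.mk.inj hq
      obtain rfl := Subtype.ext h1
      rfl
    | boundary k j a b ha hb hab => exact (t.2 ⟨k, (congrArg Prod.fst hq).symm⟩).elim
  | boundary k j a b ha hb hab =>
    generalize hq : absEdge (M.tet₁ k) (M.lab₁ k a) (M.lab₁ k b) _ = q at h'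
    cases h' with
    | common t e => exact (t.2 ⟨k, congrArg Prod.fst hq⟩).elim
    | boundary k' j' a' b' ha' hb' hab' =>
      obtain ⟨h1, h2⟩ := absEdge_eq_absEdge_iff.1 hq
      obtain rfl := M.tet₁_injective h1
      have inj := M.lab₁_injOn k
      rcases h2 with ⟨h2, h3⟩ | ⟨h2, h3⟩
      · obtain rfl := inj ha.1 ha'.1 h2
        obtain rfl := inj hb.1 hb'.1 h3
        exact M.proj_edge₂ ⟨ha.2, ha'.2⟩ ⟨hb.2, hb'.2⟩ hab
      · obtain rfl := inj ha.1 hb'.1 h2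
        obtain rfl := inj hb.1 ha'.1 h3
        rw [absEdge_comm (M.tet₂ j')]
        exact M.proj_edge₂ ⟨ha.2, hb'.2⟩ ⟨hb.2, ha'.2⟩ hab

theorem proj_eq_of_edgeCorr₂ {q q' : AbsEdge τ₁} {p : AbsEdge τ₂} (h : M.EdgeCorr q p)
    (h' : M.EdgeCorr q' p) : T₁.proj q = T₁.proj q' := by
  cases h with
  | common t e =>
    generalize hq : ((M.common t).1, e) = p at h'
    cases h' with
    | common t' e' =>
      obtain ⟨h1, rfl⟩ := Prod.mk.inj hq
      obtain rfl := M.common.injective (Subtype.ext h1)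
      rfl
    | boundary k j a b ha hb hab =>
      exact ((M.common t).2 ⟨j, (congrArg Prod.fst hq).symm⟩).elim
  | boundary k j a b ha hb hab =>
    generalize hq : absEdge (M.tet₂ j) (M.lab₂ j a) (M.lab₂ j b) _ = p at h'
    cases h' with
    | common t e => exact ((M.common t).2 ⟨j, congrArg Prod.fst hq⟩).elim
    | boundary k' j' a' b' ha' hb' hab' =>
      obtain ⟨h1, h2⟩ := absEdge_eq_absEdge_iff.1 hq
      obtain rfl := M.tet₂_injective h1
      have inj := M.lab₂_injOn j
      rcases h2 with ⟨h2, h3⟩ | ⟨h2, h3⟩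
      · obtain rfl := inj ha.2 ha'.2 h2
        obtain rfl := inj hb.2 hb'.2 h3
        exact M.proj_edge₁ ⟨ha.1, ha'.1⟩ ⟨hb.1, hb'.1⟩ hab
      · obtain rfl := inj ha.2 hb'.2 h2
        obtain rfl := inj hb.2 ha'.2 h3
        rw [absEdge_comm (M.tet₁ k')]
        exact M.proj_edge₁ ⟨ha.1, hb'.1⟩ ⟨hb.1, ha'.1⟩ hab

/-- The edges of `T₁` correspond to the edges of `T₂` other than the new one. -/
theorem proj_eq_iff {q q' : AbsEdge τ₁} {p p' : AbsEdge τ₂} (h : M.EdgeCorr q p)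
    (h' : M.EdgeCorr q' p') : T₁.proj q = T₁.proj q' ↔ T₂.proj p = T₂.proj p' := by
  constructor
  · refine Triangulation.proj_eq_of_corr (R := M.EdgeCorr)
      (fun _ _ _ h h' => M.proj_eq_of_edgeCorr₁ h h') (fun x r hr => ?_) h h'
    rcases M.exists_corr_or_inner₁ x with ⟨y, hxy⟩ | ⟨k, k', l, u, v, hkk, hl, hu, hv, rfl⟩
    · exact ⟨_, (M.outer x y hxy).edgeCorr,
        (T₂.proj_glue y).trans (M.proj_eq_of_edgeCorr₁ hxy.edgeCorr hr)⟩
    · have key : ∀ a b : Fin 5, ∃ j : Equator, a ≠ j.1 ∧ b ≠ j.1 := by decide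
      obtain ⟨j, haj, hbj⟩ := key (l 0) (l 1)
      have h01 : l 0 ≠ l 1 := fun h => absurd (u.injective ((hu 0).trans (by rw [h, hu 1])))
        (by decide)
      have h1 := BipyramidPair.EdgeCorr.boundary (B := M.toBipyramidPair) k j (l 0) (l 1)
        ⟨(hl 0).1, haj⟩ ⟨(hl 1).1, hbj⟩ h01
      have h2 := BipyramidPair.EdgeCorr.boundary (B := M.toBipyramidPair) k' j (l 0) (l 1)
        ⟨(hl 0).2, haj⟩ ⟨(hl 1).2, hbj⟩ h01
      simp only [← hu] at h1
      simp only [← hv] at h2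
      rw [M.inner₁ k k' l u v hkk hl hu hv]
      exact ⟨_, h2, M.proj_eq_of_edgeCorr₁ h1 hr⟩
  · refine Triangulation.proj_eq_of_corr (R := fun p q => M.EdgeCorr q p)
      (fun _ _ _ h h' => M.proj_eq_of_edgeCorr₂ h h') (fun y r hr => ?_) h h'
    rcases M.exists_corr_or_inner₂ y with ⟨x, hxy⟩ | ⟨j, j', l, u, v, hjj, hl, hu, hv, rfl⟩
    · exact ⟨_, (M.outer x y hxy).edgeCorr,
        (T₁.proj_glue x).trans (M.proj_eq_of_edgeCorr₂ hxy.edgeCorr hr)⟩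
    · have h01 : l 0 ≠ l 1 := fun h => absurd (u.injective ((hu 0).trans (by rw [h, hu 1])))
        (by decide)
      have key : ∀ a b : Fin 5, a ≠ b → (∃ k : Pole, a ≠ k.1 ∧ b ≠ k.1) ∨
        (a = 1 ∧ b = 3 ∨ a = 3 ∧ b = 1) := by decide
      -- The only edge lying in neither old tetrahedron is the one between the poles, and it
      -- corresponds to no edge of `T₁`, contrary to `hr`.
      have hk : ∃ k : Pole, l 0 ≠ k.1 ∧ l 1 ≠ k.1 := by
        refine (key _ _ h01).resolve_right fun h => ?_
        refine M.not_edgeCorr_newEdge j r ?_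
        convert hr using 1
        rcases h with ⟨h0, h1⟩ | ⟨h0, h1⟩
        · simp only [BipyramidPair.newEdge, OrdTri.edge, hu, h0, h1]
        · simp only [BipyramidPair.newEdge, OrdTri.edge, hu, h0, h1]
          exact absEdge_comm _ _
      obtain ⟨k, hak, hbk⟩ := hk
      have h1 := BipyramidPair.EdgeCorr.boundary (B := M.toBipyramidPair) k j (l 0) (l 1)
        ⟨hak, (hl 0).1⟩ ⟨hbk, (hl 1).1⟩ h01
      have h2 := BipyramidPair.EdgeCorr.boundary (B := M.toBipyramidPair) k j' (l 0) (l 1)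
        ⟨hak, (hl 0).2⟩ ⟨hbk, (hl 1).2⟩ h01
      simp only [← hu] at h1
      simp only [← hv] at h2
      rw [M.inner₂ j j' l u v hjj hl hu hv]
      exact ⟨_, h2, M.proj_eq_of_edgeCorr₂ h1 hr⟩

theorem proj_newEdge (j j' : Equator) : T₂.proj (M.newEdge j) = T₂.proj (M.newEdge j') :=
  M.proj_edge₂ ⟨fun h => j.2 (.inl h.symm), fun h => j'.2 (.inl h.symm)⟩
    ⟨fun h => j.2 (.inr h.symm), fun h => j'.2 (.inr h.symm)⟩ (by decide)

/-- The new edge of `T₂` is not identified with any other edge. -/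
theorem proj_eq_newEdge_iff (j : Equator) (p : AbsEdge τ₂) :
    T₂.proj p = T₂.proj (M.newEdge j) ↔ ∃ j', p = M.newEdge j' := by
  constructor
  · intro h
    refine T₂.of_proj_eq (Q := fun p => ∃ j', p = M.newEdge j') ?_ h.symm ⟨j, rfl⟩
    rintro y ⟨j₀, hj₀⟩
    rcases M.exists_corr_or_inner₂ y with ⟨x, hxy⟩ | ⟨i, i', l, u, v, hii, hl, hu, hv, rfl⟩
    · exact (M.not_edgeCorr_newEdge j₀ _ (hj₀ ▸ hxy.edgeCorr)).elim
    · refine ⟨i', ?_⟩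
      rw [M.inner₂ i i' l u v hii hl hu hv]
      obtain ⟨h1, h2⟩ := absEdge_eq_absEdge_iff.1 hj₀
      obtain rfl := M.tet₂_injective h1
      have n1 : (1 : Fin 5) ≠ i.1 := fun h => i.2 (.inl h.symm)
      have n3 : (3 : Fin 5) ≠ i.1 := fun h => i.2 (.inr h.symm)
      have inj := M.lab₂_injOn i
      simp only [hu] at h2
      rcases h2 with ⟨h2, h3⟩ | ⟨h2, h3⟩
      · simp only [BipyramidPair.newEdge, OrdTri.edge, hv, inj (hl 0).1 n1 h2,
          inj (hl 1).1 n3 h3]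
      · simp only [BipyramidPair.newEdge, OrdTri.edge, hv, inj (hl 0).1 n3 h2,
          inj (hl 1).1 n1 h3]
        exact absEdge_comm _ _
  · rintro ⟨j', rfl⟩
    exact M.proj_newEdge j' j

theorem IsDistinguished.mem_iff {M : TwoThreeMove T₁ T₂} {H₁ : Set T₁.Edge} {H₂ : Set T₂.Edge}
    (h : M.IsDistinguished H₁ H₂) {q : AbsEdge τ₁} {p : AbsEdge τ₂} (hqp : M.EdgeCorr q p) :
    T₁.proj q ∈ H₁ ↔ T₂.proj p ∈ H₂ := by
  cases hqp with
  | common t e =>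
    obtain ⟨a, b, hab, he⟩ := Triangulation.exists_absEdge_eq (t, e)
    obtain rfl : e = ⟨s(a, b), hab⟩ := congrArg Prod.snd he
    exact (Triangulation.edgeIn_iff hab).symm.trans
      ((h.common t a b).trans (Triangulation.edgeIn_iff hab))
  | boundary k j a b ha hb hab =>
    exact (Triangulation.edgeIn_iff _).symm.trans
      ((h.boundary k j a b ha.1 ha.2 hb.1 hb.2).trans (Triangulation.edgeIn_iff _))

/-- Corresponding single edge classes satisfy the same compatibility conditions as `H₁` and `H₂`, so
the comparison of sums around one edge can be stated with `IsDistinguished`. -/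
theorem isDistinguished_singleton {q : AbsEdge τ₁} {p : AbsEdge τ₂} (h : M.EdgeCorr q p) :
    M.IsDistinguished {T₁.proj q} {T₂.proj p} where
  common t a b := by
    by_cases hab : a = b
    · simp [Triangulation.EdgeIn, hab]
    · rw [Triangulation.edgeIn_singleton _ hab, Triangulation.edgeIn_singleton _ hab]
      exact M.proj_eq_iff (.common t _) h
  boundary k j a b hak haj hbk hbj := by
    by_cases hab : a = b
    · simp [Triangulation.EdgeIn, hab]
    · rw [Triangulation.edgeIn_singleton _ (label_ne (M.lab₁_injOn k) hak hbk hab),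
        Triangulation.edgeIn_singleton _ (label_ne (M.lab₂_injOn j) haj hbj hab)]
      exact M.proj_eq_iff (.boundary k j a b ⟨hak, haj⟩ ⟨hbk, hbj⟩ hab) h
  new j := by
    rintro ⟨h1, h2⟩
    obtain ⟨j', rfl⟩ := (M.proj_eq_newEdge_iff j p).1 (Eq.symm h2)
    exact M.not_edgeCorr_newEdge j' q h

end TwoThreeMove

/-! ### The 2-3 move: sums around edges -/

namespace TwoThreeMove

variable {τ₁ τ₂ : Type*} {T₁ : Triangulation τ₁} {T₂ : Triangulation τ₂} {M : TwoThreeMove T₁ T₂}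
  {c₁ : AbsEdge τ₁ → ℤ} {c₂ : AbsEdge τ₂ → ℤ}

/-- An edge on the equator lies in both old tetrahedra, but only in the new one omitting the third
equatorial vertex. -/
theorem Transit.equatorial (h : M.Transit c₁ c₂) {j j' j'' : Equator} (h1 : j ≠ j') (h2 : j ≠ j'')
    (h3 : j' ≠ j'') {k k' : Pole} (hk : k ≠ k') :
    chargeAt c₁ (M.tet₁ k) (M.lab₁ k j') (M.lab₁ k j'') +
      chargeAt c₁ (M.tet₁ k') (M.lab₁ k' j') (M.lab₁ k' j'') =
    chargeAt c₂ (M.tet₂ j) (M.lab₂ j j') (M.lab₂ j j'') := by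
  have hs := h.sum j' j'' (fun h => h3 (Subtype.ext h)) (fun h => j'.2 h.1)
  have key1 : ∀ (j' j'' : Equator) (k k' : Pole), k ≠ k' →
      (Finset.univ.filter fun i : Pole => i.1 ≠ j'.1 ∧ i.1 ≠ j''.1) = {k, k'} := by decide
  have key2 : ∀ j j' j'' : Equator, j ≠ j' → j ≠ j'' → j' ≠ j'' →
      (Finset.univ.filter fun i : Equator => i.1 ≠ j'.1 ∧ i.1 ≠ j''.1) = {j} := by decide
  rwa [key1 j' j'' k k' hk, key2 j j' j'' h1 h2 h3, Finset.sum_pair hk, Finset.sum_singleton]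
    at hs

/-- An edge from a pole to the equator lies in one old tetrahedron and in two new ones. -/
theorem Transit.polar (h : M.Transit c₁ c₂) {j j' j'' : Equator} (h1 : j ≠ j') (h2 : j ≠ j'')
    (h3 : j' ≠ j'') {k k' : Pole} (hk : k ≠ k') :
    chargeAt c₁ (M.tet₁ k) (M.lab₁ k k') (M.lab₁ k j'') =
    chargeAt c₂ (M.tet₂ j) (M.lab₂ j k') (M.lab₂ j j'') +
      chargeAt c₂ (M.tet₂ j') (M.lab₂ j' k') (M.lab₂ j' j'') := by
  have hs := h.sum k' j'' (BipyramidPair.pole_ne_equator k' j'') (fun h => j''.2 h.2)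
  have key1 : ∀ (j'' : Equator) (k k' : Pole), k ≠ k' →
      (Finset.univ.filter fun i : Pole => i.1 ≠ k'.1 ∧ i.1 ≠ j''.1) = {k} := by decide
  have key2 : ∀ (k' : Pole) (j j' j'' : Equator), j ≠ j' → j ≠ j'' → j' ≠ j'' →
      (Finset.univ.filter fun i : Equator => i.1 ≠ k'.1 ∧ i.1 ≠ j''.1) = {j, j'} := by decide
  rwa [key1 j'' k k' hk, key2 k' j j' j'' h1 h2 h3, Finset.sum_pair h1, Finset.sum_singleton]
    at hs

theorem exists_other_equators (j : Equator) :
    ∃ j' j'' : Equator, j ≠ j' ∧ j ≠ j'' ∧ j' ≠ j'' := by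
  revert j
  decide

section EdgeSums

open Classical in
theorem two_mul_edgeSum₁ [Fintype τ₁] (M : TwoThreeMove T₁ T₂) (c₁ : AbsEdge τ₁ → ℤ) (e : T₁.Edge) :
    2 * edgeSum T₁ c₁ e =
      ∑ t : {t // t ∉ Set.range M.tet₁}, ∑ a, ∑ b,
        (if T₁.EdgeIn {e} t.1 a b then chargeAt c₁ t.1 a b else 0) +
      ∑ a, ∑ b, ∑ k : Pole, if a ≠ k.1 ∧ b ≠ k.1 then
        if T₁.EdgeIn {e} (M.tet₁ k) (M.lab₁ k a) (M.lab₁ k b) then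
          chargeAt c₁ (M.tet₁ k) (M.lab₁ k a) (M.lab₁ k b) else 0 else 0 := by
  rw [two_mul_edgeSum, sum_eq_sum_compl_range_add M.tet₁_injective]
  congr 1
  rw [Finset.sum_congr rfl fun k _ => (sum_eq_sum_labels (M.lab₁_injOn k) _).trans
    (Finset.sum_congr rfl fun a _ => if_congr Iff.rfl (sum_eq_sum_labels (M.lab₁_injOn k) _) rfl),
    Finset.sum_comm]
  refine Finset.sum_congr rfl fun a _ => ?_
  rw [Finset.sum_comm]
  refine Finset.sum_congr rfl fun k _ => ?_
  by_cases h : a = k.1 <;> simp [h]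

open Classical in
theorem two_mul_edgeSum₂ [Fintype τ₁] [Fintype τ₂] (M : TwoThreeMove T₁ T₂)
    (c₂ : AbsEdge τ₂ → ℤ) (e : T₂.Edge) :
    2 * edgeSum T₂ c₂ e =
      ∑ t : {t // t ∉ Set.range M.tet₁}, ∑ a, ∑ b,
        (if T₂.EdgeIn {e} (M.common t).1 a b then chargeAt c₂ (M.common t).1 a b else 0) +
      ∑ a, ∑ b, ∑ j : Equator, if a ≠ j.1 ∧ b ≠ j.1 then
        if T₂.EdgeIn {e} (M.tet₂ j) (M.lab₂ j a) (M.lab₂ j b) then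
          chargeAt c₂ (M.tet₂ j) (M.lab₂ j a) (M.lab₂ j b) else 0 else 0 := by
  rw [two_mul_edgeSum, sum_eq_sum_compl_range_add M.tet₂_injective, ← Equiv.sum_comp M.common]
  congr 1
  rw [Finset.sum_congr rfl fun j _ => (sum_eq_sum_labels (M.lab₂_injOn j) _).trans
    (Finset.sum_congr rfl fun a _ => if_congr Iff.rfl (sum_eq_sum_labels (M.lab₂_injOn j) _) rfl),
    Finset.sum_comm]
  refine Finset.sum_congr rfl fun a _ => ?_
  rw [Finset.sum_comm]
  refine Finset.sum_congr rfl fun k _ => ?_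
  by_cases h : a = k.1 <;> simp [h]

/-- With the sums arranged by pairs of labels `a, b`, transit gives equality pair by pair, because
all copies of the edge `{a, b}` in the bipyramid are in the class or none is. -/
theorem edgeSum_eq_of_isDistinguished [Fintype τ₁] [Fintype τ₂] {e₁ : T₁.Edge} {e₂ : T₂.Edge}
    (hM : M.IsDistinguished {e₁} {e₂}) (h : M.Transit c₁ c₂) :
    edgeSum T₁ c₁ e₁ = edgeSum T₂ c₂ e₂ := by
  classical
  refine mul_left_cancel₀ two_ne_zero ?_
  rw [M.two_mul_edgeSum₁, M.two_mul_edgeSum₂]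
  refine congr (congrArg _ ?_) ?_
  · refine Finset.sum_congr rfl fun t _ => Finset.sum_congr rfl fun a _ =>
      Finset.sum_congr rfl fun b _ => if_congr (hM.common t a b) ?_ rfl
    by_cases hab : a = b
    · simp [hab]
    · rw [chargeAt_of_ne _ _ hab, chargeAt_of_ne _ _ hab]
      exact h.common t _
  · refine Finset.sum_congr rfl fun a _ => Finset.sum_congr rfl fun b _ => ?_
    by_cases hab : a = b
    · simp [hab]
    -- The pair of poles has no transit equation: no old tetrahedron contains it, and in `T₂` it is
    -- not in the class `e₂`.
    by_cases hpole : (a = 1 ∨ a = 3) ∧ (b = 1 ∨ b = 3)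
    · have key : ∀ a b : Fin 5, a ≠ b → (a = 1 ∨ a = 3) ∧ (b = 1 ∨ b = 3) →
        (a = 1 ∧ b = 3 ∨ a = 3 ∧ b = 1) ∧ ∀ k : Pole, ¬ (a ≠ k.1 ∧ b ≠ k.1) := by decide
      obtain ⟨h13, hk⟩ := key a b hab hpole
      rw [Finset.sum_eq_zero fun k _ => if_neg (hk k), Finset.sum_eq_zero fun j _ => ?_]
      rw [if_neg (?_ : ¬ T₂.EdgeIn _ _ _ _), ite_self]
      rcases h13 with ⟨rfl, rfl⟩ | ⟨rfl, rfl⟩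
      · exact hM.new j
      · exact fun h => hM.new j h.symm
    · have key : ∀ a b : Fin 5, a ≠ b → ¬ ((a = 1 ∨ a = 3) ∧ (b = 1 ∨ b = 3)) →
        ∃ (k : Pole) (j : Equator), a ≠ k.1 ∧ b ≠ k.1 ∧ a ≠ j.1 ∧ b ≠ j.1 := by decide
      obtain ⟨k₀, j₀, hak, hbk, haj, hbj⟩ := key a b hab hpole
      have hs := h.sum a b hab hpole
      rw [Finset.sum_filter, Finset.sum_filter] at hs
      by_cases hP : T₂.EdgeIn {e₂} (M.tet₂ j₀) (M.lab₂ j₀ a) (M.lab₂ j₀ b)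
      · refine (Finset.sum_congr rfl fun k _ => ?_).trans
          (hs.trans (Finset.sum_congr rfl fun j _ => Eq.symm ?_))
        · refine if_ctx_congr (by rw [ne_comm, ne_comm (a := b)]) (fun hk => if_pos ?_)
            fun _ => rfl
          exact (hM.boundary k j₀ a b hk.1.symm haj hk.2.symm hbj).2 hP
        · refine if_ctx_congr (by rw [ne_comm, ne_comm (a := b)]) (fun hj => if_pos ?_)
            fun _ => rfl
          exact (hM.boundary k₀ j a b hak hj.1.symm hbk hj.2.symm).1
            ((hM.boundary k₀ j₀ a b hak haj hbk hbj).2 hP)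
      · rw [Finset.sum_eq_zero fun k _ => ?_, Finset.sum_eq_zero fun j _ => ?_]
        · split_ifs with hj hj'
          · exact (hP ((hM.boundary k₀ j₀ a b hak haj hbk hbj).1
              ((hM.boundary k₀ j a b hak hj.1 hbk hj.2).2 hj'))).elim
          · rfl
          · rfl
        · split_ifs with hk hk'
          · exact (hP ((hM.boundary k j₀ a b hk.1 haj hk.2 hbj).1 hk')).elim
          · rfl
          · rfl

/-- In each new tetrahedron the new edge is opposite to an equatorial edge. By transit the sum
becomes that over the equatorial triangle in each of the two old tetrahedra, 1 + 1. -/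
theorem edgeSum_newEdge [Fintype τ₂] (hc₁ : IsRoughCharge c₁) (hc₂ : IsRoughCharge c₂)
    (h : M.Transit c₁ c₂)
    (j : Equator) : edgeSum T₂ c₂ (T₂.proj (M.newEdge j)) = 2 := by
  classical
  have h1 : edgeSum T₂ c₂ (T₂.proj (M.newEdge j)) = ∑ i, c₂ (M.newEdge i) := by
    symm
    refine Finset.sum_nbij M.newEdge ?_ ?_ ?_ fun _ _ => rfl
    · intro i _
      simpa using M.proj_newEdge i j
    · intro i _ i' _ hii
      exact M.tet₂_injective (congrArg Prod.fst hii)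
    · intro p hp
      obtain ⟨i, rfl⟩ := (M.proj_eq_newEdge_iff j p).1 (Finset.mem_filter.1 hp).2
      exact ⟨i, by simp, rfl⟩
  let k : Pole := ⟨1, .inl rfl⟩
  let k' : Pole := ⟨3, .inr rfl⟩
  have hk : k ≠ k' := by decide
  have h2 : ∀ {i i' i'' : Equator}, i ≠ i' → i ≠ i'' → i' ≠ i'' → c₂ (M.newEdge i) =
      chargeAt c₁ (M.tet₁ k) (M.lab₁ k i') (M.lab₁ k i'') +
      chargeAt c₁ (M.tet₁ k') (M.lab₁ k' i') (M.lab₁ k' i'') := by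
    intro i i' i'' h1 h2 h3
    have n : ∀ {i i' : Equator}, i ≠ i' → i.1 ≠ i'.1 := fun h h' => h (Subtype.ext h')
    rw [h.equatorial h1 h2 h3 hk, BipyramidPair.newEdge, ← chargeAt_of_ne c₂]
    exact hc₂.opposite_label (k := i.1) _ (M.lab₂_injOn i)
      (BipyramidPair.pole_ne_equator k i) (BipyramidPair.pole_ne_equator k' i) (n h1.symm)
      (n h2.symm) (by decide) (BipyramidPair.pole_ne_equator k i')
      (BipyramidPair.pole_ne_equator k i'') (BipyramidPair.pole_ne_equator k' i')
      (BipyramidPair.pole_ne_equator k' i'') (n h3)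
  let i0 : Equator := ⟨0, by decide⟩
  let i2 : Equator := ⟨2, by decide⟩
  let i4 : Equator := ⟨4, by decide⟩
  have huniv : (Finset.univ : Finset Equator) = {i0, i2, i4} := by decide
  rw [h1, huniv, Finset.sum_insert (by decide), Finset.sum_pair (by decide),
    h2 (i := i0) (i' := i2) (i'' := i4) (by decide) (by decide) (by decide),
    h2 (i := i2) (i' := i0) (i'' := i4) (by decide) (by decide) (by decide),
    h2 (i := i4) (i' := i0) (i'' := i2) (by decide) (by decide) (by decide)]
  have h3 := hc₁.face_label (k := k.1) (M.tet₁ k) (M.lab₁_injOn k) (a := i0) (b := i2) (d := i4)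
    (by decide) (by decide) (by decide) (by decide) (by decide) (by decide)
  have h4 := hc₁.face_label (k := k'.1) (M.tet₁ k') (M.lab₁_injOn k') (a := i0) (b := i2)
    (d := i4) (by decide) (by decide) (by decide) (by decide) (by decide) (by decide)
  linarith

end EdgeSums

/-! ### The 2-3 move: transport of potentials -/

section Potentials

variable {φ₁ : τ₁ → Fin 4 → ZMod 2} {φ₂ : τ₂ → Fin 4 → ZMod 2}

theorem pot_eq_of_corr (hcommon : ∀ t v, φ₂ (M.common t).1 v = φ₁ t.1 v)
    (hboundary : ∀ k j, φ₂ (M.tet₂ j) (M.lab₂ j k.1) = φ₁ (M.tet₁ k) (M.lab₁ k j.1))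
    {x : OrdTri τ₁} {y : OrdTri τ₂} (h : M.Corr x y) : φ₂ y.tet y.opp = φ₁ x.tet x.opp := by
  cases h with
  | common t u => exact hcommon t _
  | boundary k j l u v hl hu hv =>
    rw [opp_eq_label (M.lab₁_injOn k) (BipyramidPair.pole_ne_equator k j).symm hl hu,
      opp_eq_label (M.lab₂_injOn j) (BipyramidPair.pole_ne_equator k j) (fun i => (hl i).symm) hv]
    exact hboundary k j

theorem exists_inner_glue₁ (M : TwoThreeMove T₁ T₂) {k k' : Pole} (hk : k ≠ k') :
    ∃ x, x.tet = M.tet₁ k ∧ x.opp = M.lab₁ k k'.1 ∧ (T₁.glue x).tet = M.tet₁ k' ∧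
      (T₁.glue x).opp = M.lab₁ k' k.1 := by
  have n : k.1 ≠ k'.1 := fun h => hk (Subtype.ext h)
  rcases M.exists_corr_or_inner₁ (faceOpp (M.tet₁ k) (M.lab₁ k k'.1)) with
    ⟨y, hy⟩ | ⟨i, i', l, u, v, hii, hl, hu, hv, hx⟩
  · generalize hx : faceOpp (M.tet₁ k) (M.lab₁ k k'.1) = x at hy
    cases hy with
    | common t u => exact (t.2 ⟨k, congrArg OrdTri.tet hx⟩).elim
    | boundary i j l u v hl hu hv =>
      obtain rfl := M.tet₁_injective (congrArg OrdTri.tet hx)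
      have h1 := congrArg OrdTri.opp hx
      rw [faceOpp_opp, opp_eq_label (M.lab₁_injOn k) (BipyramidPair.pole_ne_equator k j).symm
        hl hu] at h1
      exact (BipyramidPair.pole_ne_equator k' j (M.lab₁_injOn k n.symm
        (BipyramidPair.pole_ne_equator k j).symm h1)).elim
  · obtain rfl := M.tet₁_injective (congrArg OrdTri.tet hx)
    have n' : k.1 ≠ i'.1 := fun h => hii (Subtype.ext h)
    have h1 := congrArg OrdTri.opp hx
    rw [faceOpp_opp, opp_eq_label (M.lab₁_injOn k) n'.symm hl hu] at h1
    obtain rfl := Subtype.ext (M.lab₁_injOn k n.symm n'.symm h1)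
    refine ⟨_, rfl, faceOpp_opp _ _, ?_⟩
    rw [hx, M.inner₁ k k' l u v hk hl hu hv]
    exact ⟨rfl, opp_eq_label (M.lab₁_injOn k') n (fun i => (hl i).symm) hv _⟩

theorem exists_inner_glue₂ (M : TwoThreeMove T₁ T₂) {j j' : Equator} (hj : j ≠ j') :
    ∃ x, x.tet = M.tet₂ j ∧ x.opp = M.lab₂ j j'.1 ∧ (T₂.glue x).tet = M.tet₂ j' ∧
      (T₂.glue x).opp = M.lab₂ j' j.1 := by
  have n : j.1 ≠ j'.1 := fun h => hj (Subtype.ext h)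
  rcases M.exists_corr_or_inner₂ (faceOpp (M.tet₂ j) (M.lab₂ j j'.1)) with
    ⟨y, hy⟩ | ⟨i, i', l, u, v, hii, hl, hu, hv, hx⟩
  · generalize hx : faceOpp (M.tet₂ j) (M.lab₂ j j'.1) = x at hy
    cases hy with
    | common t u => exact ((M.common t).2 ⟨j, congrArg OrdTri.tet hx⟩).elim
    | boundary k i l u v hl hu hv =>
      obtain rfl := M.tet₂_injective (congrArg OrdTri.tet hx)
      have h1 := congrArg OrdTri.opp hx
      rw [faceOpp_opp, opp_eq_label (M.lab₂_injOn j) (BipyramidPair.pole_ne_equator k j)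
        (fun i => (hl i).symm) hv] at h1
      exact (BipyramidPair.pole_ne_equator k j' (M.lab₂_injOn j n.symm
        (BipyramidPair.pole_ne_equator k j) h1).symm).elim
  · obtain rfl := M.tet₂_injective (congrArg OrdTri.tet hx)
    have n' : j.1 ≠ i'.1 := fun h => hii (Subtype.ext h)
    have h1 := congrArg OrdTri.opp hx
    rw [faceOpp_opp, opp_eq_label (M.lab₂_injOn j) n'.symm hl hu] at h1
    obtain rfl := Subtype.ext (M.lab₂_injOn j n.symm n'.symm h1)
    refine ⟨_, rfl, faceOpp_opp _ _, ?_⟩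
    rw [hx, M.inner₂ j j' l u v hj hl hu hv]
    exact ⟨rfl, opp_eq_label (M.lab₂_injOn j') n (fun i => (hl i).symm) hv _⟩

/-- Each new tetrahedron has one boundary face on either side of the equator. The values on the side
of `Δ 1` determine the extension; agreement on the side of `Δ 3` follows from `Transit.equatorial`,
and compatibility with the inner gluings from `Transit.polar`. -/
theorem exists_isPotential₂ (hc₁ : IsRoughCharge c₁) (hc₂ : IsRoughCharge c₂)
    (h : M.Transit c₁ c₂) (hφ : IsPotential T₁ c₁ φ₁) : ∃ φ₂, IsPotential T₂ c₂ φ₂ := by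
  classical
  have h2 : (2 : ZMod 2) = 0 := rfl
  let k : Pole := ⟨1, .inl rfl⟩
  let k' : Pole := ⟨3, .inr rfl⟩
  have hk : k ≠ k' := by decide
  have pe := BipyramidPair.pole_ne_equator
  have n : ∀ {i i' : Equator}, i ≠ i' → i.1 ≠ i'.1 := fun h h' => h (Subtype.ext h')
  let φ₂ : τ₂ → Fin 4 → ZMod 2 := fun t v => if ht : t ∈ Set.range M.tet₂ then
    facePot c₂ t (M.lab₂ ht.choose k.1) (φ₁ (M.tet₁ k) (M.lab₁ k ht.choose.1)) v
    else φ₁ (M.common.symm ⟨t, ht⟩).1 v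
  have hφnew : ∀ j v, φ₂ (M.tet₂ j) v =
      facePot c₂ (M.tet₂ j) (M.lab₂ j k.1) (φ₁ (M.tet₁ k) (M.lab₁ k j.1)) v := by
    intro j v
    have ht : M.tet₂ j ∈ Set.range M.tet₂ := ⟨j, rfl⟩
    simp only [φ₂, dif_pos ht, M.tet₂_injective ht.choose_spec]
  have hcommon : ∀ t v, φ₂ (M.common t).1 v = φ₁ t.1 v := by
    intro t v
    simp only [φ₂, dif_neg (M.common t).2, Subtype.coe_eta, Equiv.symm_apply_apply]
  have hboundary : ∀ i j, φ₂ (M.tet₂ j) (M.lab₂ j i.1) = φ₁ (M.tet₁ i) (M.lab₁ i j.1) := by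
    intro i j
    have hi : ∀ i : Pole, i = ⟨1, .inl rfl⟩ ∨ i = ⟨3, .inr rfl⟩ := by decide
    rcases hi i with rfl | rfl
    · rw [hφnew]
      exact facePot_self _ _ _ _
    · change φ₂ _ (M.lab₂ j k'.1) = φ₁ (M.tet₁ k') (M.lab₁ k' j.1)
      obtain ⟨j', j'', h1, h3, h4⟩ := exists_other_equators j
      -- In `T₁` the two boundary faces are connected by crossing the common face of the old
      -- tetrahedra; this change is compared with the one inside `Δ j`.
      obtain ⟨x, hx1, hx2, hx3, hx4⟩ := M.exists_inner_glue₁ hk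
      have hg := hφ.glue x
      rw [hx1, hx2, hx3, hx4] at hg
      have e1 := hφ.tet (M.tet₁ k) _ _ (label_ne (M.lab₁_injOn k) (pe k j).symm
        (a := j.1) (b := k'.1) (by decide) (pe k' j).symm)
      have e3 := hφ.tet (M.tet₁ k') _ _ (label_ne (M.lab₁_injOn k') (pe k' j).symm
        (a := j.1) (b := k.1) (by decide) (pe k j).symm)
      rw [hc₁.opposite_label _ (M.lab₁_injOn k) (d := j') (e := j'') (pe k j).symm (by decide)
        (pe k j').symm (pe k j'').symm (pe k' j).symm (n h1) (n h3) (pe k' j') (pe k' j'')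
        (n h4)] at e1
      rw [hc₁.opposite_label _ (M.lab₁_injOn k') (d := j') (e := j'') (pe k' j).symm (by decide)
        (pe k' j').symm (pe k' j'').symm (pe k j).symm (n h1) (n h3) (pe k j') (pe k j'')
        (n h4)] at e3
      rw [hφnew, facePot_of_ne _ _ _ (label_ne (M.lab₂_injOn j) (pe k' j) (pe k j) (by decide)),
        hc₂.opposite_label _ (M.lab₂_injOn j) (d := j') (e := j'') (pe k j) (pe k' j) (n h1.symm)
          (n h3.symm) (by decide) (pe k j') (pe k j'') (pe k' j') (pe k' j'') (n h4),
        ← h.equatorial h1 h3 h4 hk]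
      push_cast
      linear_combination -e1 - e3 + hg + (φ₁ (M.tet₁ k) (M.lab₁ k j.1) +
        φ₁ (M.tet₁ k) (M.lab₁ k k'.1)) * h2
  refine ⟨φ₂, fun y => ?_, fun t a b hab => ?_⟩
  · rcases M.exists_corr_or_inner₂ y with ⟨x, hxy⟩ | ⟨j, j', l, u, v, hjj, hl, hu, hv, rfl⟩
    · rw [pot_eq_of_corr hcommon hboundary (M.outer x y hxy), pot_eq_of_corr hcommon hboundary hxy,
        hφ.glue]
    · rw [M.inner₂ j j' l u v hjj hl hu hv, opp_eq_label (M.lab₂_injOn j) (n hjj.symm) hl hu,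
        opp_eq_label (M.lab₂_injOn j') (n hjj) (fun i => (hl i).symm) hv]
      change φ₂ (M.tet₂ j') _ = φ₂ (M.tet₂ j) _ + 1
      have key : ∀ j j' : Equator, j ≠ j' → ∃ j'' : Equator, j ≠ j'' ∧ j' ≠ j'' := by decide
      obtain ⟨j'', h3, h4⟩ := key j j' hjj
      have e1 := hφ.tet (M.tet₁ k) _ _ (label_ne (M.lab₁_injOn k) (pe k j).symm
        (pe k j').symm (n hjj))
      rw [hc₁.opposite_label _ (M.lab₁_injOn k) (d := k'.1) (e := j'') (pe k j).symm
        (pe k j').symm (by decide) (pe k j'').symm (n hjj) (pe k' j).symm (n h3) (pe k' j').symm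
        (n h4) (pe k' j''), h.polar hjj h3 h4 hk] at e1
      rw [hφnew, hφnew,
        facePot_of_ne _ _ _ (label_ne (M.lab₂_injOn j) (n hjj.symm) (pe k j) (pe k j').symm),
        facePot_of_ne _ _ _ (label_ne (M.lab₂_injOn j') (n hjj) (pe k j') (pe k j).symm),
        hc₂.opposite_label _ (M.lab₂_injOn j) (d := k') (e := j'') (pe k j) (n hjj.symm)
          (pe k' j) (n h3.symm) (pe k j') (by decide) (pe k j'') (pe k' j').symm (n h4)
          (pe k' j''),
        hc₂.opposite_label _ (M.lab₂_injOn j') (d := k') (e := j'') (pe k j') (n hjj)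
          (pe k' j') (n h4.symm) (pe k j) (by decide) (pe k j'') (pe k' j).symm (n h3)
          (pe k' j'')]
      push_cast at e1
      linear_combination e1 - (φ₁ (M.tet₁ k) (M.lab₁ k j.1) -
        (chargeAt c₂ (M.tet₂ j') (M.lab₂ j' k'.1) (M.lab₂ j' j''.1) : ZMod 2)) * h2
  · by_cases ht : t ∈ Set.range M.tet₂
    · obtain ⟨j, rfl⟩ := ht
      rw [hφnew, hφnew]
      exact facePot_add hc₂ _ _ _ hab
    · obtain ⟨s, hs⟩ := M.common.surjective ⟨t, ht⟩
      obtain rfl : t = (M.common s).1 := by rw [hs]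
      rw [hcommon, hcommon, hφ.tet _ _ _ hab, chargeAt_of_ne _ _ hab, chargeAt_of_ne _ _ hab]
      exact congrArg (fun z : ℤ => 1 + (z : ZMod 2)) (h.common s _)

/-- Here the values on the boundary faces of `Δ 0` determine the extension to both old tetrahedra,
and the two transit equations exchange their roles: `Transit.polar` gives agreement on the other
boundary faces and `Transit.equatorial` the gluing along the common face. -/
theorem exists_isPotential₁ (hc₁ : IsRoughCharge c₁) (hc₂ : IsRoughCharge c₂)
    (h : M.Transit c₁ c₂) (hφ : IsPotential T₂ c₂ φ₂) : ∃ φ₁, IsPotential T₁ c₁ φ₁ := by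
  classical
  have h2 : (2 : ZMod 2) = 0 := rfl
  have pe := BipyramidPair.pole_ne_equator
  have n : ∀ {i i' : Equator}, i ≠ i' → i.1 ≠ i'.1 := fun h h' => h (Subtype.ext h')
  let j₀ : Equator := ⟨0, by decide⟩
  have other : ∀ k : Pole, ∃ k' : Pole, k ≠ k' := by decide
  let φ₁ : τ₁ → Fin 4 → ZMod 2 := fun t v => if ht : t ∈ Set.range M.tet₁ then
    facePot c₁ t (M.lab₁ ht.choose j₀.1) (φ₂ (M.tet₂ j₀) (M.lab₂ j₀ ht.choose.1)) v
    else φ₂ (M.common ⟨t, ht⟩).1 v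
  have hφnew : ∀ k v, φ₁ (M.tet₁ k) v =
      facePot c₁ (M.tet₁ k) (M.lab₁ k j₀.1) (φ₂ (M.tet₂ j₀) (M.lab₂ j₀ k.1)) v := by
    intro k v
    have ht : M.tet₁ k ∈ Set.range M.tet₁ := ⟨k, rfl⟩
    simp only [φ₁, dif_pos ht, M.tet₁_injective ht.choose_spec]
  have hcommon : ∀ t v, φ₂ (M.common t).1 v = φ₁ t.1 v := by
    intro t v
    simp only [φ₁, dif_neg t.2, Subtype.coe_eta]
  have hboundary : ∀ k j, φ₂ (M.tet₂ j) (M.lab₂ j k.1) = φ₁ (M.tet₁ k) (M.lab₁ k j.1) := by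
    intro k j
    obtain ⟨k', hk⟩ := other k
    have nk : k.1 ≠ k'.1 := fun h => hk (Subtype.ext h)
    by_cases hj : j = j₀
    · subst hj
      rw [hφnew, facePot_self]
    · have key : ∀ j j' : Equator, j ≠ j' → ∃ j'' : Equator, j ≠ j'' ∧ j' ≠ j'' := by decide
      obtain ⟨j'', h3, h4⟩ := key j j₀ hj
      have hj' : j₀ ≠ j := fun h => hj h.symm
      obtain ⟨x, hx1, hx2, hx3, hx4⟩ := M.exists_inner_glue₂ hj
      have hg := hφ.glue x
      rw [hx1, hx2, hx3, hx4] at hg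
      have e1 := hφ.tet (M.tet₂ j) _ _ (label_ne (M.lab₂_injOn j) (n hj') (pe k j)
        (pe k j₀).symm)
      have e2 := hφ.tet (M.tet₂ j₀) _ _ (label_ne (M.lab₂_injOn j₀) (n hj) (pe k j₀)
        (pe k j).symm)
      rw [hc₂.opposite_label _ (M.lab₂_injOn j) (d := k') (e := j'') (n hj') (pe k j)
        (pe k' j) (n h3.symm) (pe k j₀).symm (pe k' j₀).symm (n h4) nk (pe k j'')
        (pe k' j'')] at e1
      rw [hc₂.opposite_label _ (M.lab₂_injOn j₀) (d := k') (e := j'') (n hj) (pe k j₀)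
        (pe k' j₀) (n h4.symm) (pe k j).symm (pe k' j).symm (n h3) nk (pe k j'')
        (pe k' j'')] at e2
      rw [hφnew, facePot_of_ne _ _ _ (label_ne (M.lab₁_injOn k) (pe k j).symm (pe k j₀).symm
          (n hj)),
        hc₁.opposite_label _ (M.lab₁_injOn k) (d := k') (e := j'') (pe k j₀).symm
          (pe k j).symm nk.symm (pe k j'').symm (n hj') (pe k' j₀).symm (n h4) (pe k' j).symm
          (n h3) (pe k' j''),
        h.polar hj h3 h4 hk]
      push_cast
      linear_combination e1 + e2 - hg - (φ₂ (M.tet₂ j) (M.lab₂ j j₀.1) +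
        φ₂ (M.tet₂ j₀) (M.lab₂ j₀ k.1)) * h2
  refine ⟨φ₁, fun x => ?_, fun t a b hab => ?_⟩
  · rcases M.exists_corr_or_inner₁ x with ⟨y, hxy⟩ | ⟨k, k', l, u, v, hk, hl, hu, hv, rfl⟩
    · rw [← pot_eq_of_corr hcommon hboundary (M.outer x y hxy),
        ← pot_eq_of_corr hcommon hboundary hxy, hφ.glue]
    · have nk : k.1 ≠ k'.1 := fun h => hk (Subtype.ext h)
      rw [M.inner₁ k k' l u v hk hl hu hv, opp_eq_label (M.lab₁_injOn k) nk.symm hl hu,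
        opp_eq_label (M.lab₁_injOn k') nk (fun i => (hl i).symm) hv]
      change φ₁ (M.tet₁ k') _ = φ₁ (M.tet₁ k) _ + 1
      obtain ⟨j', j'', h1, h3, h4⟩ := exists_other_equators j₀
      have e1 := hφ.tet (M.tet₂ j₀) _ _ (label_ne (M.lab₂_injOn j₀) (pe k j₀) (pe k' j₀) nk)
      rw [hc₂.opposite_label _ (M.lab₂_injOn j₀) (d := j') (e := j'') (pe k j₀) (pe k' j₀)
        (n h1.symm) (n h3.symm) nk (pe k j') (pe k j'') (pe k' j') (pe k' j'') (n h4),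
        ← h.equatorial h1 h3 h4 hk] at e1
      rw [hφnew, hφnew,
        facePot_of_ne _ _ _ (label_ne (M.lab₁_injOn k) nk.symm (pe k j₀).symm (pe k' j₀)),
        facePot_of_ne _ _ _ (label_ne (M.lab₁_injOn k') nk (pe k' j₀).symm (pe k j₀)),
        hc₁.opposite_label _ (M.lab₁_injOn k) (d := j') (e := j'') (pe k j₀).symm nk.symm
          (pe k j').symm (pe k j'').symm (pe k' j₀).symm (n h1) (n h3) (pe k' j') (pe k' j'')
          (n h4),
        hc₁.opposite_label _ (M.lab₁_injOn k') (d := j') (e := j'') (pe k' j₀).symm nk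
          (pe k' j').symm (pe k' j'').symm (pe k j₀).symm (n h1) (n h3) (pe k j') (pe k j'')
          (n h4)]
      push_cast at e1
      linear_combination e1 - (φ₂ (M.tet₂ j₀) (M.lab₂ j₀ k.1) -
        (chargeAt c₁ (M.tet₁ k') (M.lab₁ k' j'.1) (M.lab₁ k' j''.1) : ZMod 2)) * h2
  · by_cases ht : t ∈ Set.range M.tet₁
    · obtain ⟨j, rfl⟩ := ht
      rw [hφnew, hφnew]
      exact facePot_add hc₁ _ _ _ hab
    · have h3 := hcommon ⟨t, ht⟩
      rw [← h3, ← h3, hφ.tet _ _ _ hab, chargeAt_of_ne _ _ hab, chargeAt_of_ne _ _ hab]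
      exact congrArg (fun z : ℤ => 1 + (z : ZMod 2)) (h.common ⟨t, ht⟩ _).symm

end Potentials

variable [Fintype τ₁] [Fintype τ₂] {H₁ : Set T₁.Edge} {H₂ : Set T₂.Edge}

theorem isIntegralCharge₂ (hM : M.IsDistinguished H₁ H₂) (hc₁ : IsIntegralCharge T₁ H₁ c₁)
    (hc₂ : IsRoughCharge c₂) (h : M.Transit c₁ c₂) : IsIntegralCharge T₂ H₂ c₂ := by
  obtain ⟨φ₁, hφ₁⟩ := exists_isPotential hc₁.rough hc₁.curve
  obtain ⟨φ₂, hφ₂⟩ := exists_isPotential₂ hc₁.rough hc₂ h hφ₁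
  refine ⟨hc₂, ?_, ?_, hφ₂.curve hc₂⟩
  · rintro ⟨p⟩ hp
    change T₂.proj p ∉ H₂ at hp
    change edgeSum T₂ c₂ (T₂.proj p) = 2
    rcases M.exists_edgeCorr_or_newEdge p with ⟨q, hq⟩ | ⟨j, rfl⟩
    · rw [← edgeSum_eq_of_isDistinguished (M.isDistinguished_singleton hq) h]
      exact hc₁.sum_of_notMem _ fun h' => hp ((hM.mem_iff hq).1 h')
    · exact edgeSum_newEdge hc₁.rough hc₂ h j
  · rintro ⟨p⟩ hp
    change T₂.proj p ∈ H₂ at hp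
    change edgeSum T₂ c₂ (T₂.proj p) = 0
    rcases M.exists_edgeCorr_or_newEdge p with ⟨q, hq⟩ | ⟨j, rfl⟩
    · rw [← edgeSum_eq_of_isDistinguished (M.isDistinguished_singleton hq) h]
      exact hc₁.sum_of_mem _ ((hM.mem_iff hq).2 hp)
    · exact (hM.new j ⟨_, hp⟩).elim

theorem isIntegralCharge₁ (hM : M.IsDistinguished H₁ H₂) (hc₂ : IsIntegralCharge T₂ H₂ c₂)
    (hc₁ : IsRoughCharge c₁) (h : M.Transit c₁ c₂) : IsIntegralCharge T₁ H₁ c₁ := by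
  obtain ⟨φ₂, hφ₂⟩ := exists_isPotential hc₂.rough hc₂.curve
  obtain ⟨φ₁, hφ₁⟩ := exists_isPotential₁ hc₁ hc₂.rough h hφ₂
  refine ⟨hc₁, ?_, ?_, hφ₁.curve hc₁⟩
  · rintro ⟨q⟩ hq
    change T₁.proj q ∉ H₁ at hq
    change edgeSum T₁ c₁ (T₁.proj q) = 2
    obtain ⟨p, hp⟩ := M.exists_edgeCorr₁ q
    rw [edgeSum_eq_of_isDistinguished (M.isDistinguished_singleton hp) h]
    exact hc₂.sum_of_notMem _ fun h' => hq ((hM.mem_iff hp).2 h')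
  · rintro ⟨q⟩ hq
    change T₁.proj q ∈ H₁ at hq
    change edgeSum T₁ c₁ (T₁.proj q) = 0
    obtain ⟨p, hp⟩ := M.exists_edgeCorr₁ q
    rw [edgeSum_eq_of_isDistinguished (M.isDistinguished_singleton hp) h]
    exact hc₂.sum_of_mem _ ((hM.mem_iff hp).1 hq)

end TwoThreeMove

/-! ### Insertion of two tetrahedra: faces, edges and functions on faces -/

theorem exists_face_labels {a b v : Fin 4} (hab : a ≠ b) (hva : v ≠ a) (hvb : v ≠ b) :
    ∃ m : Fin 3 ↪ Fin 4, m 0 = a ∧ m 1 = b ∧ ∀ w, w ∈ Set.range m ↔ w ≠ v := by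
  obtain ⟨x, -, h0, h1, hv⟩ := OrdTri.exists_of_ne () hab hva hvb
  refine ⟨x.vert, h0, h1, fun w => ⟨?_, fun hw => x.exists_vert_eq (by rwa [hv])⟩⟩
  rintro ⟨i, rfl⟩
  exact hv ▸ x.vert_ne_opp i

theorem exists_missing_label (m : Fin 3 ↪ Fin 4) : ∃ v, ∀ w, w ∈ Set.range m ↔ w ≠ v := by
  refine ⟨(OrdTri.mk () m).opp, fun w => ⟨?_, fun hw => (OrdTri.mk () m).exists_vert_eq hw⟩⟩
  rintro ⟨i, rfl⟩
  exact (OrdTri.mk () m).vert_ne_opp i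

namespace NewPair

variable {τ₁ τ₂ : Type*} (N : NewPair τ₁ τ₂)

theorem old_or_face (y : OrdTri τ₂) : (∃ x, y = N.old x) ∨ ∃ d m, y = N.face d m := by
  by_cases h : y.tet ∈ Set.range N.tet
  · obtain ⟨d, hd⟩ := h
    refine .inr ⟨d, y.vert.trans (N.lab d).symm.toEmbedding, OrdTri.ext hd.symm ?_⟩
    ext i
    simp [face]
  · obtain ⟨t, ht⟩ := N.common.surjective ⟨y.tet, h⟩
    exact .inl ⟨⟨t, y.vert⟩, OrdTri.ext (by simp [old, ht]) rfl⟩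

theorem oldEdge_or_edge (p : AbsEdge τ₂) :
    (∃ q, p = N.oldEdge q) ∨ ∃ d a b h, p = N.edge d a b h := by
  by_cases h : p.1 ∈ Set.range N.tet
  · obtain ⟨d, hd⟩ := h
    obtain ⟨v, w, hvw, hp⟩ := Triangulation.exists_absEdge_eq p
    refine .inr ⟨d, (N.lab d).symm v, (N.lab d).symm w, (N.lab d).symm.injective.ne hvw, ?_⟩
    simp only [edge, hd, Equiv.apply_symm_apply]
    exact hp
  · obtain ⟨t, ht⟩ := N.common.surjective ⟨p.1, h⟩
    exact .inl ⟨(t, p.2), Prod.ext (by simp [oldEdge, ht]) rfl⟩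

theorem old_injective : Function.Injective N.old := fun _ _ h =>
  OrdTri.ext (N.common.injective (Subtype.ext (congrArg OrdTri.tet h))) (OrdTri.mk.inj h).2

theorem old_ne_face (x : OrdTri τ₁) (d : Fin 2) (m : Fin 3 ↪ Fin 4) : N.old x ≠ N.face d m :=
  fun h => (N.common x.tet).2 ⟨d, (congrArg OrdTri.tet h).symm⟩

theorem oldEdge_injective : Function.Injective N.oldEdge := fun _ _ h =>
  Prod.ext (N.common.injective (Subtype.ext (congrArg Prod.fst h))) (Prod.mk.inj h).2

theorem oldEdge_ne_edge (q : AbsEdge τ₁) (d : Fin 2) {a b : Fin 4} (h : a ≠ b) :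
    N.oldEdge q ≠ N.edge d a b h :=
  fun h => (N.common q.1).2 ⟨d, (congrArg Prod.fst h).symm⟩

theorem face_inj {d d' : Fin 2} {m m' : Fin 3 ↪ Fin 4} (h : N.face d m = N.face d' m') :
    d = d' ∧ m = m' := by
  obtain rfl := N.tet_injective (congrArg OrdTri.tet h)
  refine ⟨rfl, ?_⟩
  ext i : 1
  exact (N.lab d).injective (DFunLike.congr_fun (congrArg OrdTri.vert h) i)

theorem edge_inj {d d' : Fin 2} {a b a' b' : Fin 4} {h : a ≠ b} {h' : a' ≠ b'} :
    N.edge d a b h = N.edge d' a' b' h' ↔ d = d' ∧ (a = a' ∧ b = b' ∨ a = b' ∧ b = a') := by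
  rw [edge, edge, absEdge_eq_absEdge_iff]
  constructor
  · rintro ⟨h1, h2⟩
    obtain rfl := N.tet_injective h1
    simpa using h2
  · rintro ⟨rfl, h2⟩
    simpa using h2

theorem edge_comm (d : Fin 2) {a b : Fin 4} (h : a ≠ b) :
    N.edge d a b h = N.edge d b a h.symm := absEdge_comm _ _

@[simp]
theorem old_edge (x : OrdTri τ₁) : (N.old x).edge = N.oldEdge x.edge := rfl

theorem face_edge (d : Fin 2) (m : Fin 3 ↪ Fin 4) :
    (N.face d m).edge = N.edge d (m 0) (m 1) (m.injective.ne (by decide)) := rfl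

theorem face_opp (d : Fin 2) {m : Fin 3 ↪ Fin 4} {v : Fin 4}
    (hv : ∀ w, w ∈ Set.range m ↔ w ≠ v) : (N.face d m).opp = N.lab d v := by
  rw [OrdTri.opp_eq_iff]
  intro i
  exact (N.lab d).injective.ne ((hv _).1 ⟨i, rfl⟩)

theorem chargeAt_lab (c : AbsEdge τ₂ → ℤ) (d : Fin 2) {a b : Fin 4} (h : a ≠ b) :
    chargeAt c (N.tet d) (N.lab d a) (N.lab d b) = c (N.edge d a b h) :=
  chargeAt_of_ne _ _ _

theorem sum_eq (c : AbsEdge τ₂ → ℤ) {a b : Fin 4} (h : a ≠ b) {d d' : Fin 2} (hd : d ≠ d') :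
    N.sum c a b h = c (N.edge d a b h) + c (N.edge d' a b h) := by
  have key : ∀ d d' : Fin 2, d ≠ d' → d = 0 ∧ d' = 1 ∨ d = 1 ∧ d' = 0 := by decide
  rw [sum, Fin.sum_univ_two]
  rcases key d d' hd with ⟨rfl, rfl⟩ | ⟨rfl, rfl⟩
  · rfl
  · exact add_comm _ _

theorem sum_absEdge {M : Type*} [AddCommMonoid M] [Fintype τ₁] [Fintype τ₂]
    (F : AbsEdge τ₂ → M) :
    ∑ p, F p = ∑ q, F (N.oldEdge q) + (∑ d, F (N.edge d 0 1 (by decide))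
      + ∑ d, F (N.edge d 0 2 (by decide)) + ∑ d, F (N.edge d 0 3 (by decide))
      + ∑ d, F (N.edge d 1 2 (by decide)) + ∑ d, F (N.edge d 1 3 (by decide))
      + ∑ d, F (N.edge d 2 3 (by decide))) := by
  classical
  rw [← Finset.univ_product_univ, Finset.sum_product, sum_eq_sum_compl_range_add N.tet_injective,
    ← Equiv.sum_comp N.common]
  refine congr (congrArg _ ?_) ?_
  · rw [← Finset.univ_product_univ, Finset.sum_product]
    rfl
  · simp only [← Finset.sum_add_distrib]
    exact Finset.sum_congr rfl fun d _ => sum_edges (N.lab d) fun s => F (N.tet d, s)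

open Classical in
/-- The extension to the new tetrahedra of a function on the faces of the old ones; on the face
of `tet d` opposite to the label `a` it has the value `s d a`. -/
noncomputable def extend (φ : τ₁ → Fin 4 → ZMod 2) (s : Fin 2 → Fin 4 → ZMod 2) (t : τ₂)
    (v : Fin 4) : ZMod 2 :=
  if ht : t ∈ Set.range N.tet then s ht.choose ((N.lab ht.choose).symm v)
  else φ (N.common.symm ⟨t, ht⟩) v

variable {N} {c : AbsEdge τ₂ → ℤ} {φ : τ₁ → Fin 4 → ZMod 2} {s : Fin 2 → Fin 4 → ZMod 2}

@[simp]
theorem extend_common (t : τ₁) (v : Fin 4) : N.extend φ s (N.common t).1 v = φ t v := by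
  simp only [extend, dif_neg (N.common t).2, Subtype.coe_eta, Equiv.symm_apply_apply]

@[simp]
theorem extend_tet (d : Fin 2) (a : Fin 4) : N.extend φ s (N.tet d) (N.lab d a) = s d a := by
  have ht : N.tet d ∈ Set.range N.tet := ⟨d, rfl⟩
  simp only [extend, dif_pos ht, N.tet_injective ht.choose_spec, Equiv.symm_apply_apply]

theorem extend_old (x : OrdTri τ₁) :
    N.extend φ s (N.old x).tet (N.old x).opp = φ x.tet x.opp := extend_common _ _

theorem extend_face (d : Fin 2) {m : Fin 3 ↪ Fin 4} {a : Fin 4}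
    (ha : ∀ w, w ∈ Set.range m ↔ w ≠ a) :
    N.extend φ s (N.face d m).tet (N.face d m).opp = s d a := by
  rw [N.face_opp d ha]
  exact extend_tet d a

theorem extend_add {c₁ : AbsEdge τ₁ → ℤ} (hcommon : ∀ q, c₁ q = c (N.oldEdge q))
    (hφ : ∀ t a b, a ≠ b → φ t a + φ t b = 1 + (chargeAt c₁ t a b : ZMod 2))
    (hs : ∀ d a b (h : a ≠ b), s d a + s d b = 1 + (c (N.edge d a b h) : ZMod 2)) (t : τ₂)
    (u v : Fin 4) (huv : u ≠ v) :
    N.extend φ s t u + N.extend φ s t v = 1 + (chargeAt c t u v : ZMod 2) := by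
  by_cases h : t ∈ Set.range N.tet
  · obtain ⟨d, rfl⟩ := h
    obtain ⟨a, rfl⟩ := (N.lab d).surjective u
    obtain ⟨b, rfl⟩ := (N.lab d).surjective v
    have hab : a ≠ b := fun h => huv (by rw [h])
    rw [extend_tet, extend_tet, hs d a b hab, N.chargeAt_lab _ _ hab]
  · obtain ⟨s, hs⟩ := N.common.surjective ⟨t, h⟩
    obtain rfl : t = (N.common s).1 := by rw [hs]
    rw [extend_common, extend_common, hφ _ _ _ huv, chargeAt_of_ne _ _ huv, hcommon,
      chargeAt_of_ne _ _ huv]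
    rfl

variable (N) in
/-- The function on the faces of the new tetrahedra with value `z d` on the face of `tet d`
opposite to the label `b` which changes inside them by the charge plus `1`. -/
def labelPot (c : AbsEdge τ₂ → ℤ) (b : Fin 4) (z : Fin 2 → ZMod 2) (d : Fin 2) (a : Fin 4) :
    ZMod 2 :=
  facePot c (N.tet d) (N.lab d b) (z d) (N.lab d a)

@[simp]
theorem labelPot_self (b : Fin 4) (z : Fin 2 → ZMod 2) (d : Fin 2) :
    N.labelPot c b z d b = z d := facePot_self _ _ _ _

theorem labelPot_of_ne {a b : Fin 4} (h : b ≠ a) (z : Fin 2 → ZMod 2) (d : Fin 2) :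
    N.labelPot c b z d a = z d + 1 + (c (N.edge d b a h) : ZMod 2) := by
  rw [labelPot, facePot_of_ne _ _ _ ((N.lab d).injective.ne h.symm), N.chargeAt_lab _ _ h]

theorem labelPot_add (hc : IsRoughCharge c) (e : Fin 4) (z : Fin 2 → ZMod 2) (d : Fin 2)
    (a b : Fin 4) (h : a ≠ b) :
    N.labelPot c e z d a + N.labelPot c e z d b = 1 + (c (N.edge d a b h) : ZMod 2) := by
  rw [labelPot, labelPot, facePot_add hc _ _ _ ((N.lab d).injective.ne h), N.chargeAt_lab _ _ h]

theorem restrict_add {c₁ : AbsEdge τ₁ → ℤ} {φ₂ : τ₂ → Fin 4 → ZMod 2}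
    (hcommon : ∀ q, c₁ q = c (N.oldEdge q))
    (hφ : ∀ t a b, a ≠ b → φ₂ t a + φ₂ t b = 1 + (chargeAt c t a b : ZMod 2)) (t : τ₁)
    (u v : Fin 4) (huv : u ≠ v) :
    φ₂ (N.common t).1 u + φ₂ (N.common t).1 v = 1 + (chargeAt c₁ t u v : ZMod 2) := by
  rw [hφ _ _ _ huv, chargeAt_of_ne _ _ huv, chargeAt_of_ne _ _ huv, hcommon]
  rfl

end NewPair

/-! ### The bubble move -/

namespace BubbleMove

variable {τ₁ τ₂ : Type*} {T₁ : Triangulation τ₁} {T₂ : Triangulation τ₂} (M : BubbleMove T₁ T₂)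

theorem glue_inner {d d' : Fin 2} (hd : d ≠ d') {m : Fin 3 ↪ Fin 4} (hm : 3 ∈ Set.range m) :
    T₂.glue (M.face d m) = M.face d' m := by
  have key : ∀ d d' : Fin 2, d ≠ d' → d = 0 ∧ d' = 1 ∨ d = 1 ∧ d' = 0 := by decide
  rcases key d d' hd with ⟨rfl, rfl⟩ | ⟨rfl, rfl⟩
  · exact M.inner m hm
  · rw [← M.inner m hm, T₂.glue_glue]

/-- The face to which the two new tetrahedra are attached, seen from the two sides. -/
def side (d : Fin 2) : OrdTri τ₁ := if d = 0 then M.f else T₁.glue M.f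

theorem glue_side {d d' : Fin 2} (hd : d ≠ d') : T₁.glue (M.side d) = M.side d' := by
  have key : ∀ d d' : Fin 2, d ≠ d' → d = 0 ∧ d' = 1 ∨ d = 1 ∧ d' = 0 := by decide
  rcases key d d' hd with ⟨rfl, rfl⟩ | ⟨rfl, rfl⟩ <;> simp [side, T₁.glue_glue]

theorem glue_old_side (d : Fin 2) (π : Equiv.Perm (Fin 3)) :
    T₂.glue (M.old ((M.side d).reorder π)) = (M.face d Fin.castSuccEmb).reorder π := by
  change T₂.glue ((M.old (M.side d)).reorder π) = _
  rw [T₂.glue_reorder]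
  congr 1
  fin_cases d
  · exact M.cut₀
  · exact M.cut₁

theorem glue_old (x : OrdTri τ₁) :
    (∃ d π, x = (M.side d).reorder π) ∨ T₂.glue (M.old x) = M.old (T₁.glue x) := by
  by_cases h0 : ∃ π, x = M.f.reorder π
  · obtain ⟨π, rfl⟩ := h0
    exact .inl ⟨0, π, rfl⟩
  by_cases h1 : ∃ π, x = (T₁.glue M.f).reorder π
  · obtain ⟨π, rfl⟩ := h1
    exact .inl ⟨1, π, rfl⟩
  exact .inr (M.outer x (not_exists.1 h0) (not_exists.1 h1))

theorem mem_range_castSuccEmb (w : Fin 4) :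
    w ∈ Set.range (Fin.castSuccEmb : Fin 3 ↪ Fin 4) ↔ w ≠ 3 := by
  simp only [Set.mem_range, Fin.coe_castSuccEmb]
  revert w
  decide

theorem face_cases (d : Fin 2) (m : Fin 3 ↪ Fin 4) :
    3 ∈ Set.range m ∨ ∃ π, M.face d m = (M.face d Fin.castSuccEmb).reorder π := by
  by_cases h : 3 ∈ Set.range m
  · exact .inl h
  · refine .inr (OrdTri.exists_reorder_eq rfl ?_)
    obtain ⟨v, hv⟩ := exists_missing_label m
    obtain rfl : 3 = v := by
      by_contra hne
      exact h ((hv 3).2 hne)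
    rw [M.face_opp d hv, M.face_opp d mem_range_castSuccEmb]

theorem proj_edge (d d' : Fin 2) {a b : Fin 4} (h : a ≠ b) :
    T₂.proj (M.edge d a b h) = T₂.proj (M.edge d' a b h) := by
  by_cases hd : d = d'
  · rw [hd]
  have key : ∀ a b : Fin 4, ∃ v, v ≠ a ∧ v ≠ b ∧ 3 ≠ v := by decide
  obtain ⟨v, hva, hvb, hv⟩ := key a b
  obtain ⟨m, rfl, rfl, hm⟩ := exists_face_labels h hva hvb
  have := T₂.proj_glue (M.face d m)
  rw [M.glue_inner hd ((hm 3).2 hv)] at this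
  exact this.symm

/-- The correspondence between the abstract edges of the two triangulations. -/
inductive EdgeCorr : AbsEdge τ₁ → AbsEdge τ₂ → Prop
  | old (q) : EdgeCorr q (M.oldEdge q)
  | new (d : Fin 2) (a b : Fin 3) (h : a ≠ b) :
      EdgeCorr (absEdge M.f.tet (M.f.vert a) (M.f.vert b) (M.f.vert.injective.ne h))
        (M.edge d a.castSucc b.castSucc (Fin.castSucc_injective _ |>.ne h))

variable {M}

/-- It suffices to look at `tet 0`, which is glued to the old tetrahedron along `f`. -/
theorem EdgeCorr.proj_eq {q : AbsEdge τ₁} {p : AbsEdge τ₂} (h : M.EdgeCorr q p) :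
    T₂.proj p = T₂.proj (M.oldEdge q) := by
  cases h with
  | old => rfl
  | new d a b h =>
    rw [M.proj_edge d 0]
    obtain ⟨π, rfl, rfl⟩ : ∃ π : Equiv.Perm (Fin 3), π 0 = a ∧ π 1 = b := by
      revert a b
      decide
    have := T₂.proj_glue (M.old (M.f.reorder π))
    exact (congrArg (fun y => T₂.proj (OrdTri.edge y)) (M.glue_old_side 0 π)).symm.trans this

theorem EdgeCorr.eq_of_right {q q' : AbsEdge τ₁} {p : AbsEdge τ₂} (h : M.EdgeCorr q p)
    (h' : M.EdgeCorr q' p) : q = q' := by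
  cases h with
  | old =>
    generalize hp : M.oldEdge q = p at h'
    cases h' with
    | old => exact M.oldEdge_injective hp
    | new => exact (M.oldEdge_ne_edge _ _ _ hp).elim
  | new d a b hab =>
    generalize hp : M.edge d a.castSucc b.castSucc _ = p at h'
    cases h' with
    | old => exact (M.oldEdge_ne_edge _ _ _ hp.symm).elim
    | new d' a' b' h' =>
      obtain ⟨-, ⟨h1, h2⟩ | ⟨h1, h2⟩⟩ := M.edge_inj.1 hp
      · obtain rfl := Fin.castSucc_injective _ h1
        obtain rfl := Fin.castSucc_injective _ h2
        rfl
      · obtain rfl := Fin.castSucc_injective _ h1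
        obtain rfl := Fin.castSucc_injective _ h2
        exact absEdge_comm _ _

theorem EdgeCorr.side {d : Fin 2} {a b : Fin 4} {h : a ≠ b} {q : AbsEdge τ₁}
    (hq : M.EdgeCorr q (M.edge d a b h)) (d' : Fin 2) : M.EdgeCorr q (M.edge d' a b h) := by
  generalize hp : M.edge d a b h = p at hq
  cases hq with
  | old => exact (M.oldEdge_ne_edge _ _ _ hp.symm).elim
  | new d'' a' b' h' =>
    obtain ⟨-, ⟨rfl, rfl⟩ | ⟨rfl, rfl⟩⟩ := M.edge_inj.1 hp
    · exact .new d' a' b' h'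
    · rw [M.edge_comm]
      exact .new d' a' b' h'

variable (M)

theorem edgeCorr_side (d d' : Fin 2) (π : Equiv.Perm (Fin 3)) :
    ∃ q, M.EdgeCorr q ((M.face d Fin.castSuccEmb).reorder π).edge ∧
      T₁.proj q = T₁.proj ((M.side d').reorder π).edge := by
  refine ⟨(M.f.reorder π).edge, .new d (π 0) (π 1) (π.injective.ne (by decide)), ?_⟩
  by_cases hd : d' = 0
  · subst hd; rfl
  · rw [← M.glue_side (d := 0) (d' := d') (Ne.symm hd), ← T₁.glue_reorder, T₁.proj_glue]
    rfl

theorem proj_eq_iff {q q' : AbsEdge τ₁} {p p' : AbsEdge τ₂} (h : M.EdgeCorr q p)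
    (h' : M.EdgeCorr q' p') : T₁.proj q = T₁.proj q' ↔ T₂.proj p = T₂.proj p' := by
  constructor
  · refine Triangulation.proj_eq_of_corr (R := M.EdgeCorr)
      (fun _ _ _ h h' => h.proj_eq.trans h'.proj_eq.symm) (fun x r hr => ?_) h h'
    refine ⟨_, .old _, ?_⟩
    rw [hr.proj_eq, ← M.old_edge, ← M.old_edge]
    rcases M.glue_old x with ⟨d, π, rfl⟩ | hx
    · obtain ⟨d', hd⟩ : ∃ d', d ≠ d' := exists_ne d |>.imp fun _ => Ne.symm
      rw [T₁.glue_reorder, M.glue_side hd, ← T₂.proj_glue, M.glue_old_side,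
        ← T₂.proj_glue (M.old _),
        M.glue_old_side]
      exact M.proj_edge d' d
        ((Fin.castSucc_injective 3).ne (π.injective.ne (show (0 : Fin 3) ≠ 1 by decide)))
    · rw [← hx, T₂.proj_glue]
  · refine Triangulation.proj_eq_of_corr (R := fun p q => M.EdgeCorr q p)
      (fun _ _ _ h h' => congrArg _ (h.eq_of_right h')) (fun y r hr => ?_) h h'
    rcases M.old_or_face y with ⟨x, rfl⟩ | ⟨d, m, rfl⟩
    · obtain rfl := hr.eq_of_right (EdgeCorr.old (M := M) x.edge)
      rcases M.glue_old x with ⟨d, π, rfl⟩ | hx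
      · rw [M.glue_old_side]
        exact M.edgeCorr_side d d π
      · rw [hx]
        exact ⟨_, .old _, T₁.proj_glue x⟩
    · rcases M.face_cases d m with hm | ⟨π, hπ⟩
      · obtain ⟨d', hd⟩ : ∃ d', d ≠ d' := exists_ne d |>.imp fun _ => Ne.symm
        rw [M.glue_inner hd hm]
        exact ⟨r, EdgeCorr.side (h := m.injective.ne (by decide)) hr d', rfl⟩
      · rw [hπ] at hr ⊢
        obtain ⟨q, hq, hq'⟩ := M.edgeCorr_side d d π
        obtain rfl := hr.eq_of_right hq
        rw [← M.glue_old_side, T₂.glue_glue]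
        exact ⟨_, .old _, hq'.symm⟩

theorem proj_oldEdge_eq_iff {q q' : AbsEdge τ₁} :
    T₂.proj (M.oldEdge q) = T₂.proj (M.oldEdge q') ↔ T₁.proj q = T₁.proj q' :=
  (M.proj_eq_iff (.old q) (.old q')).symm

/-- A new edge is identified only with its copy in the other new tetrahedron. -/
theorem proj_eq_spike_iff (d : Fin 2) {a : Fin 4} (ha : a ≠ 3) (p : AbsEdge τ₂) :
    T₂.proj p = T₂.proj (M.edge d a 3 ha) ↔ ∃ d', p = M.edge d' a 3 ha := by
  constructor
  · intro h
    refine T₂.of_proj_eq (Q := fun p => ∃ d', p = M.edge d' a 3 ha) ?_ h.symm ⟨d, rfl⟩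
    rintro y ⟨d', hy⟩
    rcases M.old_or_face y with ⟨x, rfl⟩ | ⟨d₁, m, rfl⟩
    · exact (M.oldEdge_ne_edge x.edge _ _ hy).elim
    · rw [M.face_edge] at hy
      obtain ⟨rfl, hm⟩ := M.edge_inj.1 hy
      have h3 : 3 ∈ Set.range m := by
        rcases hm with ⟨-, h⟩ | ⟨h, -⟩
        exacts [⟨1, h⟩, ⟨0, h⟩]
      obtain ⟨d₂, hd⟩ : ∃ d', d₁ ≠ d' := exists_ne d₁ |>.imp fun _ => Ne.symm
      rw [M.glue_inner hd h3, M.face_edge]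
      exact ⟨d₂, M.edge_inj.2 ⟨rfl, hm⟩⟩
  · rintro ⟨d', rfl⟩
    exact M.proj_edge _ _ _

theorem proj_cases (e : T₂.Edge) :
    (∃ q, e = T₂.proj (M.oldEdge q)) ∨ ∃ (a : Fin 4) (ha : a ≠ 3),
      e = T₂.proj (M.edge 0 a 3 ha) := by
  obtain ⟨p⟩ := e
  change (∃ q, T₂.proj p = _) ∨ ∃ a ha, T₂.proj p = _
  rcases M.oldEdge_or_edge p with ⟨q, rfl⟩ | ⟨d, a, b, hab, rfl⟩
  · exact .inl ⟨q, rfl⟩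
  · by_cases hb : b = 3
    · subst hb
      exact .inr ⟨a, hab, M.proj_edge _ _ _⟩
    by_cases ha : a = 3
    · subst ha
      exact .inr ⟨b, hb, by rw [M.edge_comm, M.proj_edge d 0]⟩
    · obtain ⟨a, rfl⟩ := Fin.exists_castSucc_eq.2 (show a ≠ Fin.last 3 from ha)
      obtain ⟨b, rfl⟩ := Fin.exists_castSucc_eq.2 (show b ≠ Fin.last 3 from hb)
      exact .inl ⟨_, (EdgeCorr.new d a b (fun h => hab (by rw [h]))).proj_eq⟩

variable {M} {c₁ : AbsEdge τ₁ → ℤ} {c₂ : AbsEdge τ₂ → ℤ}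

theorem sum_ite_edge (M : BubbleMove T₁ T₂) (c₂ : AbsEdge τ₂ → ℤ) (e : T₂.Edge) {a b : Fin 4}
    (h : a ≠ b) [DecidableEq T₂.Edge] :
    (∑ d, if T₂.proj (M.edge d a b h) = e then c₂ (M.edge d a b h) else 0) =
      if T₂.proj (M.edge 0 a b h) = e then M.sum c₂ a b h else 0 := by
  rw [Fin.sum_univ_two, M.proj_edge 1 0, NewPair.sum, Fin.sum_univ_two]
  split_ifs <;> simp

open Classical in
-- The new tetrahedra contribute 2 along the edge 01 and 0 along the other two edges of the face.
-- Hence the sum rises from 0 to 2 exactly at the edge that leaves the link. This holds even if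
-- edges of the face are identified with each other, since the contribution is computed label by
-- label.
theorem edgeSum_oldEdge [Fintype τ₁] [Fintype τ₂] (h : M.Transit c₁ c₂) (q : AbsEdge τ₁) :
    edgeSum T₂ c₂ (T₂.proj (M.oldEdge q)) =
      edgeSum T₁ c₁ (T₁.proj q) + if T₁.proj q = T₁.proj M.f.edge then 2 else 0 := by
  have hspike : ∀ {a : Fin 4} (ha : a ≠ 3),
      ¬ T₂.proj (M.edge 0 a 3 ha) = T₂.proj (M.oldEdge q) := by
    intro a ha heq
    obtain ⟨d, hd⟩ := (M.proj_eq_spike_iff 0 ha _).1 heq.symm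
    exact M.oldEdge_ne_edge _ _ _ hd
  have h01 : T₂.proj (M.edge 0 0 1 (by decide)) = T₂.proj (M.oldEdge q) ↔
      T₁.proj q = T₁.proj M.f.edge :=
    (M.proj_eq_iff (EdgeCorr.new 0 0 1 (by decide)) (.old q)).symm.trans eq_comm
  rw [edgeSum, Finset.sum_filter, M.sum_absEdge]
  simp only [sum_ite_edge, h.sum03, h.sum13, h.sum12, h.sum02, h.sum01, hspike, h01, ite_self,
    if_false, add_zero, M.proj_oldEdge_eq_iff, ← h.common]
  rw [edgeSum, Finset.sum_filter]

theorem edgeSum_spike [Fintype τ₂] (M : BubbleMove T₁ T₂) (c₂ : AbsEdge τ₂ → ℤ) {a : Fin 4}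
    (ha : a ≠ 3) : edgeSum T₂ c₂ (T₂.proj (M.edge 0 a 3 ha)) = M.sum c₂ a 3 ha := by
  classical
  symm
  refine Finset.sum_nbij (fun d => M.edge d a 3 ha) ?_ ?_ ?_ fun _ _ => rfl
  · intro d _
    simpa using M.proj_edge d 0 ha
  · intro d _ d' _ hd
    exact (M.edge_inj.1 hd).1
  · intro p hp
    obtain ⟨d, rfl⟩ := (M.proj_eq_spike_iff 0 ha p).1 (Finset.mem_filter.1 hp).2
    exact ⟨d, by simp, rfl⟩

/-- The sums along the three new edges are 0, 0 and 2. -/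
theorem Transit.even_spike (h : M.Transit c₁ c₂) {a : Fin 4} (ha : a ≠ 3) {d d' : Fin 2}
    (hd : d ≠ d') :
    (c₂ (M.edge d a 3 ha) : ZMod 2) + (c₂ (M.edge d' a 3 ha) : ZMod 2) = 0 := by
  have hs : ∀ a (ha : a ≠ 3), ((M.sum c₂ a 3 ha : ℤ) : ZMod 2) = 0 := by
    intro a ha
    obtain ⟨a, rfl⟩ := Fin.exists_castSucc_eq.2 (show a ≠ Fin.last 3 from ha)
    fin_cases a
    · exact congrArg (Int.cast : ℤ → ZMod 2) h.sum03
    · exact congrArg (Int.cast : ℤ → ZMod 2) h.sum13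
    · exact congrArg (Int.cast : ℤ → ZMod 2) h.sum23
  rw [← hs a ha, NewPair.sum_eq _ _ _ hd]
  push_cast
  rfl

theorem exists_isPotential₂ (hc₂ : IsRoughCharge c₂) (h : M.Transit c₁ c₂)
    {φ₁ : τ₁ → Fin 4 → ZMod 2} (hφ : IsPotential T₁ c₁ φ₁) : ∃ φ₂, IsPotential T₂ c₂ φ₂ := by
  have h2 : (2 : ZMod 2) = 0 := rfl
  -- The value on the outer face of `tet d` is forced by its gluing to an old face; from there
  -- `labelPot` spreads it to the three inner faces. The values on the two sides still differ by 1,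
  -- as the inner gluings require.
  let z : Fin 2 → ZMod 2 := fun d => φ₁ (M.side d).tet (M.side d).opp + 1
  have hz : ∀ d d', d ≠ d' → z d' = z d + 1 := by
    intro d d' hd
    simp only [z, ← M.glue_side hd, hφ.glue]
  let s := M.labelPot c₂ 3 z
  have hside : ∀ d, M.extend φ₁ s (M.face d Fin.castSuccEmb).tet (M.face d Fin.castSuccEmb).opp =
      z d := fun d => (NewPair.extend_face d mem_range_castSuccEmb).trans
    (NewPair.labelPot_self _ _ _)
  refine ⟨M.extend φ₁ s, fun y => ?_,
    NewPair.extend_add h.common hφ.tet (NewPair.labelPot_add hc₂ 3 z)⟩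
  rcases M.old_or_face y with ⟨x, rfl⟩ | ⟨d, m, rfl⟩
  · rw [NewPair.extend_old]
    rcases M.glue_old x with ⟨d, π, rfl⟩ | hx
    · rw [M.glue_old_side, OrdTri.opp_reorder, OrdTri.tet_reorder, hside]
      simp [z]
    · rw [hx, NewPair.extend_old, hφ.glue]
  · rcases M.face_cases d m with hm | ⟨π, hπ⟩
    · obtain ⟨d', hd⟩ : ∃ d', d ≠ d' := exists_ne d |>.imp fun _ => Ne.symm
      obtain ⟨a, ha⟩ := exists_missing_label m
      have ha3 : 3 ≠ a := (ha 3).1 hm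
      rw [M.glue_inner hd hm, NewPair.extend_face d ha, NewPair.extend_face d' ha]
      change M.labelPot c₂ 3 z d' a = M.labelPot c₂ 3 z d a + 1
      rw [NewPair.labelPot_of_ne ha3, NewPair.labelPot_of_ne ha3, hz d d' hd, M.edge_comm d,
        M.edge_comm d']
      linear_combination h.even_spike ha3.symm hd - (c₂ (M.edge d a 3 ha3.symm) : ZMod 2) * h2
    · have h4 : T₂.glue (M.face d m) = M.old ((M.side d).reorder π) := by
        rw [hπ, ← M.glue_old_side, T₂.glue_glue]
      rw [h4, NewPair.extend_old, hπ]
      simp only [OrdTri.opp_reorder, OrdTri.tet_reorder, hside, z]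
      linear_combination -h2

theorem isPotential₁ (h : M.Transit c₁ c₂) {φ₂ : τ₂ → Fin 4 → ZMod 2}
    (hφ : IsPotential T₂ c₂ φ₂) : IsPotential T₁ c₁ fun t v => φ₂ (M.common t).1 v := by
  have h2 : (2 : ZMod 2) = 0 := rfl
  refine ⟨fun x => ?_, NewPair.restrict_add h.common hφ.tet⟩
  change φ₂ (M.old (T₁.glue x)).tet (M.old (T₁.glue x)).opp =
    φ₂ (M.old x).tet (M.old x).opp + 1
  rcases M.glue_old x with ⟨d, π, rfl⟩ | hx
  · obtain ⟨d', hd⟩ : ∃ d', d ≠ d' := exists_ne d |>.imp fun _ => Ne.symm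
    have e1 := hφ.glue (M.old ((M.side d).reorder π))
    have e2 := hφ.glue (M.old ((M.side d').reorder π))
    rw [M.glue_old_side] at e1 e2
    rw [T₁.glue_reorder, M.glue_side hd]
    obtain ⟨m, hm0, hm1, hm⟩ := exists_face_labels (a := 2) (b := 3) (v := 0) (by decide)
      (by decide) (by decide)
    have e3 := hφ.glue (M.face d m)
    rw [M.glue_inner hd ((hm 3).2 (by decide)), M.face_opp d hm, M.face_opp d' hm] at e3
    rw [OrdTri.opp_reorder, M.face_opp _ mem_range_castSuccEmb] at e1 e2
    have e4 := hφ.tet (M.tet d) _ _ ((M.lab d).injective.ne (show (0 : Fin 4) ≠ 3 by decide))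
    have e5 := hφ.tet (M.tet d') _ _ ((M.lab d').injective.ne (show (0 : Fin 4) ≠ 3 by decide))
    rw [M.chargeAt_lab _ _ (by decide)] at e4 e5
    change φ₂ (M.tet d) _ = _ at e1
    change φ₂ (M.tet d') _ = _ at e2
    change φ₂ (M.tet d') _ = φ₂ (M.tet d) _ + 1 at e3
    have hs := h.even_spike (show (0 : Fin 4) ≠ 3 by decide) hd
    -- The path crosses the pillow through the inner face opposite to 0. With the two gluings at its
    -- ends the total change is 3 = 1, as for the single gluing in `T₁`.
    have e6 : φ₂ (M.tet d') (M.lab d' 3) = φ₂ (M.tet d) (M.lab d 3) + 1 := by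
      linear_combination e4 + e5 - e3 + hs - (φ₂ (M.tet d) (M.lab d 0) +
        φ₂ (M.tet d) (M.lab d 3)) * h2
    linear_combination e1 - e2 + e6
  · rw [← hx, hφ.glue]

theorem IsDistinguished.proj_oldEdge_notMem {H₁ : Set T₁.Edge} {H₂ : Set T₂.Edge}
    (hM : M.IsDistinguished H₁ H₂) {q : AbsEdge τ₁} (hq : T₁.proj q = T₁.proj M.f.edge) :
    T₂.proj (M.oldEdge q) ∉ H₂ := by
  rw [← (M.proj_eq_iff (EdgeCorr.new 0 0 1 (by decide)) (.old q)).1 hq.symm]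
  exact hM.removed

variable [Fintype τ₁] [Fintype τ₂] {H₁ : Set T₁.Edge} {H₂ : Set T₂.Edge}

theorem isIntegralCharge₂ (hM : M.IsDistinguished H₁ H₂) (hc₁ : IsIntegralCharge T₁ H₁ c₁)
    (hc₂ : IsRoughCharge c₂) (h : M.Transit c₁ c₂) : IsIntegralCharge T₂ H₂ c₂ := by
  classical
  obtain ⟨φ₁, hφ₁⟩ := exists_isPotential hc₁.rough hc₁.curve
  obtain ⟨φ₂, hφ₂⟩ := exists_isPotential₂ hc₂ h hφ₁
  refine ⟨hc₂, fun e he => ?_, fun e he => ?_, hφ₂.curve hc₂⟩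
  · rcases M.proj_cases e with ⟨q, rfl⟩ | ⟨a, ha, rfl⟩
    · rw [edgeSum_oldEdge h]
      split_ifs with hq
      · rw [hq, hc₁.sum_of_mem _ hM.former, zero_add]
      · rw [hc₁.sum_of_notMem _ fun h' => he ((hM.common q hq).1 h'), add_zero]
    · rw [edgeSum_spike]
      obtain ⟨a, rfl⟩ := Fin.exists_castSucc_eq.2 (show a ≠ Fin.last 3 from ha)
      fin_cases a
      exacts [(he hM.new03).elim, (he hM.new13).elim, h.sum23]
  · rcases M.proj_cases e with ⟨q, rfl⟩ | ⟨a, ha, rfl⟩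
    · rw [edgeSum_oldEdge h]
      split_ifs with hq
      · exact (hM.proj_oldEdge_notMem hq he).elim
      · rw [hc₁.sum_of_mem _ ((hM.common q hq).2 he), add_zero]
    · rw [edgeSum_spike]
      obtain ⟨a, rfl⟩ := Fin.exists_castSucc_eq.2 (show a ≠ Fin.last 3 from ha)
      fin_cases a
      exacts [h.sum03, h.sum13, (hM.new23 he).elim]

theorem isIntegralCharge₁ (hM : M.IsDistinguished H₁ H₂) (hc₂ : IsIntegralCharge T₂ H₂ c₂)
    (hc₁ : IsRoughCharge c₁) (h : M.Transit c₁ c₂) : IsIntegralCharge T₁ H₁ c₁ := by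
  classical
  obtain ⟨φ₂, hφ₂⟩ := exists_isPotential hc₂.rough hc₂.curve
  refine ⟨hc₁, ?_, ?_, (isPotential₁ h hφ₂).curve hc₁⟩
  · rintro ⟨q⟩ hq
    change T₁.proj q ∉ H₁ at hq
    change edgeSum T₁ c₁ (T₁.proj q) = 2
    have hf : T₁.proj q ≠ T₁.proj M.f.edge := fun hf => hq (hf ▸ hM.former)
    have := edgeSum_oldEdge h q
    rw [if_neg hf, add_zero] at this
    rw [← this]
    exact hc₂.sum_of_notMem _ fun h' => hq ((hM.common q hf).2 h')
  · rintro ⟨q⟩ hq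
    change T₁.proj q ∈ H₁ at hq
    change edgeSum T₁ c₁ (T₁.proj q) = 0
    have := edgeSum_oldEdge h q
    split_ifs at this with hf
    · rw [hc₂.sum_of_notMem _ (hM.proj_oldEdge_notMem hf)] at this
      linarith
    · rw [hc₂.sum_of_mem _ ((hM.common q hf).1 hq)] at this
      linarith

end BubbleMove

/-! ### The 0-2 move: collapsing the pillow -/

namespace NewPair

variable {τ₁ τ₂ : Type*} {N : NewPair τ₁ τ₂} {T₂ : Triangulation τ₂}

theorem Through.eq_of_old {x : OrdTri τ₁} {v : OrdTri τ₂} (h : N.Through T₂ (N.old x) v) :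
    v = N.old x := by
  generalize hu : N.old x = u at h
  cases h with
  | arrive => rfl
  | pass d d' m _ _ _ _ _ => exact (N.old_ne_face x d m hu).elim

theorem old_edge_ne_face_edge (x : OrdTri τ₁) (d : Fin 2) (m : Fin 3 ↪ Fin 4) :
    (N.old x).edge ≠ (N.face d m).edge :=
  N.oldEdge_ne_edge x.edge d (m.injective.ne (by decide))

theorem fin_two_eq {d d' d'' : Fin 2} (h : d ≠ d') (h' : d ≠ d'') : d' = d'' := by
  revert d d' d''
  decide

theorem Through.of_face {d : Fin 2} {m : Fin 3 ↪ Fin 4} {v : OrdTri τ₂}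
    (h : N.Through T₂ (N.face d m) v) {d' : Fin 2} (hd : d ≠ d') :
    0 ∈ Set.range m ∧ 1 ∈ Set.range m ∧ N.Through T₂ (T₂.glue (N.face d' m)) v := by
  generalize hu : N.face d m = u at h
  cases h with
  | arrive x => exact (N.old_ne_face x d m hu.symm).elim
  | pass d₁ d₁' m₁ _ hd₁ h0 h1 h =>
    obtain ⟨rfl, rfl⟩ := N.face_inj hu
    rw [fin_two_eq hd hd₁]
    exact ⟨h0, h1, h⟩

/-- The collapsing of the pillow is well-defined. -/
theorem Through.unique {u v v' : OrdTri τ₂} (h : N.Through T₂ u v) (h' : N.Through T₂ u v') :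
    v = v' := by
  induction h with
  | arrive x => exact h'.eq_of_old.symm
  | pass d d' m v hd h0 h1 h ih => exact ih (h'.of_face hd).2.2

theorem Through.reorder {u v : OrdTri τ₂} (h : N.Through T₂ u v) (π : Equiv.Perm (Fin 3)) :
    N.Through T₂ (u.reorder π) (v.reorder π) := by
  induction h with
  | arrive x => exact .arrive (x.reorder π)
  | pass d d' m v hd h0 h1 h ih =>
    rw [← T₂.glue_reorder] at ih
    have hr : ∀ w, w ∈ Set.range m → w ∈ Set.range (π.toEmbedding.trans m) := by
      rintro _ ⟨i, rfl⟩
      exact ⟨π.symm i, by simp⟩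
    exact .pass d d' (π.toEmbedding.trans m) _ hd (hr _ h0) (hr _ h1) ih

/-- A passage through the pillow can be retraced: whatever is reached by turning back at the start
`u` is also reached by turning back at the end `w`. -/
theorem Through.glue_right {u w v : OrdTri τ₂} (h : N.Through T₂ u w)
    (h' : N.Through T₂ (T₂.glue u) v) : N.Through T₂ (T₂.glue w) v := by
  induction h generalizing v with
  | arrive x => exact h'
  | pass d d' m _ hd h0 h1 h ih =>
    refine ih ?_
    rw [T₂.glue_glue]
    exact .pass d' d m v hd.symm h0 h1 h'

end NewPair

/-! ### The 0-2 move: correspondence of edges -/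

namespace ZeroTwoMove

open NewPair

variable {τ₁ τ₂ : Type*} {T₁ : Triangulation τ₁} {T₂ : Triangulation τ₂} (M : ZeroTwoMove T₁ T₂)

theorem glue_inner {d d' : Fin 2} (hd : d ≠ d') {m : Fin 3 ↪ Fin 4} (h2 : 2 ∈ Set.range m)
    (h3 : 3 ∈ Set.range m) : T₂.glue (M.face d m) = M.face d' m := by
  have key : ∀ d d' : Fin 2, d ≠ d' → d = 0 ∧ d' = 1 ∨ d = 1 ∧ d' = 0 := by decide
  rcases key d d' hd with ⟨rfl, rfl⟩ | ⟨rfl, rfl⟩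
  · exact M.inner m h2 h3
  · rw [← M.inner m h2 h3, T₂.glue_glue]

theorem face_cases (m : Fin 3 ↪ Fin 4) :
    (0 ∈ Set.range m ∧ 1 ∈ Set.range m) ∨ (2 ∈ Set.range m ∧ 3 ∈ Set.range m) := by
  obtain ⟨v, hv⟩ := exists_missing_label m
  simp only [hv]
  clear hv
  revert v
  decide

theorem proj_edge (d d' : Fin 2) {a b : Fin 4} (h : a ≠ b)
    (h01 : ¬ (a = 0 ∧ b = 1 ∨ a = 1 ∧ b = 0)) :
    T₂.proj (M.edge d a b h) = T₂.proj (M.edge d' a b h) := by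
  by_cases hd : d = d'
  · rw [hd]
  have key : ∀ a b : Fin 4, a ≠ b → ¬ (a = 0 ∧ b = 1 ∨ a = 1 ∧ b = 0) →
    ∃ v, v ≠ a ∧ v ≠ b ∧ 2 ≠ v ∧ 3 ≠ v := by decide
  obtain ⟨v, hva, hvb, h2, h3⟩ := key a b h h01
  obtain ⟨m, rfl, rfl, hm⟩ := exists_face_labels h hva hvb
  have := T₂.proj_glue (M.face d m)
  rw [M.glue_inner hd ((hm 2).2 h2) ((hm 3).2 h3)] at this
  exact this.symm

theorem exists_through {d : Fin 2} {m : Fin 3 ↪ Fin 4} (h0 : 0 ∈ Set.range m)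
    (h1 : 1 ∈ Set.range m) : ∃ x, M.Through T₂ (M.face d m) (M.old x) := by
  obtain ⟨d', hd⟩ : ∃ d', d ≠ d' := exists_ne d |>.imp fun _ => Ne.symm
  obtain ⟨x, hx⟩ := M.persist d' m h0 h1
  exact ⟨x, .pass d d' m _ hd h0 h1 hx⟩

/-- Collapsing the pillow is compatible with the gluings. -/
theorem through_glue {u : OrdTri τ₂} {x : OrdTri τ₁} (h : M.Through T₂ u (M.old x)) :
    M.Through T₂ (T₂.glue u) (M.old (T₁.glue x)) := by
  have hex : ∃ y, M.Through T₂ (T₂.glue u) (M.old y) := by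
    rcases M.old_or_face u with ⟨x', rfl⟩ | ⟨d, m, rfl⟩
    · exact ⟨_, M.outer x'⟩
    · obtain ⟨d', hd⟩ : ∃ d', d ≠ d' := exists_ne d |>.imp fun _ => Ne.symm
      obtain ⟨h0, h1, -⟩ := h.of_face hd
      exact M.persist d m h0 h1
  obtain ⟨y, hy⟩ := hex
  -- `persist` guarantees that the passage ends at some old face; retracing it and uniqueness show
  -- that this is the face glued to `x` in `T₁`.
  rw [(M.outer x).unique (h.glue_right hy)]
  exact hy

theorem through_other_face {d d' : Fin 2} (hd : d ≠ d') {m : Fin 3 ↪ Fin 4} {x : OrdTri τ₁}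
    (h : M.Through T₂ (M.face d m) (M.old x)) :
    M.Through T₂ (M.face d' m) (M.old (T₁.glue x)) := by
  have := M.through_glue (h.of_face hd).2.2
  rwa [T₂.glue_glue] at this

/-- The edge is one of the two edges of `T₂` into which `e₀` is split. -/
def IsSplit (e : T₂.Edge) : Prop :=
  e = T₂.proj (M.edge 0 0 1 (by decide)) ∨ e = T₂.proj (M.edge 1 0 1 (by decide))

theorem isSplit_edge (d : Fin 2) {a b : Fin 4} (h : a ≠ b) (h01 : a = 0 ∧ b = 1 ∨ a = 1 ∧ b = 0) :
    M.IsSplit (T₂.proj (M.edge d a b h)) := by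
  have : M.edge d a b h = M.edge d 0 1 (by decide) := M.edge_inj.2 ⟨rfl, h01⟩
  rw [this]
  fin_cases d
  · exact .inl rfl
  · exact .inr rfl

/-- The two copies of an edge other than 01 are already identified in the pillow; only the copies of
01 are merged by collapsing. -/
theorem proj_eq_of_through {u v : OrdTri τ₂} (h : M.Through T₂ u v) :
    (M.IsSplit (T₂.proj u.edge) ∧ M.IsSplit (T₂.proj v.edge)) ∨
      T₂.proj u.edge = T₂.proj v.edge := by
  induction h with
  | arrive x => exact .inr rfl
  | pass d d' m v hd h0 h1 h ih =>
    rw [T₂.proj_glue, M.face_edge] at ih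
    rw [M.face_edge]
    by_cases h01 : m 0 = 0 ∧ m 1 = 1 ∨ m 0 = 1 ∧ m 1 = 0
    · refine .inl ⟨M.isSplit_edge _ _ h01, ?_⟩
      rcases ih with ih | ih
      · exact ih.2
      · exact ih ▸ M.isSplit_edge _ _ h01
    · rwa [M.proj_edge d d' _ h01]

theorem isSplit_oldEdge_iff (q : AbsEdge τ₁) :
    M.IsSplit (T₂.proj (M.oldEdge q)) ↔ T₁.proj q = M.e₀ := (M.split q).symm

/-- Two faces outside the interior of the pillow with a common edge which is not split
are equal up to the order of the vertices of that edge, unless they are old. -/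
theorem eq_of_through {u u' : OrdTri τ₂} {x x' : OrdTri τ₁} (h : M.Through T₂ u (M.old x))
    (h' : M.Through T₂ u' (M.old x')) (he : u.edge = u'.edge)
    (hs : ¬ M.IsSplit (T₂.proj u.edge)) : x.edge = x'.edge := by
  rcases M.old_or_face u with ⟨x₀, rfl⟩ | ⟨d, m, rfl⟩
  · rcases M.old_or_face u' with ⟨x₀', rfl⟩ | ⟨d', m', rfl⟩
    · obtain rfl := M.old_injective h.eq_of_old
      obtain rfl := M.old_injective h'.eq_of_old
      exact M.oldEdge_injective he
    · exact (old_edge_ne_face_edge _ _ _ he).elim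
  · rcases M.old_or_face u' with ⟨x₀', rfl⟩ | ⟨d', m', rfl⟩
    · exact (old_edge_ne_face_edge _ _ _ he.symm).elim
    · rw [M.face_edge] at he hs
      rw [M.face_edge] at he
      obtain ⟨rfl, hm⟩ := M.edge_inj.1 he
      obtain ⟨d', hd⟩ : ∃ d', d ≠ d' := exists_ne d |>.imp fun _ => Ne.symm
      have h01 : ¬ (m 0 = 0 ∧ m 1 = 1 ∨ m 0 = 1 ∧ m 1 = 0) := fun h01 =>
        hs (M.isSplit_edge _ _ h01)
      obtain ⟨h0, h1, -⟩ := h.of_face hd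
      obtain ⟨h0', h1', -⟩ := h'.of_face hd
      obtain ⟨v, hv⟩ := exists_missing_label m
      obtain ⟨v', hv'⟩ := exists_missing_label m'
      have n0 := (hv (m 0)).1 ⟨0, rfl⟩
      have n1 := (hv (m 1)).1 ⟨1, rfl⟩
      have n0' := (hv' (m' 0)).1 ⟨0, rfl⟩
      have n1' := (hv' (m' 1)).1 ⟨1, rfl⟩
      have n01 : m 0 ≠ m 1 := m.injective.ne (by decide)
      rw [hv] at h0 h1
      rw [hv'] at h0' h1'
      -- The outer faces of one new tetrahedron are 012 and 013, and these meet only in the edge 01.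
      have key : ∀ a b v v' : Fin 4, a ≠ b → (a ≠ v ∧ b ≠ v) ∧ (a ≠ v' ∧ b ≠ v') →
        (0 ≠ v ∧ 1 ≠ v) ∧ (0 ≠ v' ∧ 1 ≠ v') → (a = 0 ∧ b = 1 ∨ a = 1 ∧ b = 0) ∨ v = v' := by
        decide
      have hvv : v = v' := by
        rcases hm with ⟨e0, e1⟩ | ⟨e0, e1⟩
        · rw [← e0] at n0'
          rw [← e1] at n1'
          exact (key _ _ v v' n01 ⟨⟨n0, n1⟩, n0', n1'⟩ ⟨⟨h0, h1⟩, h0', h1'⟩).resolve_left h01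
        · rw [← e1] at n0'
          rw [← e0] at n1'
          exact (key _ _ v v' n01 ⟨⟨n0, n1⟩, n1', n0'⟩ ⟨⟨h0, h1⟩, h0', h1'⟩).resolve_left h01
      subst hvv
      obtain ⟨i, hi⟩ := (hv' (m 2)).2 ((hv (m 2)).1 ⟨2, rfl⟩)
      have hi2 : i = 2 := by
        rcases hm with ⟨e0, e1⟩ | ⟨e0, e1⟩ <;> fin_cases i
        · exact absurd (m.injective (e0.trans hi)) (by decide)
        · exact absurd (m.injective (e1.trans hi)) (by decide)
        · rfl
        · exact absurd (m.injective (e1.trans hi)) (by decide)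
        · exact absurd (m.injective (e0.trans hi)) (by decide)
        · rfl
      subst hi2
      rcases hm with ⟨e0, e1⟩ | ⟨e0, e1⟩
      · have : m = m' := by
          ext i : 1
          fin_cases i
          exacts [e0, e1, hi.symm]
        subst this
        rw [M.old_injective (h.unique h')]
      · have : M.face d m' = (M.face d m).reorder (Equiv.swap 0 1) := by
          refine OrdTri.ext rfl ?_
          ext i : 1
          fin_cases i
          · exact congrArg (M.lab d) e1.symm
          · exact congrArg (M.lab d) e0.symm
          · exact congrArg (M.lab d) hi
        rw [this] at h'
        have := (h.reorder (Equiv.swap 0 1)).unique h'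
        rw [← M.old_injective (show M.old (x.reorder (Equiv.swap 0 1)) = M.old x' from this),
          OrdTri.edge_reorder_swap]

/-- Away from the split edge the collapse is injective on edge classes. A chain of identifications
in `T₂` may run through the pillow, so it is followed in `T₁` by collapsing the faces that carry its
edges. -/
theorem proj_oldEdge_eq_iff {q q' : AbsEdge τ₁} (hq : T₁.proj q ≠ M.e₀) :
    T₂.proj (M.oldEdge q) = T₂.proj (M.oldEdge q') ↔ T₁.proj q = T₁.proj q' := by
  constructor
  · intro h
    have hs : ∀ q, T₁.proj q ≠ M.e₀ → ¬ M.IsSplit (T₂.proj (M.oldEdge q)) := fun q hq hs =>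
      hq ((M.isSplit_oldEdge_iff q).1 hs)
    have hq' : T₁.proj q' ≠ M.e₀ := by
      rw [Ne, ← M.isSplit_oldEdge_iff, ← h]
      exact hs q hq
    have hex : ∀ q : AbsEdge τ₁, ∃ x : OrdTri τ₁, x.edge = q := by
      intro q
      obtain ⟨a, b, hab, hq⟩ := Triangulation.exists_absEdge_eq q
      have key : ∀ a b : Fin 4, ∃ v, v ≠ a ∧ v ≠ b := by decide
      obtain ⟨v, hva, hvb⟩ := key a b
      obtain ⟨m, rfl, rfl, -⟩ := exists_face_labels hab hva hvb
      exact ⟨⟨q.1, m⟩, hq.symm⟩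
    obtain ⟨x, rfl⟩ := hex q
    obtain ⟨x', rfl⟩ := hex q'
    -- An edge `p` of `T₂` corresponds to `q` if some face having `p` as its first edge collapses to
    -- an old face with first edge `q`.
    refine Triangulation.proj_eq_of_corr (T := T₂) (R := fun p q => ¬ M.IsSplit (T₂.proj p) ∧
      ∃ u x, M.Through T₂ u (M.old x) ∧ u.edge = p ∧ x.edge = q) ?_ ?_
      ⟨hs _ hq, M.old x, x, .arrive x, rfl, rfl⟩ ⟨hs _ hq', M.old x', x', .arrive x', rfl, rfl⟩ h
    · rintro p _ _ ⟨hp, u, x, h, rfl, rfl⟩ ⟨-, u', x', h', he, rfl⟩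
      rw [M.eq_of_through h h' he.symm hp]
    · rintro y _ ⟨hp, u, x, h, hu, rfl⟩
      rw [T₂.proj_glue]
      rcases M.old_or_face y with ⟨y, rfl⟩ | ⟨d, m, rfl⟩
      · refine ⟨_, ⟨hp, _, _, M.outer y, rfl, rfl⟩, ?_⟩
        rw [T₁.proj_glue, M.eq_of_through (.arrive y) h hu.symm hp]
      rcases face_cases m with ⟨h0, h1⟩ | ⟨h2, h3⟩
      · obtain ⟨x', hx'⟩ := M.exists_through (d := d) h0 h1
        refine ⟨_, ⟨hp, _, _, M.through_glue hx', rfl, rfl⟩, ?_⟩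
        rw [T₁.proj_glue, M.eq_of_through hx' h hu.symm hp]
      · obtain ⟨d', hd⟩ : ∃ d', d ≠ d' := exists_ne d |>.imp fun _ => Ne.symm
        rw [M.glue_inner hd h2 h3]
        rcases M.old_or_face u with ⟨x₀, rfl⟩ | ⟨d₁, m₁, rfl⟩
        · exact (old_edge_ne_face_edge _ _ _ hu).elim
        · rw [M.face_edge, M.face_edge] at hu
          obtain ⟨rfl, hm⟩ := M.edge_inj.1 hu
          refine ⟨_, ⟨hp, _, _, M.through_other_face hd h, ?_, rfl⟩, T₁.proj_glue x⟩
          rw [M.face_edge, M.face_edge]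
          exact M.edge_inj.2 ⟨rfl, hm⟩
  · intro h
    refine Triangulation.proj_eq_of_corr (T := T₁)
      (R := fun q p => T₁.proj q ≠ M.e₀ ∧ p = M.oldEdge q) ?_ ?_ ⟨hq, rfl⟩ ⟨h ▸ hq, rfl⟩ h
    · rintro q _ _ ⟨-, rfl⟩ ⟨-, rfl⟩
      rfl
    · rintro x _ ⟨hx, rfl⟩
      refine ⟨_, ⟨(T₁.proj_glue x).trans_ne hx, rfl⟩, ?_⟩
      have h1 := M.proj_eq_of_through (M.outer x)
      rw [T₂.proj_glue] at h1
      rcases h1 with h1 | h1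
      · exact (hx ((M.isSplit_oldEdge_iff _).1 h1.1)).elim
      · exact h1.symm

/-- The new interior edge is not identified with any other edge. -/
theorem proj_eq_interior_iff (p : AbsEdge τ₂) :
    T₂.proj p = T₂.proj (M.edge 0 2 3 (by decide)) ↔ ∃ d, p = M.edge d 2 3 (by decide) := by
  constructor
  · intro h
    refine T₂.of_proj_eq (Q := fun p => ∃ d, p = M.edge d 2 3 (by decide)) ?_ h.symm ⟨0, rfl⟩
    rintro y ⟨d', hy⟩
    rcases M.old_or_face y with ⟨x, rfl⟩ | ⟨d, m, rfl⟩
    · exact (M.oldEdge_ne_edge x.edge _ _ hy).elim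
    · rw [M.face_edge] at hy
      obtain ⟨rfl, hm⟩ := M.edge_inj.1 hy
      have h23 : 2 ∈ Set.range m ∧ 3 ∈ Set.range m := by
        rcases hm with ⟨h, h'⟩ | ⟨h, h'⟩
        exacts [⟨⟨0, h⟩, ⟨1, h'⟩⟩, ⟨⟨1, h'⟩, ⟨0, h⟩⟩]
      obtain ⟨d₂, hd⟩ : ∃ d', d ≠ d' := exists_ne d |>.imp fun _ => Ne.symm
      rw [M.glue_inner hd h23.1 h23.2, M.face_edge]
      exact ⟨d₂, M.edge_inj.2 ⟨rfl, hm⟩⟩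
  · rintro ⟨d', rfl⟩
    exact M.proj_edge _ _ _ (by decide)

theorem proj_cases (e : T₂.Edge) :
    M.IsSplit e ∨ e = T₂.proj (M.edge 0 2 3 (by decide)) ∨
      ∃ q, T₁.proj q ≠ M.e₀ ∧ e = T₂.proj (M.oldEdge q) := by
  have hold : ∀ q, M.IsSplit (T₂.proj (M.oldEdge q)) ∨
      ∃ q', T₁.proj q' ≠ M.e₀ ∧ T₂.proj (M.oldEdge q) = T₂.proj (M.oldEdge q') := by
    intro q
    by_cases hq : T₁.proj q = M.e₀
    · exact .inl ((M.isSplit_oldEdge_iff q).2 hq)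
    · exact .inr ⟨q, hq, rfl⟩
  obtain ⟨p⟩ := e
  change M.IsSplit (T₂.proj p) ∨ T₂.proj p = _ ∨ ∃ q, _ ∧ T₂.proj p = _
  rcases M.oldEdge_or_edge p with ⟨q, rfl⟩ | ⟨d, a, b, hab, rfl⟩
  · exact (hold q).imp_right .inr
  · have key : ∀ a b : Fin 4, a ≠ b → (a = 2 ∧ b = 3 ∨ a = 3 ∧ b = 2) ∨
      ∃ v, v ≠ a ∧ v ≠ b ∧ 0 ≠ v ∧ 1 ≠ v := by decide
    rcases key a b hab with h23 | ⟨v, hva, hvb, h0, h1⟩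
    · exact .inr (.inl ((M.proj_eq_interior_iff _).2 ⟨d, M.edge_inj.2 ⟨rfl, h23⟩⟩))
    · obtain ⟨m, rfl, rfl, hm⟩ := exists_face_labels hab hva hvb
      obtain ⟨x, hx⟩ := M.exists_through (d := d) ((hm 0).2 h0) ((hm 1).2 h1)
      rcases M.proj_eq_of_through hx with h | h
      · exact .inl h.1
      · rw [M.face_edge] at h
        rw [h]
        exact (hold x.edge).imp_right .inr

variable {M} {c₁ : AbsEdge τ₁ → ℤ} {c₂ : AbsEdge τ₂ → ℤ}

theorem interior_not_isSplit (d : Fin 2) :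
    ¬ T₂.proj (M.edge 0 2 3 (by decide)) = T₂.proj (M.edge d 0 1 (by decide)) := by
  intro h
  obtain ⟨d', hd'⟩ := (M.proj_eq_interior_iff _).1 h.symm
  have := (M.edge_inj.1 hd').2
  revert this
  decide

/-! ### The 0-2 move: sums around edges -/

section EdgeSums

theorem sum_ite_edge (M : ZeroTwoMove T₁ T₂) {A : Type*} [AddCommMonoid A] (F : AbsEdge τ₂ → A)
    (e : T₂.Edge) {a b : Fin 4} (h : a ≠ b) (h01 : ¬ (a = 0 ∧ b = 1 ∨ a = 1 ∧ b = 0))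
    [DecidableEq T₂.Edge] :
    (∑ d, if T₂.proj (M.edge d a b h) = e then F (M.edge d a b h) else 0) =
      if T₂.proj (M.edge 0 a b h) = e then ∑ d, F (M.edge d a b h) else 0 := by
  rw [Fin.sum_univ_two, M.proj_edge 1 0 h h01, Fin.sum_univ_two]
  split_ifs <;> simp

theorem chargeAt_vertex (hc₂ : IsRoughCharge c₂) (d : Fin 2) :
    c₂ (M.edge d 0 1 (by decide)) + c₂ (M.edge d 0 2 (by decide)) +
      c₂ (M.edge d 0 3 (by decide)) = 1 := by
  simp only [← M.chargeAt_lab]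
  refine hc₂.vertex _ ?_ ?_ ?_ ?_ ?_ ?_ <;> exact (M.lab d).injective.ne (by decide)

theorem charge_opposite (hc₂ : IsRoughCharge c₂) (d : Fin 2) :
    c₂ (M.edge d 0 1 (by decide)) = c₂ (M.edge d 2 3 (by decide)) ∧
    c₂ (M.edge d 0 2 (by decide)) = c₂ (M.edge d 1 3 (by decide)) ∧
    c₂ (M.edge d 0 3 (by decide)) = c₂ (M.edge d 1 2 (by decide)) := by
  simp only [← M.chargeAt_lab]
  refine ⟨hc₂.opposite _ ?_ ?_ ?_ ?_ ?_ ?_, hc₂.opposite _ ?_ ?_ ?_ ?_ ?_ ?_,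
    hc₂.opposite _ ?_ ?_ ?_ ?_ ?_ ?_⟩ <;> exact (M.lab d).injective.ne (by decide)

/-- Add the relations at the vertex 0 of both new tetrahedra; the edges 02 and 03 cancel. -/
theorem Transit.sum01 [Fintype τ₁] [Fintype τ₂] (h : M.Transit c₁ c₂) (hc₂ : IsRoughCharge c₂) :
    M.sum c₂ 0 1 (by decide) = 2 := by
  have h02 := h.sum02
  have h03 := h.sum03
  rw [NewPair.sum, Fin.sum_univ_two] at h02 h03 ⊢
  linarith [chargeAt_vertex (M := M) hc₂ 0, chargeAt_vertex (M := M) hc₂ 1]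

theorem Transit.sum23 [Fintype τ₁] [Fintype τ₂] (h : M.Transit c₁ c₂) (hc₂ : IsRoughCharge c₂) :
    M.sum c₂ 2 3 (by decide) = 2 := by
  rw [← h.sum01 hc₂, NewPair.sum, NewPair.sum]
  exact Finset.sum_congr rfl fun d _ => (charge_opposite hc₂ d).1.symm

variable [Fintype τ₁] [Fintype τ₂]

/-- The pillow contributes 0: the edges 01 and 23 lie in other classes, and along each of the four
remaining labels the two charges cancel. -/
theorem edgeSum_oldEdge (h : M.Transit c₁ c₂) {q : AbsEdge τ₁} (hq : T₁.proj q ≠ M.e₀) :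
    edgeSum T₂ c₂ (T₂.proj (M.oldEdge q)) = edgeSum T₁ c₁ (T₁.proj q) := by
  classical
  have hs : ¬ M.IsSplit (T₂.proj (M.oldEdge q)) := fun hs => hq ((M.isSplit_oldEdge_iff q).1 hs)
  have h01 : ∀ d, ¬ T₂.proj (M.edge d 0 1 (by decide)) = T₂.proj (M.oldEdge q) := fun d hd =>
    hs (hd ▸ M.isSplit_edge d _ (.inl ⟨rfl, rfl⟩))
  have h23 : ∀ d, ¬ T₂.proj (M.edge d 2 3 (by decide)) = T₂.proj (M.oldEdge q) := by
    intro d hd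
    rw [M.proj_edge d 0 _ (by decide)] at hd
    obtain ⟨d', hd'⟩ := (M.proj_eq_interior_iff _).1 hd.symm
    exact M.oldEdge_ne_edge _ _ _ hd'
  have h02 := h.sum02
  have h03 := h.sum03
  have h12 := h.sum12
  have h13 := h.sum13
  rw [NewPair.sum] at h02 h03 h12 h13
  rw [edgeSum, Finset.sum_filter, M.sum_absEdge,
    M.sum_ite_edge (a := 0) (b := 2) _ _ _ (by decide),
    M.sum_ite_edge (a := 0) (b := 3) _ _ _ (by decide),
    M.sum_ite_edge (a := 1) (b := 2) _ _ _ (by decide),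
    M.sum_ite_edge (a := 1) (b := 3) _ _ _ (by decide), h02, h03, h12, h13]
  simp only [h01, h23, ite_self, if_false, Finset.sum_const_zero, add_zero, ← h.common]
  rw [edgeSum, Finset.sum_filter]
  refine Finset.sum_congr rfl fun q' _ => if_congr ?_ rfl rfl
  rw [eq_comm, M.proj_oldEdge_eq_iff hq, eq_comm]

theorem edgeSum_interior (h : M.Transit c₁ c₂) (hc₂ : IsRoughCharge c₂) :
    edgeSum T₂ c₂ (T₂.proj (M.edge 0 2 3 (by decide))) = 2 := by
  classical
  rw [← h.sum23 hc₂]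
  symm
  refine Finset.sum_nbij (fun d => M.edge d 2 3 (by decide)) ?_ ?_ ?_ fun _ _ => rfl
  · intro d _
    simpa using M.proj_edge d 0 _ (by decide)
  · intro d _ d' _ hd
    exact (M.edge_inj.1 hd).1
  · intro p hp
    obtain ⟨d, rfl⟩ := (M.proj_eq_interior_iff p).1 (Finset.mem_filter.1 hp).2
    exact ⟨d, by simp, rfl⟩

/-- The second of the two edges into which `e₀` is split has charge sum `2`. -/
theorem edgeSum_split (h : M.Transit c₁ c₂) (hc₂ : IsRoughCharge c₂) :
    edgeSum T₂ c₂ (T₂.proj (M.edge 1 0 1 (by decide))) = 2 := by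
  classical
  have h02 := h.sum02
  have h03 := h.sum03
  have h12 := h.sum12
  have h13 := h.sum13
  have h01 := h.sum01 hc₂
  rw [NewPair.sum] at h02 h03 h12 h13
  rw [NewPair.sum, Fin.sum_univ_two] at h01
  have hsum : ∀ e : T₂.Edge, (¬ T₂.proj (M.edge 0 2 3 (by decide)) = e) →
      edgeSum T₂ c₂ e = ∑ q, (if T₂.proj (M.oldEdge q) = e then c₂ (M.oldEdge q) else 0) +
      ∑ d, (if T₂.proj (M.edge d 0 1 (by decide)) = e then c₂ (M.edge d 0 1 (by decide))
        else 0) := by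
    intro e he
    rw [edgeSum, Finset.sum_filter, M.sum_absEdge,
      M.sum_ite_edge (a := 0) (b := 2) _ _ _ (by decide),
      M.sum_ite_edge (a := 0) (b := 3) _ _ _ (by decide),
      M.sum_ite_edge (a := 1) (b := 2) _ _ _ (by decide),
      M.sum_ite_edge (a := 1) (b := 3) _ _ _ (by decide),
      M.sum_ite_edge (a := 2) (b := 3) _ _ _ (by decide), h02, h03, h12, h13, if_neg he]
    simp only [ite_self, add_zero]
  -- The old edges around `e₀` are divided between its two halves, and each half receives the edge
  -- 01 of one new tetrahedron. Together the halves thus have the sum of `e₀` plus 2, and `h.split`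
  -- accounts for the first half.
  have h1 : ∑ q, (if T₂.proj (M.oldEdge q) = T₂.proj (M.edge 0 0 1 (by decide)) then
        c₂ (M.oldEdge q) else 0) +
      ∑ q, (if T₂.proj (M.oldEdge q) = T₂.proj (M.edge 1 0 1 (by decide)) then
        c₂ (M.oldEdge q) else 0) = edgeSum T₁ c₁ M.e₀ := by
    rw [edgeSum, Finset.sum_filter, ← Finset.sum_add_distrib]
    refine Finset.sum_congr rfl fun q _ => ?_
    rw [h.common]
    have hq := M.split q
    by_cases h0 : T₂.proj (M.oldEdge q) = T₂.proj (M.edge 0 0 1 (by decide))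
    · rw [if_pos h0, if_neg (h0 ▸ M.split_ne), if_pos (hq.2 (.inl h0)), add_zero]
    · rw [if_neg h0, zero_add]
      exact if_congr (by rw [hq, or_iff_right h0]) rfl rfl
  have h2 := hsum _ (interior_not_isSplit 0)
  have h3 := hsum _ (interior_not_isSplit 1)
  rw [Fin.sum_univ_two, if_pos rfl, if_neg M.split_ne.symm] at h2
  rw [Fin.sum_univ_two, if_pos rfl, if_neg M.split_ne] at h3
  have h4 := h.split
  linarith

end EdgeSums

end ZeroTwoMove

/-! ### The 0-2 move: transport of potentials and the defect -/

theorem sum_compl_edge {a b d e : Fin 4} (hab : a ≠ b) (had : a ≠ d) (hae : a ≠ e) (hbd : b ≠ d)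
    (hbe : b ≠ e) (hde : d ≠ e) (f : Fin 4 → ZMod 2) :
    ∑ v with v ∉ s(a, b), f v = f d + f e := by
  rw [← Finset.sum_pair hde]
  refine Finset.sum_congr ?_ fun _ _ => rfl
  ext v
  simp only [Finset.mem_filter, Finset.mem_univ, true_and, Sym2.mem_iff, Finset.mem_insert,
    Finset.mem_singleton]
  have key : ∀ a b d e v : Fin 4, a ≠ b → (a ≠ d ∧ b ≠ d) ∧ (a ≠ e ∧ b ≠ e) → d ≠ e →
    (¬ (v = a ∨ v = b) ↔ v = d ∨ v = e) := by decide
  exact key a b d e v hab ⟨⟨had, hbd⟩, hae, hbe⟩ hde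

namespace ZeroTwoMove

open NewPair

variable {τ₁ τ₂ : Type*} {T₁ : Triangulation τ₁} {T₂ : Triangulation τ₂} {M : ZeroTwoMove T₁ T₂}
  {c₁ : AbsEdge τ₁ → ℤ} {c₂ : AbsEdge τ₂ → ℤ}

section Potentials

variable [Fintype τ₁] [Fintype τ₂]

theorem Transit.even (h : M.Transit c₁ c₂) {a b : Fin 4} (hab : (a = 0 ∨ a = 1) ∧ (b = 2 ∨ b = 3))
    (hne : a ≠ b) {d d' : Fin 2} (hd : d ≠ d') :
    (c₂ (M.edge d a b hne) : ZMod 2) + (c₂ (M.edge d' a b hne) : ZMod 2) = 0 := by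
  have hs : M.sum c₂ a b hne = 0 := by
    rcases hab with ⟨rfl | rfl, rfl | rfl⟩
    exacts [h.sum02, h.sum03, h.sum12, h.sum13]
  rw [NewPair.sum_eq _ _ _ hd] at hs
  exact_mod_cast congrArg (Int.cast : ℤ → ZMod 2) hs

/-- Arriving at a face of one new tetrahedron, crossing to the face with the same labels in the
other one, and leaving it changes the potential by 1 + 1 = 0, so restriction to the old tetrahedra
respects the collapsed gluings. -/
theorem isPotential₁ (h : M.Transit c₁ c₂) {φ₂ : τ₂ → Fin 4 → ZMod 2}
    (hφ : IsPotential T₂ c₂ φ₂) : IsPotential T₁ c₁ fun t v => φ₂ (M.common t).1 v := by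
  have h2 : (2 : ZMod 2) = 0 := rfl
  refine ⟨fun x => ?_, NewPair.restrict_add h.common hφ.tet⟩
  change φ₂ (M.old (T₁.glue x)).tet (M.old (T₁.glue x)).opp =
    φ₂ (M.old x).tet (M.old x).opp + 1
  rw [← hφ.glue]
  have key : ∀ u v, M.Through T₂ u v → φ₂ v.tet v.opp = φ₂ u.tet u.opp := by
    intro u v huv
    induction huv with
    | arrive x => rfl
    | pass d d' m v hd h0 h1 _ ih =>
      rw [ih, hφ.glue]
      obtain ⟨a, ha⟩ := exists_missing_label m
      have ha0 : 0 ≠ a := (ha 0).1 h0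
      have ha23 : a = 2 ∨ a = 3 := by
        have key : ∀ a : Fin 4, 0 ≠ a → 1 ≠ a → a = 2 ∨ a = 3 := by decide
        exact key a ha0 ((ha 1).1 h1)
      rw [M.face_opp d ha, M.face_opp d' ha]
      change φ₂ (M.tet d') _ + 1 = φ₂ (M.tet d) _
      -- The crossing is made through the inner face 123, and the evenness used is that of the edges
      -- joining 0 to `a`.
      obtain ⟨m', -, -, hm'⟩ := exists_face_labels (a := 2) (b := 3) (v := 0) (by decide)
        (by decide) (by decide)
      have e3 := hφ.glue (M.face d m')
      rw [M.glue_inner hd ((hm' 2).2 (by decide)) ((hm' 3).2 (by decide)), M.face_opp d hm',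
        M.face_opp d' hm'] at e3
      change φ₂ (M.tet d') _ = φ₂ (M.tet d) _ + 1 at e3
      have e4 := hφ.tet (M.tet d) _ _ ((M.lab d).injective.ne ha0)
      have e5 := hφ.tet (M.tet d') _ _ ((M.lab d').injective.ne ha0)
      rw [M.chargeAt_lab _ _ ha0] at e4 e5
      linear_combination e5 - e4 - e3 - h.even ⟨.inl rfl, ha23⟩ ha0 hd +
        (c₂ (M.edge d' 0 a ha0) : ZMod 2) * h2
  exact key _ _ (M.outer x)

/-- If a function on faces changes along the gluings, and inside the tetrahedra its changes are
as for a potential except possibly by the amounts `ε` in the new ones, then the latter vanish. -/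
theorem defect_eq_zero (h : M.Transit c₁ c₂) (hc₁ : IsRoughCharge c₁) (hc₂ : IsRoughCharge c₂)
    (heven : edgeSum T₁ c₁ M.e₀ = 0 ∨ edgeSum T₁ c₁ M.e₀ = 2) {φ₁ : τ₁ → Fin 4 → ZMod 2}
    (hφ : ∀ t a b, a ≠ b → φ₁ t a + φ₁ t b = 1 + (chargeAt c₁ t a b : ZMod 2))
    {z w : Fin 2 → ZMod 2} (hz : z 1 = z 0 + 1) (hw : w 1 = w 0 + 1)
    (hglue : ∀ y, M.extend φ₁ (fun d a => if a = 3 then w d else M.labelPot c₂ 2 z d a)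
        (T₂.glue y).tet (T₂.glue y).opp =
      M.extend φ₁ (fun d a => if a = 3 then w d else M.labelPot c₂ 2 z d a) y.tet y.opp + 1)
    (d : Fin 2) : w d = M.labelPot c₂ 2 z d 3 := by
  classical
  have h2 : (2 : ZMod 2) = 0 := rfl
  set s : Fin 2 → Fin 4 → ZMod 2 := fun d a => if a = 3 then w d else M.labelPot c₂ 2 z d a
    with hs
  set ψ := M.extend φ₁ s with hψ
  let C : Fin 2 → ∀ a b : Fin 4, a ≠ b → ZMod 2 := fun d a b h => (c₂ (M.edge d a b h) : ZMod 2)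
  -- The defect of `tet d`: the prescribed values on its two outer faces should differ by 1 plus the
  -- charge of the edge between them.
  let ε : Fin 2 → ZMod 2 := fun d => z d + w d + 1 + C d 0 1 (by decide)
  have hv : ∀ d, C d 0 1 (by decide) + C d 0 2 (by decide) + C d 0 3 (by decide) = 1 := by
    intro d
    have hd := congrArg (Int.cast : ℤ → ZMod 2) (chargeAt_vertex (M := M) hc₂ d)
    push_cast at hd
    exact hd
  have ho := fun d => charge_opposite (M := M) hc₂ d
  have ho1 : ∀ d, C d 2 3 (by decide) = C d 0 1 (by decide) :=
    fun d => congrArg (Int.cast : ℤ → ZMod 2) (ho d).1.symm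
  have ho2 : ∀ d, C d 1 3 (by decide) = C d 0 2 (by decide) :=
    fun d => congrArg (Int.cast : ℤ → ZMod 2) (ho d).2.1.symm
  have ho3 : ∀ d, C d 1 2 (by decide) = C d 0 3 (by decide) :=
    fun d => congrArg (Int.cast : ℤ → ZMod 2) (ho d).2.2.symm
  have s0 : ∀ d, s d 0 = z d + 1 + C d 0 2 (by decide) := fun d => by
    rw [hs]
    simp only [if_neg (show ¬ (0 : Fin 4) = 3 by decide)]
    rw [labelPot_of_ne (by decide), M.edge_comm]
  have s1 : ∀ d, s d 1 = z d + 1 + C d 1 2 (by decide) := fun d => by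
    rw [hs]
    simp only [if_neg (show ¬ (1 : Fin 4) = 3 by decide)]
    rw [labelPot_of_ne (by decide), M.edge_comm]
  have s2 : ∀ d, s d 2 = z d := fun d => by
    rw [hs]
    simp only [if_neg (show ¬ (2 : Fin 4) = 3 by decide), labelPot_self]
  have s3 : ∀ d, s d 3 = w d := fun d => rfl
  -- The failure of `ψ` to be a potential between the two faces containing `p`. Only the value
  -- opposite to 3 can be wrong, so `D` equals `ε d` on the edges of the face 012 and 0 elsewhere.
  let D : AbsEdge τ₂ → ZMod 2 := fun p => (1 + ∑ v with v ∉ p.2.1, ψ p.1 v) + (c₂ p : ZMod 2)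
  have hDold : ∀ q, D (M.oldEdge q) = 0 := by
    intro q
    obtain ⟨a, b, hab, hq⟩ := Triangulation.exists_absEdge_eq q
    have key : ∀ a b : Fin 4, ∃ d e, (a ≠ d ∧ a ≠ e) ∧ (b ≠ d ∧ b ≠ e) ∧ d ≠ e := by decide
    obtain ⟨d, e, ⟨had, hae⟩, ⟨hbd, hbe⟩, hde⟩ := key a b
    have h1 := hφ q.1 d e hde
    rw [← hc₁.opposite q.1 hab had hae hbd hbe hde, chargeAt_of_ne _ _ hab, ← hq] at h1
    have h3 : D (M.oldEdge q) = (1 + (φ₁ q.1 d + φ₁ q.1 e)) + (c₁ q : ZMod 2) := by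
      have hq2 : s(a, b) = q.2.1 := (congrArg (fun p : AbsEdge τ₁ => p.2.1) hq).symm
      have hψ' : ∀ v, φ₁ q.1 v = ψ (M.common q.1).1 v := fun v => (extend_common q.1 v).symm
      rw [← sum_compl_edge hab had hae hbd hbe hde, h.common]
      simp only [hψ', hq2]
      rfl
    rw [h3, h1]
    linear_combination (1 + (c₁ q : ZMod 2)) * h2
  have hDnew : ∀ d {a b i j : Fin 4} (hab : a ≠ b), (a ≠ i ∧ a ≠ j) ∧ (b ≠ i ∧ b ≠ j) ∧ i ≠ j →
      D (M.edge d a b hab) = 1 + (s d i + s d j) + C d a b hab := by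
    rintro d a b i j hab ⟨⟨hai, haj⟩, ⟨hbi, hbj⟩, hij⟩
    have inj := (M.lab d).injective
    have h3 := sum_compl_edge (inj.ne hab) (inj.ne hai) (inj.ne haj) (inj.ne hbi) (inj.ne hbj)
      (inj.ne hij) (ψ (M.tet d))
    rw [hψ, extend_tet, extend_tet] at h3
    simp only [D, C]
    rw [← h3]
    rfl
  have D01 : ∀ d, D (M.edge d 0 1 (by decide)) = ε d := fun d => by
    rw [hDnew d (i := 2) (j := 3) _ (by decide), s2, s3]
    simp only [ε]
    ring
  have D02 : ∀ d, D (M.edge d 0 2 (by decide)) = ε d := fun d => by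
    rw [hDnew d (i := 1) (j := 3) _ (by decide), s1, s3, ho3]
    simp only [ε]
    linear_combination hv d + (1 - C d 0 1 (by decide)) * h2
  have D03 : ∀ d, D (M.edge d 0 3 (by decide)) = 0 := fun d => by
    rw [hDnew d (i := 1) (j := 2) _ (by decide), s1, s2, ho3]
    linear_combination (1 + z d + C d 0 3 (by decide)) * h2
  have D12 : ∀ d, D (M.edge d 1 2 (by decide)) = ε d := fun d => by
    rw [hDnew d (i := 0) (j := 3) _ (by decide), s0, s3, ho3]
    simp only [ε]
    linear_combination hv d + (1 - C d 0 1 (by decide)) * h2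
  have D13 : ∀ d, D (M.edge d 1 3 (by decide)) = 0 := fun d => by
    rw [hDnew d (i := 0) (j := 2) _ (by decide), s0, s2, ho2]
    linear_combination (1 + z d + C d 0 2 (by decide)) * h2
  have D23 : ∀ d, D (M.edge d 2 3 (by decide)) = 0 := fun d => by
    rw [hDnew d (i := 0) (j := 1) _ (by decide), s0, s1, ho1, ho3]
    linear_combination hv d + (2 + z d) * h2
  -- Both outer values change by 1 from one side of the pillow to the other, and the charges along
  -- 01 add up to 2.
  have hε : ε 0 + ε 1 = 0 := by
    have h01 := congrArg (Int.cast : ℤ → ZMod 2) (h.sum01 hc₂)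
    rw [NewPair.sum, Fin.sum_univ_two] at h01
    push_cast at h01
    simp only [ε, C]
    linear_combination hz + hw + h01 + (z 0 + w 0 + 3) * h2
  -- By `sum_faces_around_edge` the face terms vanish, leaving the charge sum around this edge,
  -- which transit identifies with the even sum around `e₀`.
  have hsum : ∑ p : AbsEdge τ₂, (if T₂.proj p = T₂.proj (M.edge 0 0 1 (by decide)) then D p else 0)
      = 0 := by
    rw [← Finset.sum_filter, Finset.sum_add_distrib, sum_faces_around_edge T₂ hglue, zero_add,
      ← Int.cast_sum]
    change ((edgeSum T₂ c₂ (T₂.proj (M.edge 0 0 1 (by decide))) : ℤ) : ZMod 2) = 0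
    rw [← h.split]
    rcases heven with h' | h' <;> rw [h'] <;> rfl
  rw [M.sum_absEdge,
    M.sum_ite_edge (a := 0) (b := 2) _ _ _ (by decide),
    M.sum_ite_edge (a := 0) (b := 3) _ _ _ (by decide),
    M.sum_ite_edge (a := 1) (b := 2) _ _ _ (by decide),
    M.sum_ite_edge (a := 1) (b := 3) _ _ _ (by decide),
    M.sum_ite_edge (a := 2) (b := 3) _ _ _ (by decide)] at hsum
  -- The edges 02 and 12 of the two tetrahedra enter in pairs, giving ε 0 + ε 1 = 0. The edge 01
  -- enters only through `tet 0`, because its copy in `tet 1` is a different edge by `split_ne`.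
  -- What remains is ε 0.
  simp only [hDold, D01, D02, D03, D12, D13, D23, Fin.sum_univ_two, hε, ite_self, add_zero,
    Finset.sum_const_zero, zero_add, if_true, if_neg M.split_ne.symm] at hsum
  have hεd : ε d = 0 := by
    fin_cases d
    · exact hsum
    · simpa [hsum] using hε
  rw [labelPot_of_ne (by decide)]
  change w d = z d + 1 + C d 2 3 (by decide)
  rw [ho1]
  simp only [ε] at hεd
  linear_combination hεd - (z d + 1 + C d 0 1 (by decide)) * h2

/-- The four outer faces of the pillow inherit values from the old faces to which they collapse, and
the inner ones are computed from the face opposite to 2. The gluing rule then holds by construction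
and local evenness; consistency of `w` with `z` inside each tetrahedron is the global point, settled
by `defect_eq_zero`. -/
theorem exists_isPotential₂ (h : M.Transit c₁ c₂) (hc₁ : IsRoughCharge c₁)
    (hc₂ : IsRoughCharge c₂) (heven : edgeSum T₁ c₁ M.e₀ = 0 ∨ edgeSum T₁ c₁ M.e₀ = 2)
    {φ₁ : τ₁ → Fin 4 → ZMod 2} (hφ : IsPotential T₁ c₁ φ₁) : ∃ φ₂, IsPotential T₂ c₂ φ₂ := by
  have h2 : (2 : ZMod 2) = 0 := rfl
  obtain ⟨m₂, -, -, hm₂⟩ := exists_face_labels (a := 0) (b := 1) (v := 2) (by decide)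
    (by decide) (by decide)
  obtain ⟨m₃, -, -, hm₃⟩ := exists_face_labels (a := 0) (b := 1) (v := 3) (by decide)
    (by decide) (by decide)
  choose x hx using fun d => M.exists_through (d := d) ((hm₂ 0).2 (by decide))
    ((hm₂ 1).2 (by decide))
  choose y hy using fun d => M.exists_through (d := d) ((hm₃ 0).2 (by decide))
    ((hm₃ 1).2 (by decide))
  let z : Fin 2 → ZMod 2 := fun d => φ₁ (x d).tet (x d).opp
  let w : Fin 2 → ZMod 2 := fun d => φ₁ (y d).tet (y d).opp
  have hz : ∀ d d', d ≠ d' → z d' = z d + 1 := by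
    intro d d' hd
    have := M.old_injective ((hx d').unique (M.through_other_face hd (hx d)))
    simp only [z, this, hφ.glue]
  have hw : ∀ d d', d ≠ d' → w d' = w d + 1 := by
    intro d d' hd
    have := M.old_injective ((hy d').unique (M.through_other_face hd (hy d)))
    simp only [w, this, hφ.glue]
  let s : Fin 2 → Fin 4 → ZMod 2 := fun d a => if a = 3 then w d else M.labelPot c₂ 2 z d a
  -- The extended function is constant along passages through the collapsed pillow, so every outer
  -- gluing inherits its change by 1 from `T₁`.
  have hthrough : ∀ {u : OrdTri τ₂} {v : OrdTri τ₁}, M.Through T₂ u (M.old v) →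
      M.extend φ₁ s u.tet u.opp = φ₁ v.tet v.opp := by
    intro u v huv
    rcases M.old_or_face u with ⟨v', rfl⟩ | ⟨d, m, rfl⟩
    · rw [M.old_injective huv.eq_of_old, extend_old]
    · obtain ⟨d', hd⟩ : ∃ d', d ≠ d' := exists_ne d |>.imp fun _ => Ne.symm
      obtain ⟨h0, h1, -⟩ := huv.of_face hd
      obtain ⟨a, ha⟩ := exists_missing_label m
      have ha23 : a = 2 ∨ a = 3 := by
        have key : ∀ a : Fin 4, 0 ≠ a → 1 ≠ a → a = 2 ∨ a = 3 := by decide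
        exact key a ((ha 0).1 h0) ((ha 1).1 h1)
      rw [extend_face d ha]
      rcases ha23 with rfl | rfl
      · obtain ⟨π, hπ⟩ := OrdTri.exists_reorder_eq (x := M.face d m) (y := M.face d m₂) rfl
          (by rw [M.face_opp d ha, M.face_opp d hm₂])
        rw [hπ] at huv
        have := M.old_injective (show M.old v = M.old ((x d).reorder π) from
          huv.unique ((hx d).reorder π))
        rw [this, OrdTri.opp_reorder, OrdTri.tet_reorder]
        simp only [s, if_neg (show ¬ (2 : Fin 4) = 3 by decide), labelPot_self, z]
      · obtain ⟨π, hπ⟩ := OrdTri.exists_reorder_eq (x := M.face d m) (y := M.face d m₃) rfl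
          (by rw [M.face_opp d ha, M.face_opp d hm₃])
        rw [hπ] at huv
        have := M.old_injective (show M.old v = M.old ((y d).reorder π) from
          huv.unique ((hy d).reorder π))
        rw [this, OrdTri.opp_reorder, OrdTri.tet_reorder]
        simp only [s, if_true, w]
  have hglue : ∀ u, M.extend φ₁ s (T₂.glue u).tet (T₂.glue u).opp =
      M.extend φ₁ s u.tet u.opp + 1 := by
    have hglue' : ∀ {u : OrdTri τ₂} {v : OrdTri τ₁}, M.Through T₂ u (M.old v) →
        M.extend φ₁ s (T₂.glue u).tet (T₂.glue u).opp = M.extend φ₁ s u.tet u.opp + 1 := by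
      intro u v huv
      rw [hthrough huv, hthrough (M.through_glue huv), hφ.glue]
    intro u
    rcases M.old_or_face u with ⟨v, rfl⟩ | ⟨d, m, rfl⟩
    · exact hglue' (.arrive v)
    rcases face_cases m with ⟨h0, h1⟩ | ⟨hm2, hm3⟩
    · obtain ⟨v, hv⟩ := M.exists_through (d := d) h0 h1
      exact hglue' hv
    · obtain ⟨d', hd⟩ : ∃ d', d ≠ d' := exists_ne d |>.imp fun _ => Ne.symm
      obtain ⟨a, ha⟩ := exists_missing_label m
      have ha2 : 2 ≠ a := (ha 2).1 hm2
      have ha3 : 3 ≠ a := (ha 3).1 hm3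
      have ha01 : a = 0 ∨ a = 1 := by
        have key : ∀ a : Fin 4, 2 ≠ a → 3 ≠ a → a = 0 ∨ a = 1 := by decide
        exact key a ha2 ha3
      rw [M.glue_inner hd hm2 hm3, extend_face d ha, extend_face d' ha]
      simp only [s, if_neg ha3.symm]
      rw [labelPot_of_ne ha2, labelPot_of_ne ha2, hz d d' hd, M.edge_comm d, M.edge_comm d']
      linear_combination h.even ⟨ha01, .inl rfl⟩ ha2.symm hd -
        (c₂ (M.edge d a 2 ha2.symm) : ZMod 2) * h2
  have hs : s = M.labelPot c₂ 2 z := by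
    funext d a
    by_cases ha : a = 3
    · subst ha
      exact (if_pos rfl).trans (defect_eq_zero h hc₁ hc₂ heven hφ.tet (hz 0 1 (by decide))
        (hw 0 1 (by decide)) hglue d)
    · exact if_neg ha
  refine ⟨M.extend φ₁ s, hglue, extend_add h.common hφ.tet ?_⟩
  rw [hs]
  exact labelPot_add hc₂ 2 z

end Potentials

variable [Fintype τ₁] [Fintype τ₂] {H₁ : Set T₁.Edge} {H₂ : Set T₂.Edge}

theorem isIntegralCharge₂ (hM : M.IsDistinguished H₁ H₂) (hc₁ : IsIntegralCharge T₁ H₁ c₁)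
    (hc₂ : IsRoughCharge c₂) (h : M.Transit c₁ c₂) : IsIntegralCharge T₂ H₂ c₂ := by
  have heven : edgeSum T₁ c₁ M.e₀ = 0 ∨ edgeSum T₁ c₁ M.e₀ = 2 := by
    by_cases he : M.e₀ ∈ H₁
    · exact .inl (hc₁.sum_of_mem _ he)
    · exact .inr (hc₁.sum_of_notMem _ he)
  obtain ⟨φ₁, hφ₁⟩ := exists_isPotential hc₁.rough hc₁.curve
  obtain ⟨φ₂, hφ₂⟩ := exists_isPotential₂ h hc₁.rough hc₂ heven hφ₁
  refine ⟨hc₂, fun e he => ?_, fun e he => ?_, hφ₂.curve hc₂⟩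
  · rcases M.proj_cases e with (rfl | rfl) | rfl | ⟨q, hq, rfl⟩
    · rw [← h.split]
      exact hc₁.sum_of_notMem _ fun h' => he (hM.split.1 h')
    · exact edgeSum_split h hc₂
    · exact edgeSum_interior h hc₂
    · rw [edgeSum_oldEdge h hq]
      exact hc₁.sum_of_notMem _ fun h' => he ((hM.common q hq).1 h')
  · rcases M.proj_cases e with (rfl | rfl) | rfl | ⟨q, hq, rfl⟩
    · rw [← h.split]
      exact hc₁.sum_of_mem _ (hM.split.2 he)
    · exact (hM.new he).elim
    · exact (hM.interior he).elim
    · rw [edgeSum_oldEdge h hq]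
      exact hc₁.sum_of_mem _ ((hM.common q hq).2 he)

theorem isIntegralCharge₁ (hM : M.IsDistinguished H₁ H₂) (hc₂ : IsIntegralCharge T₂ H₂ c₂)
    (hc₁ : IsRoughCharge c₁) (h : M.Transit c₁ c₂) : IsIntegralCharge T₁ H₁ c₁ := by
  obtain ⟨φ₂, hφ₂⟩ := exists_isPotential hc₂.rough hc₂.curve
  refine ⟨hc₁, ?_, ?_, (isPotential₁ h hφ₂).curve hc₁⟩
  · rintro ⟨q⟩ hq
    change T₁.proj q ∉ H₁ at hq
    change edgeSum T₁ c₁ (T₁.proj q) = 2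
    by_cases he : T₁.proj q = M.e₀
    · rw [he] at hq ⊢
      rw [h.split]
      exact hc₂.sum_of_notMem _ fun h' => hq (hM.split.2 h')
    · rw [← edgeSum_oldEdge h he]
      exact hc₂.sum_of_notMem _ fun h' => hq ((hM.common q he).2 h')
  · rintro ⟨q⟩ hq
    change T₁.proj q ∈ H₁ at hq
    change edgeSum T₁ c₁ (T₁.proj q) = 0
    by_cases he : T₁.proj q = M.e₀
    · rw [he] at hq ⊢
      rw [h.split]
      exact hc₂.sum_of_mem _ (hM.split.1 hq)
    · rw [← edgeSum_oldEdge h he]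
      exact hc₂.sum_of_mem _ ((hM.common q he).1 hq)

end ZeroTwoMove

end ChargedTri

theorem mainTheorem9 {W : Type*} [TopologicalSpace W] [T2Space W] [CompactSpace W]
    [ChartedSpace (EuclideanSpace ℝ (Fin 3)) W] (L : Set W) (hL : ChargedTri.IsLink L)
    {τ₁ τ₂ : Type*} [Fintype τ₁] [Fintype τ₂]
    (T₁ : ChargedTri.Triangulation τ₁) (H₁ : Set T₁.Edge)
    (T₂ : ChargedTri.Triangulation τ₂) (H₂ : Set T₂.Edge)
    (h₁ : T₁.IsDistinguished H₁ L) (h₂ : T₂.IsDistinguished H₂ L)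
    (move : ChargedTri.DistinguishedMove T₁ H₁ T₂ H₂)
    (c₁ : ChargedTri.AbsEdge τ₁ → ℤ) (c₂ : ChargedTri.AbsEdge τ₂ → ℤ)
    (hc₁ : ChargedTri.IsIntegralCharge T₁ H₁ c₁) (hc₂ : ChargedTri.IsRoughCharge c₂)
    (transit : move.Transit c₁ c₂) :
    ChargedTri.IsIntegralCharge T₂ H₂ c₂ := by
  cases move with
  | twoThree M h => exact M.isIntegralCharge₂ h hc₁ hc₂ transit
  | threeTwo M h => exact M.isIntegralCharge₁ h hc₁ hc₂ transit
  | zeroTwo M h => exact M.isIntegralCharge₂ h hc₁ hc₂ transit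
  | twoZero M h => exact M.isIntegralCharge₁ h hc₁ hc₂ transit
  | bubble M h => exact M.isIntegralCharge₂ h hc₁ hc₂ transit
  | bubbleInv M h => exact M.isIntegralCharge₁ h hc₁ hc₂ transit
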